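/- Let $\mathfrak g$ be a finite-dimensional simple Lie algebra over $\mathbb C$ with Killing form $\langle\cdot|\cdot\rangle$, and let $e,h,f\in\mathfrak g$ satisfy $[h,e]=2e$, $[h,f]=-2f$, $[e,f]=h$. Let $\mathfrak g=\bigoplus_{i\in\mathbb Z}\mathfrak g_i$ be a Lie algebra grading with $f\in\mathfrak g_{-2}$, $h\in\mathfrak g_0$, $e\in\mathfrak g_2$ such that $\operatorname{ad}f:\mathfrak g_j\to\mathfrak g_{j-2}$ is injective for $j\ge1$ and surjective for $j\le1$. Let $\mathfrak l\subset\mathfrak g_{-1}$ be isotropic for the form $(x,y)=\langle e|[x,y]\rangle$, put $\mathfrak l'=\{x\in\mathfrak g_{-1}:(x,\mathfrak l)=0\}$, $\mathfrak m=\mathfrak l\oplus\bigoplus_{i\le-2}\mathfrak g_i$, $\mathfrak n=\mathfrak l'\oplus\bigoplus_{i\le-2}\mathfrak g_i$, let $\mathfrak b$ be the orthogonal complement of $\mathfrak n$, and let $a\in\mathfrak g$ satisfy $[a,\mathfrak n]=0$. Let $\mathfrak L(\mathfrak g)=C^\infty(S^1,\mathfrak g)$, with the form $(u|v)=\int_{S^1}\langle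 u|v\rangle dx$, by which gradients $\delta F$ of functionals are defined. For a parameter $\epsilon\neq0$ consider the Poisson tensors $P_2(z)(v)=\frac1\epsilon[\epsilon\partial_x+z,v]$ and $P_1(z)(v)=\frac1\epsilon[a,v]$, the pencil $P_\lambda=P_2+\lambda P_1$, and the brackets $\{F,G\}=(\delta F|P\,\delta G)$ on local functionals (integrals of differential polynomials). Put $S=e+\mathfrak L(\mathfrak b)$, $Q=e+\mathfrak L(\mathfrak g_f)$ with $\mathfrak g_f=\ker\operatorname{ad}f$, and $D=P_2(\mathfrak L(\mathfrak n))$. Choose a basis $\xi_1,\dots,\xi_n$ of $\mathfrak g$ with $\xi_1,\dots,\xi_m$ a basis of $\mathfrak g_f$, with dual basis $\xi^1,\dots,\xi^n$, and the coordinates $q^I(z)=\langle z-e|\xi^I\rangle$, and write $$\{q^I(x),q^J(y)\}_\lambda=\mathbb F^{IJ}_\lambda\,\tfrac1\epsilon\,\delta(x-y),\qquad \mathbb F^{IJ}_\lambda\varphi=\langle\xi^I|[\epsilon\partial_x+z+\lambda a,\varphi\,\xi^J]\rangle .$$ Let Latin indices run over $1,\dots,m$ and Greek indices over $m+1,\dots,n$,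 so that $Q=\{q^\alpha=0\}$. Below, a matrix differential operator on $Q$ means one of finite order in $\epsilon\partial_x$ whose coefficients are differential polynomials in the $q^i$, formed with $\epsilon\partial_x$ and with coefficients that do not depend on $\epsilon$. Then the following holds. 1. (Generalized Drinfeld–Sokolov, or bihamiltonian, reduction.) There are matrix differential operators $P_1^Q$, $P_2^Q$ on $Q$ such that, for every $\epsilon\ne0$ and $k=1,2$, the bracket $\{f,g\}_k^Q=\int\sum_{i,j}\frac{\delta f}{\delta q^i}\,\frac1\epsilon (P_k^Q)^{ij}\frac{\delta g}{\delta q^j}\,dx$ of local functionals on $Q$ is the reduction of $P_k$: $\{f,g\}_k^Q=\{F,G\}_k|_Q$ for all local functionals $F,G$ on $\mathfrak L(\mathfrak g)$ that extend $f,g$ and whose differentials vanish on $D$ at the points of $S$. Every $f$ has such an extension, and it can be chosen with a density whose restriction to $S$ is invariant under the gauge action $z\mapsto\exp(-\operatorname{ad}m)(\epsilon\partial_x+z)-\epsilon\partial_x$, $m\in\mathfrak L(\mathfrak m)$. 2. (Dirac reduction.) For every $\lambda\in\mathbb C$ the Dirac reduction of $P_\lambda$ to $Q$ is well defined: the minor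 $(\mathbb F_\lambda^{\alpha\beta})$ restricted to $Q$ has a two-sided inverse $(\mathbb S_{\alpha\beta})$ which is a matrix differential operator on $Q$. For every $\epsilon\neq0$ it equals the reduced pencil, $$\mathbb F_\lambda^{ij}-\mathbb F_\lambda^{i\alpha}\,\mathbb S_{\alpha\beta}\,\mathbb F_\lambda^{\beta j}=(P_2^Q)^{ij}+\lambda\,(P_1^Q)^{ij},$$ it defines a local Poisson bracket on $Q$ (skew-symmetric, with the Jacobi identity, on local functionals), and this bracket is the reduction of $P_\lambda$ in the sense of 1. -/

import Mathlib

open scoped TensorProduct ContDiff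

noncomputable section

namespace WAlg

/-! ### Smooth functions on the circle -/

/-- The `ℂ`-algebra `C^∞(S¹, ℂ)`, as smooth `2π`-periodic functions of a real variable. -/
def smoothCircle : Subalgebra ℂ (ℝ → ℂ) where
  carrier := {φ | ContDiff ℝ ∞ φ ∧ Function.Periodic φ (2 * Real.pi)}
  mul_mem' hf hg := ⟨hf.1.mul hg.1, hf.2.mul hg.2⟩
  add_mem' hf hg := ⟨hf.1.add hg.1, hf.2.add hg.2⟩
  algebraMap_mem' _ := ⟨contDiff_const, fun _ => rfl⟩

/-- Smooth complex functions on the circle. -/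
abbrev CircleFun : Type := smoothCircle

/-- The derivative `∂_x` on smooth functions on the circle. -/
def dx : CircleFun →ₗ[ℂ] CircleFun where
  toFun φ := ⟨deriv φ.1, by
    refine ⟨(contDiff_infty_iff_deriv.1 φ.2.1).2, fun x => ?_⟩
    have h : (fun y => φ.1 (y + 2 * Real.pi)) = φ.1 := funext φ.2.2
    rw [← deriv_comp_add_const, h]⟩
  map_add' φ ψ := by
    have hφ : Differentiable ℝ φ.1 := φ.2.1.differentiable (by simp)
    have hψ : Differentiable ℝ ψ.1 := ψ.2.1.differentiable (by simp)
    ext x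
    exact deriv_add (hφ x) (hψ x)
  map_smul' c φ := by
    have hφ : Differentiable ℝ φ.1 := φ.2.1.differentiable (by simp)
    ext x
    exact deriv_const_smul c (hφ x)

/-- The integral over the circle. -/
def circleInt (φ : CircleFun) : ℂ := ∫ x in (0 : ℝ)..(2 * Real.pi), φ.1 x

/-! ### Differential polynomials, local functionals, matrix differential operators -/

/-- Differential polynomials in the fields `u^i`, `i : σ`: polynomials in the jet variables
`(i, k)`, which stands for the `k`-th derivative of `u^i`. -/
abbrev DiffPoly (σ : Type*) : Type _ := MvPolynomial (σ × ℕ) ℂ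

/-- The value of a differential polynomial on the fields `u`, where the jet variable `(i, k)`
is evaluated as `(ε ∂_x)^k u^i`. Thus a monomial of differential degree `s` carries `ε ^ s`. -/
def evalJet {σ : Type*} (ε : ℂ) (p : DiffPoly σ) (u : σ → CircleFun) : CircleFun :=
  MvPolynomial.aeval (fun ik : σ × ℕ => ε ^ ik.2 • (dx^[ik.2] (u ik.1))) p

/-- The local functional `u ↦ ∫ p(u, u_x, u_xx, …) dx` with density `p`. -/
def localFunctional {σ : Type*} (p : DiffPoly σ) (u : σ → CircleFun) : ℂ :=
  circleInt (evalJet 1 p u)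

/-- A scalar differential operator `∑_r c_r (ε ∂_x)^r` of finite order whose coefficients `c_r`
are differential polynomials in the fields indexed by `σ`. -/
abbrev DiffOp (σ : Type*) : Type _ := ℕ →₀ DiffPoly σ

/-- The action of a differential operator, at the fields `u`, on a function. The coefficients
are evaluated on the jets of `ε ∂_x`, so the part with coefficients of differential degree `s`
and order `r` carries exactly `ε ^ (s + r)`. -/
def DiffOp.act {σ : Type*} (ε : ℂ) (T : DiffOp σ) (u : σ → CircleFun) (φ : CircleFun) :
    CircleFun :=
  T.sum fun r c => evalJet ε c u * (ε ^ r • (dx^[r] φ))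

/-- Matrices of differential operators. -/
abbrev MatDiffOp (σ α β : Type*) : Type _ := α → β → DiffOp σ

section OnFields

variable {ι : Type*} [Fintype ι]

/-- `g` is the variational derivative `(δf/δu^i)_i` of the functional `f` at `u`. -/
def IsVarDeriv (f : (ι → CircleFun) → ℂ) (u g : ι → CircleFun) : Prop :=
  ∀ s : ι → CircleFun,
    HasDerivAt (fun θ : ℂ => f (u + θ • s)) (∑ i, circleInt (g i * s i)) 0

/-- The variational derivative (it is unique when it exists, and local functionals have one). -/
def varDeriv (f : (ι → CircleFun) → ℂ) (u : ι → CircleFun) : ι → CircleFun :=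
  Classical.epsilon (IsVarDeriv f u)

/-- The bracket of functionals defined by `{u^i(x), u^j(y)} = K^{ij} ε⁻¹ δ(x - y)`, that is
`{f, g} = ∫ ∑ (δf/δu^i) ε⁻¹ K^{ij} (δg/δu^j) dx`. -/
def opBracket (ε : ℂ) (K : MatDiffOp ι ι ι) (f g : (ι → CircleFun) → ℂ) :
    (ι → CircleFun) → ℂ := fun u =>
  ε⁻¹ * ∑ i, ∑ j, circleInt (varDeriv f u i * (K i j).act ε u (varDeriv g u j))

/-- The bracket defined by `K` is a local Poisson bracket: it makes the space of local functionals
a Lie algebra. -/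
structure IsLocalPoisson (ε : ℂ) (K : MatDiffOp ι ι ι) : Prop where
  closed : ∀ p q : DiffPoly ι, ∃ r : DiffPoly ι,
    opBracket ε K (localFunctional p) (localFunctional q) = localFunctional r
  skew : ∀ p q : DiffPoly ι,
    opBracket ε K (localFunctional p) (localFunctional q) =
      -opBracket ε K (localFunctional q) (localFunctional p)
  jacobi : ∀ p q r : DiffPoly ι,
    opBracket ε K (opBracket ε K (localFunctional p) (localFunctional q)) (localFunctional r) +
      opBracket ε K (opBracket ε K (localFunctional q) (localFunctional r)) (localFunctional p) +
      opBracket ε K (opBracket ε K (localFunctional r) (localFunctional p)) (localFunctional q) = 0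

end OnFields

/-! ### The Lie algebraic data -/

variable {𝔤 : Type*} [LieRing 𝔤] [LieAlgebra ℂ 𝔤]

/-- The data fixed for the reduction: an `sl₂`-triple `e, h, f`, a good grading for `f`
compatible with the triple, an isotropic subspace `l` of degree `-1`, and an element `a`
centralizing `l' ⊕ ⨁_{i ≤ -2} 𝔤_i`, where `l'` is the coisotropic complement of `l`. -/
structure ReductionData (𝔤 : Type*) [LieRing 𝔤] [LieAlgebra ℂ 𝔤] where
  e : 𝔤
  h : 𝔤
  f : 𝔤
  lie_h_e : ⁅h, e⁆ = (2 : ℂ) • e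
  lie_h_f : ⁅h, f⁆ = (-2 : ℂ) • f
  lie_e_f : ⁅e, f⁆ = h
  /-- the graded pieces `𝔤_i` -/
  gr : ℤ → Submodule ℂ 𝔤
  internal : DirectSum.IsInternal gr
  lie_mem : ∀ i j : ℤ, ∀ x ∈ gr i, ∀ y ∈ gr j, ⁅x, y⁆ ∈ gr (i + j)
  f_mem : f ∈ gr (-2)
  h_mem : h ∈ gr 0
  e_mem : e ∈ gr 2
  ad_f_injective : ∀ j : ℤ, 1 ≤ j → ∀ x ∈ gr j, ⁅f, x⁆ = 0 → x = 0
  ad_f_surjective : ∀ j : ℤ, j ≤ 1 → ∀ y ∈ gr (j - 2), ∃ x ∈ gr j, ⁅f, x⁆ = y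
  /-- the isotropic subspace -/
  l : Submodule ℂ 𝔤
  l_le : l ≤ gr (-1)
  isotropic : ∀ x ∈ l, ∀ y ∈ l, killingForm ℂ 𝔤 e ⁅x, y⁆ = 0
  /-- the element that defines the first Poisson structure -/
  a : 𝔤
  a_centralizes_low : ∀ i : ℤ, i ≤ -2 → ∀ x ∈ gr i, ⁅a, x⁆ = 0
  a_centralizes_coisotropic :
    ∀ x ∈ gr (-1), (∀ y ∈ l, killingForm ℂ 𝔤 e ⁅x, y⁆ = 0) → ⁅a, x⁆ = 0

namespace ReductionData

variable (d : ReductionData 𝔤)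

/-- The coisotropic subspace `l' = {x ∈ 𝔤_{-1} | ⟨e | [x, l]⟩ = 0}`. -/
def l' : Submodule ℂ 𝔤 where
  carrier := {x | x ∈ d.gr (-1) ∧ ∀ y ∈ d.l, killingForm ℂ 𝔤 d.e ⁅x, y⁆ = 0}
  add_mem' hx hy := ⟨add_mem hx.1 hy.1, fun z hz => by
    rw [add_lie, map_add, hx.2 z hz, hy.2 z hz, add_zero]⟩
  zero_mem' := ⟨zero_mem _, fun z _ => by rw [zero_lie, map_zero]⟩
  smul_mem' c x hx := ⟨Submodule.smul_mem _ c hx.1, fun z hz => by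
    rw [smul_lie, map_smul, hx.2 z hz, smul_zero]⟩

/-- `m = l ⊕ ⨁_{i ≤ -2} 𝔤_i`, whose loop algebra generates the gauge group. -/
def gaugeAlg : Submodule ℂ 𝔤 := d.l ⊔ ⨆ i : ℤ, ⨆ _ : i ≤ -2, d.gr i

/-- `n = l' ⊕ ⨁_{i ≤ -2} 𝔤_i`. -/
def nil : Submodule ℂ 𝔤 := d.l' ⊔ ⨆ i : ℤ, ⨆ _ : i ≤ -2, d.gr i

/-- `b`, the orthogonal complement of `n` under the Killing form. -/
def b : Submodule ℂ 𝔤 where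
  carrier := {x | ∀ y ∈ d.nil, killingForm ℂ 𝔤 x y = 0}
  add_mem' hx hy z hz := by
    rw [map_add, LinearMap.add_apply, hx z hz, hy z hz, add_zero]
  zero_mem' z _ := by rw [map_zero, LinearMap.zero_apply]
  smul_mem' c x hx z hz := by
    rw [map_smul, LinearMap.smul_apply, hx z hz, smul_zero]

/-- `𝔤_f = ker ad f`. -/
def centralizer : Submodule ℂ 𝔤 := LinearMap.ker (LieAlgebra.ad ℂ 𝔤 d.f)

end ReductionData

/-! ### The loop algebra and its bihamiltonian structure -/

variable (𝔤) in
/-- The loop algebra `L(𝔤) = C^∞(S¹) ⊗ 𝔤` with its pointwise bracket (for finite-dimensional `𝔤`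
these are the smooth maps from the circle to `𝔤`). -/
abbrev Loop : Type _ := CircleFun ⊗[ℂ] 𝔤

/-- The constant loop. -/
def const (x : 𝔤) : Loop 𝔤 := (1 : CircleFun) ⊗ₜ[ℂ] x

/-- The loops `L(V)` with values in a subspace `V`. -/
def loops (V : Submodule ℂ 𝔤) : Submodule CircleFun (Loop 𝔤) := V.baseChange CircleFun

/-- The derivative `∂_x` of loops. -/
def loopDeriv : Loop 𝔤 →ₗ[ℂ] Loop 𝔤 := LinearMap.rTensor 𝔤 dx

/-- The function `x ↦ ⟨u(x) | v(x)⟩`, with the Killing form. -/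
def pairing (u v : Loop 𝔤) : CircleFun :=
  LinearMap.BilinForm.baseChange CircleFun (killingForm ℂ 𝔤) u v

/-- The nondegenerate form `(u | v) = ∫ ⟨u(x) | v(x)⟩ dx` on the loop algebra. -/
def loopForm (u v : Loop 𝔤) : ℂ := circleInt (pairing u v)

/-- `g` is the gradient of the functional `F` at `z`. -/
def IsGradient (F : Loop 𝔤 → ℂ) (z g : Loop 𝔤) : Prop :=
  ∀ s : Loop 𝔤, HasDerivAt (fun θ : ℂ => F (z + θ • s)) (loopForm g s) 0

/-- The gradient (it is unique when it exists, and local functionals have one). -/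
def gradient (F : Loop 𝔤 → ℂ) (z : Loop 𝔤) : Loop 𝔤 := Classical.epsilon (IsGradient F z)

/-- The Poisson tensor `P₂(z)(v) = ε⁻¹ [ε ∂_x + z, v]`. -/
def P₂ (ε : ℂ) (z v : Loop 𝔤) : Loop 𝔤 := ε⁻¹ • (ε • loopDeriv v + ⁅z, v⁆)

/-- The Poisson tensor `P₁(z)(v) = ε⁻¹ [a, v]`. -/
def P₁ (a : 𝔤) (ε : ℂ) (_z v : Loop 𝔤) : Loop 𝔤 := ε⁻¹ • ⁅const a, v⁆

/-- The pencil `P_c = P₂ + c P₁`. -/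
def pencil (a : 𝔤) (c ε : ℂ) (z v : Loop 𝔤) : Loop 𝔤 := P₂ ε z v + c • P₁ a ε z v

/-- The bracket `{F, G} = (δF | P δG)` defined by a Poisson tensor `P`. -/
def tensorBracket (P : Loop 𝔤 → Loop 𝔤 → Loop 𝔤) (F G : Loop 𝔤 → ℂ) (z : Loop 𝔤) : ℂ :=
  loopForm (gradient F z) (P z (gradient G z))

/-- The gauge transformation `z ↦ exp(-ad m)(ε ∂_x + z) - ε ∂_x`. Since `(-ad m)(ε ∂_x) = ε m_x`,
this is `∑ (1/k!) (-ad m)^k z + ∑ (1/(k+1)!) (-ad m)^k (ε m_x)`. The sums are finite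
when `m` is ad-nilpotent, which is the only case where this is used. -/
def gauge (ε : ℂ) (m z : Loop 𝔤) : Loop 𝔤 :=
  (∑ᶠ k : ℕ, ((k.factorial : ℂ)⁻¹) • ((fun v => -⁅m, v⁆)^[k] z)) +
    ∑ᶠ k : ℕ, (((k + 1).factorial : ℂ)⁻¹) • ((fun v => -⁅m, v⁆)^[k] (ε • loopDeriv m))

/-! ### Coordinates, reduction to `Q = e + L(𝔤_f)` -/

section Coordinates

variable [FiniteDimensional ℂ 𝔤] [LieAlgebra.IsSimple ℂ 𝔤]
variable {ι κ : Type*} [Fintype ι] [Fintype κ] [DecidableEq ι] [DecidableEq κ]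
variable (d : ReductionData 𝔤) (ξ : Module.Basis (ι ⊕ κ) ℂ 𝔤)

/-- The basis `ξ^I` dual to `ξ_I` under the Killing form. -/
def dual : Module.Basis (ι ⊕ κ) ℂ 𝔤 :=
  LinearMap.BilinForm.dualBasis (killingForm ℂ 𝔤)
    (LieAlgebra.IsKilling.killingForm_nondegenerate ℂ 𝔤) ξ

/-- The coordinates `q^I(z) = ⟨z - e | ξ^I⟩` on the loop algebra. -/
def coords (z : Loop 𝔤) (I : ι ⊕ κ) : CircleFun := pairing (z - const d.e) (const (dual ξ I))

/-- The point `e + ∑ q^i ξ_i`. When the `ξ_i`, `i : ι`, form a basis of `𝔤_f`, this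
parametrizes `Q = e + L(𝔤_f)` by its coordinates. -/
def slice (q : ι → CircleFun) : Loop 𝔤 := const d.e + ∑ i, q i ⊗ₜ[ℂ] ξ (Sum.inl i)

/-- The local functional on the loop algebra with a given density in the coordinates. -/
def loopFunctional (p : DiffPoly (ι ⊕ κ)) (z : Loop 𝔤) : ℂ := localFunctional p (coords d ξ z)

/-- The restriction of the differential polynomial `p` to `S = e + L(b)` belongs to the ring `R` of
differential polynomials on `S` invariant under the gauge action of the group of `L(m)`. -/
def IsGaugeInvariant (ε : ℂ) (p : DiffPoly (ι ⊕ κ)) : Prop :=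
  ∀ m ∈ loops d.gaugeAlg, ∀ s ∈ loops d.b,
    evalJet 1 p (coords d ξ (gauge ε m (const d.e + s))) =
      evalJet 1 p (coords d ξ (const d.e + s))

/-- The functional on `L(𝔤)` with density `P` extends the functional on `Q` with density `p`, and
it is constant along the distribution `D = P₂(L(n))` at the points of `S = e + L(b)`. -/
def IsExtension (ε : ℂ) (P : DiffPoly (ι ⊕ κ)) (p : DiffPoly ι) : Prop :=
  (∀ q : ι → CircleFun, loopFunctional d ξ P (slice d ξ q) = localFunctional p q) ∧
  ∀ s ∈ loops d.b, ∀ v ∈ loops d.nil,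
    loopForm (gradient (loopFunctional d ξ P) (const d.e + s)) (P₂ ε (const d.e + s) v) = 0

/-- The bracket defined on `Q` by the operator `K` is the reduction of the Poisson tensor `T`:
`{f, g}^Q = {F, G} ∘ i` for all extensions `F`, `G` of `f`, `g` that are constant along `D`, and
such extensions exist, even with a density which is gauge invariant on `S`. -/
def IsReducedOperator (ε : ℂ) (T : Loop 𝔤 → Loop 𝔤 → Loop 𝔤) (K : MatDiffOp ι ι ι) : Prop :=
  (∀ p : DiffPoly ι, ∃ P : DiffPoly (ι ⊕ κ), IsExtension d ξ ε P p ∧ IsGaugeInvariant d ξ ε P) ∧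
  ∀ (p r : DiffPoly ι) (P R : DiffPoly (ι ⊕ κ)),
    IsExtension d ξ ε P p → IsExtension d ξ ε R r →
    ∀ q : ι → CircleFun,
      tensorBracket T (loopFunctional d ξ P) (loopFunctional d ξ R) (slice d ξ q) =
        opBracket ε K (localFunctional p) (localFunctional r) q

/-- The matrix differential operator of the pencil: `{q^I(x), q^J(y)}_c = 𝔽^{IJ} ε⁻¹ δ(x - y)`,
so that `𝔽^{IJ} φ = ⟨ξ^I | [ε ∂_x + z + c a, φ ξ^J]⟩`. -/
def pencilOp (c ε : ℂ) (z : Loop 𝔤) (I J : ι ⊕ κ) (φ : CircleFun) : CircleFun :=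
  pairing (const (dual ξ I)) (ε • pencil d.a c ε z (φ ⊗ₜ[ℂ] dual ξ J))

/-- `S` is a two-sided inverse of the minor `𝔽^{αβ}` restricted to `Q`. -/
def IsMinorInverse (c ε : ℂ) (S : MatDiffOp ι κ κ) : Prop :=
  ∀ (q : ι → CircleFun) (φ : κ → CircleFun) (α : κ),
    (∑ β, pencilOp d ξ c ε (slice d ξ q) (Sum.inr α) (Sum.inr β)
      (∑ γ, (S β γ).act ε q (φ γ)) = φ α) ∧
    (∑ β, (S α β).act ε q
      (∑ γ, pencilOp d ξ c ε (slice d ξ q) (Sum.inr β) (Sum.inr γ) (φ γ)) = φ α)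

/-- The Dirac formula `𝔽^{ij} - 𝔽^{iα} S_{αβ} 𝔽^{βj}` at the point of `Q` with coordinates `q`. -/
def diracOp (c ε : ℂ) (S : MatDiffOp ι κ κ) (q : ι → CircleFun) (i j : ι) (φ : CircleFun) :
    CircleFun :=
  pencilOp d ξ c ε (slice d ξ q) (Sum.inl i) (Sum.inl j) φ -
    ∑ α, ∑ β, pencilOp d ξ c ε (slice d ξ q) (Sum.inl i) (Sum.inr α)
      ((S α β).act ε q
        (pencilOp d ξ c ε (slice d ξ q) (Sum.inr β) (Sum.inl j) φ))

end Coordinates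

end WAlg

end

noncomputable section
namespace WAlg

set_option linter.unusedSectionVars false

/-! ### Calculus on the circle -/

/-! Write ∇_x = [ε∂_x + e + x, ·] (in Lean, `conn` at e + x). As f ∈ 𝔫 commutes with a, a lies in
𝔤_f, so at a point e + q of Q the whole pencil is ε⁻¹∇_x with x = q + λa still in L(𝔤_f).

Dirac side. By `sl₂` theory 𝔤 = [e,[f,𝔤]] ⊕ 𝔤_f, so ad e has a partial inverse `theta` with values
in [f,𝔤], of degree -2 and with kernel 𝔤_f. Since 𝔤_f lives in degrees ≤ 0, `theta` ∘ (ε∂_x + ad x)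
is nilpotent, and a finite Neumann series `solve` gives the unique v ∈ L([f,𝔤]) with ∇_x v ≡ w
modulo L(𝔤_f). The ξ^α span [f,𝔤] = 𝔤_f^⊥, so this is exactly the inversion of the minor, and it is
a differential operator because the series is finite. The Dirac formula becomes φ ↦ ∇_x(`lift` φ),
where `lift` φ ∈ φ + L([f,𝔤]) is corrected so that ∇_x(`lift` φ) ∈ L(𝔤_f) (`diracOp_minorInverse`).

Drinfeld–Sokolov side. The gradient v of an extension satisfies ∇v ∈ L(𝔟), for every λ because [a,𝔤]
⊂ 𝔟, and it is prescribed modulo L([f,𝔤]) by the functional on Q. Two such v differ by an element of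
L(𝔪) ⊂ L(𝔫) (`mem_loops_gaugeAlg`). The orthogonalities 𝔫 ⊥ 𝔟 and [f,𝔤] ⊥ 𝔤_f then allow v to be
replaced by the Dirac lift inside the bracket (`loopForm_eq_lift`), so both reductions agree for
every λ. Using the lifts of λ = 0 for all λ shows that the result is affine in λ
(`reducedOp_affine`).

Extensions exist because every e + s with s of degree ≤ 1 is moved by a gauge transformation to a
point of Q that is a differential polynomial in s (`toSlice`); pulling back along this map gives
invariant densities. That the point is unique (`IsGaugeMap.unique`) follows by comparing two
unipotent automorphisms: the leading part of their difference is a derivation, hence ad y with y of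
negative degree, and [e,y] ∈ 𝔤_f forces y = 0.

For the Jacobi identity, the bracket of lifted gradients is differentiated along Hamiltonian fields:
second variations cancel by symmetry, and the rest cancels because ∇_x is a skew-adjoint derivation
(`sum_loopForm_lie_conn`). -/

theorem dx_mul (φ ψ : CircleFun) : dx (φ * ψ) = dx φ * ψ + φ * dx ψ := by
  have hφ : Differentiable ℝ φ.1 := φ.2.1.differentiable (by simp)
  have hψ : Differentiable ℝ ψ.1 := ψ.2.1.differentiable (by simp)
  ext x
  exact deriv_mul (hφ x) (hψ x)

theorem dx_one : dx 1 = 0 := by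
  have h := dx_mul 1 1
  rw [mul_one, mul_one, one_mul] at h
  exact left_eq_add.mp h

theorem dx_algebraMap (c : ℂ) : dx (algebraMap ℂ CircleFun c) = 0 := by
  rw [Algebra.algebraMap_eq_smul_one, map_smul, dx_one, smul_zero]

theorem circleFun_continuous (φ : CircleFun) : Continuous φ.1 := φ.2.1.continuous

theorem circleFun_intervalIntegrable (φ : CircleFun) :
    IntervalIntegrable φ.1 MeasureTheory.volume 0 (2 * Real.pi) :=
  (circleFun_continuous φ).intervalIntegrable _ _

/-- The integral over the circle, as a linear map. -/
def circleIntL : CircleFun →ₗ[ℂ] ℂ where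
  toFun := circleInt
  map_add' φ ψ := intervalIntegral.integral_add (circleFun_intervalIntegrable φ)
    (circleFun_intervalIntegrable ψ)
  map_smul' c φ := intervalIntegral.integral_smul c φ.1

theorem circleInt_eq (φ : CircleFun) : circleInt φ = circleIntL φ := rfl

theorem circleInt_dx (φ : CircleFun) : circleInt (dx φ) = 0 := by
  have hφ : Differentiable ℝ φ.1 := φ.2.1.differentiable (by simp)
  have h : circleInt (dx φ) = φ.1 (2 * Real.pi) - φ.1 0 :=
    intervalIntegral.integral_deriv_eq_sub (fun x _ => hφ x)
      (circleFun_intervalIntegrable (dx φ))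
  have h2 := φ.2.2 0
  rw [zero_add] at h2
  rw [h, h2, sub_self]

theorem circleInt_dx_mul (φ ψ : CircleFun) :
    circleInt (dx φ * ψ) = -circleInt (φ * dx ψ) := by
  have h := circleInt_dx (φ * ψ)
  rw [dx_mul, circleInt_eq, map_add, ← circleInt_eq, ← circleInt_eq] at h
  exact eq_neg_of_add_eq_zero_left h

theorem circleInt_mul_iterate (k : ℕ) (φ ψ : CircleFun) :
    circleInt (φ * dx^[k] ψ) = circleInt (((-1 : ℂ) ^ k • dx^[k] φ) * ψ) := by
  induction k generalizing φ with
  | zero => simp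
  | succ k ih =>
    rw [Function.iterate_succ_apply', ← neg_eq_iff_eq_neg.mpr (circleInt_dx_mul φ _), ih,
      circleInt_eq, circleInt_eq, ← map_neg, Function.iterate_succ_apply, pow_succ]
    congr 1
    rw [mul_neg_one, neg_smul]
    exact (neg_mul (α := CircleFun) _ _).symm

/-- The complex conjugate of a function on the circle. -/
def conjFun (φ : CircleFun) : CircleFun :=
  ⟨fun x => (starRingEnd ℂ) (φ.1 x), Complex.conjCLE.contDiff.comp φ.2.1, fun x => by
    simp only [φ.2.2 x]⟩

/-- Testing against the conjugate gives ∫|φ|² = 0. This yields uniqueness of variational derivatives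
and lets identities between operators be checked weakly. -/
theorem eq_zero_of_circleInt_mul (φ : CircleFun) (h : ∀ ψ, circleInt (φ * ψ) = 0) : φ = 0 := by
  have hc : Continuous fun x => Complex.normSq (φ.1 x) :=
    Complex.continuous_normSq.comp (circleFun_continuous φ)
  have h1 : ∫ x in (0 : ℝ)..(2 * Real.pi), Complex.normSq (φ.1 x) = 0 := by
    have h2 := h (conjFun φ)
    have h3 : circleInt (φ * conjFun φ) =
        ∫ x in (0 : ℝ)..(2 * Real.pi), ((Complex.normSq (φ.1 x) : ℝ) : ℂ) := by
      refine intervalIntegral.integral_congr fun x _ => ?_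
      exact Complex.mul_conj (φ.1 x)
    rw [h3, intervalIntegral.integral_ofReal] at h2
    exact_mod_cast h2
  have hz : ∀ x ∈ Set.Icc (0 : ℝ) (2 * Real.pi), φ.1 x = 0 := by
    intro x hx
    by_contra hne
    have := intervalIntegral.integral_pos (a := 0) (b := 2 * Real.pi) (by positivity)
      hc.continuousOn (fun y _ => Complex.normSq_nonneg (φ.1 y))
      ⟨x, hx, Complex.normSq_pos.mpr hne⟩
    exact this.ne' h1
  ext x
  obtain ⟨y, hy, hxy⟩ := φ.2.2.exists_mem_Ico₀ (by positivity) x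
  rw [hxy]
  exact hz y ⟨hy.1, hy.2.le⟩

/-! ### Differential polynomials -/

/-- Evaluation on jets as an algebra homomorphism. -/
def evalJetHom {σ : Type*} (ε : ℂ) (u : σ → CircleFun) : DiffPoly σ →ₐ[ℂ] CircleFun :=
  MvPolynomial.aeval (fun ik : σ × ℕ => ε ^ ik.2 • (dx^[ik.2] (u ik.1)))

theorem evalJet_eq {σ : Type*} (ε : ℂ) (p : DiffPoly σ) (u : σ → CircleFun) :
    evalJet ε p u = evalJetHom ε u p := rfl

theorem evalJetHom_X {σ : Type*} (ε : ℂ) (u : σ → CircleFun) (ik : σ × ℕ) :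
    evalJetHom ε u (MvPolynomial.X ik) = ε ^ ik.2 • (dx^[ik.2] (u ik.1)) :=
  MvPolynomial.aeval_X _ _

/-- The total derivative of differential polynomials. -/
def totalDeriv (σ : Type*) : Derivation ℂ (DiffPoly σ) (DiffPoly σ) :=
  MvPolynomial.mkDerivation ℂ fun ik => MvPolynomial.X (ik.1, ik.2 + 1)

/-- The jet variable (i, k) stands for (ε∂_x)^k u^i, so the formal total derivative represents ε∂_x
rather than ∂_x. -/
theorem evalJetHom_totalDeriv {σ : Type*} (ε : ℂ) (u : σ → CircleFun) (p : DiffPoly σ) :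
    evalJetHom ε u (totalDeriv σ p) = ε • dx (evalJetHom ε u p) := by
  induction p using MvPolynomial.induction_on with
  | C c =>
    have h : (MvPolynomial.C c : DiffPoly σ) = algebraMap ℂ _ c := rfl
    rw [h, Derivation.map_algebraMap, map_zero, AlgHom.commutes, dx_algebraMap, smul_zero]
  | add p q hp hq => simp only [map_add, hp, hq, smul_add]
  | mul_X p ik hp =>
    rw [Derivation.leibniz, map_add, map_mul, dx_mul, smul_add, smul_eq_mul, smul_eq_mul, map_mul,
      map_mul, hp, totalDeriv, MvPolynomial.mkDerivation_X, evalJetHom_X, evalJetHom_X, map_smul,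
      ← Function.iterate_succ_apply' dx, pow_succ']
    rw [add_comm, mul_comm _ (ε • dx _), smul_mul_assoc, mul_smul_comm, mul_smul_comm,
      mul_smul_comm, mul_smul]

/-- `F` is given by a differential polynomial. -/
def IsDP {σ : Type*} (F : (σ → CircleFun) → CircleFun) : Prop :=
  ∃ p : DiffPoly σ, ∀ u, F u = evalJet 1 p u

section IsDP
variable {σ τ : Type*} {F G : (σ → CircleFun) → CircleFun}

theorem isDP_evalJet_one (p : DiffPoly σ) : IsDP (evalJet 1 p) := ⟨p, fun _ => rfl⟩

theorem isDP_coord (i : σ) : IsDP fun u => u i :=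
  ⟨MvPolynomial.X (i, 0), fun u => by rw [evalJet_eq, evalJetHom_X]; simp⟩

theorem isDP_algebraMap (c : ℂ) : IsDP fun _ : σ → CircleFun => algebraMap ℂ CircleFun c :=
  ⟨algebraMap ℂ _ c, fun u => by rw [evalJet_eq, AlgHom.commutes]⟩

theorem isDP_zero : IsDP fun _ : σ → CircleFun => 0 := by
  simpa using isDP_algebraMap (σ := σ) 0

theorem IsDP.add (hF : IsDP F) (hG : IsDP G) : IsDP fun u => F u + G u := by
  obtain ⟨p, hp⟩ := hF
  obtain ⟨q, hq⟩ := hG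
  exact ⟨p + q, fun u => by
    beta_reduce
    rw [hp, hq, evalJet_eq, evalJet_eq, evalJet_eq, map_add]⟩

theorem IsDP.mul (hF : IsDP F) (hG : IsDP G) : IsDP fun u => F u * G u := by
  obtain ⟨p, hp⟩ := hF
  obtain ⟨q, hq⟩ := hG
  exact ⟨p * q, fun u => by
    beta_reduce
    rw [hp, hq, evalJet_eq, evalJet_eq, evalJet_eq, map_mul]⟩

theorem IsDP.smul (c : ℂ) (hF : IsDP F) : IsDP fun u => c • F u := by
  obtain ⟨p, hp⟩ := hF
  exact ⟨c • p, fun u => by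
    beta_reduce
    rw [hp, evalJet_eq, evalJet_eq, map_smul]⟩

theorem isDP_sum {τ : Type*} (s : Finset τ) {F : τ → (σ → CircleFun) → CircleFun}
    (hF : ∀ t ∈ s, IsDP (F t)) : IsDP fun u => ∑ t ∈ s, F t u := by
  classical
  induction s using Finset.induction_on with
  | empty => simpa using isDP_zero
  | insert t s ht ih =>
    simp only [Finset.sum_insert ht]
    exact (hF t (Finset.mem_insert_self t s)).add
      (ih fun t' h' => hF t' (Finset.mem_insert_of_mem h'))

theorem IsDP.dx (hF : IsDP F) : IsDP fun u => dx (F u) := by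
  obtain ⟨p, hp⟩ := hF
  exact ⟨totalDeriv σ p, fun u => by
    beta_reduce
    rw [hp, evalJet_eq, evalJet_eq, evalJetHom_totalDeriv, one_smul]⟩

theorem IsDP.iterate_dx (k : ℕ) (hF : IsDP F) : IsDP fun u => WAlg.dx^[k] (F u) := by
  induction k with
  | zero => exact hF
  | succ k ih =>
    simp only [Function.iterate_succ_apply']
    exact ih.dx

/-- `IsDP` refers to jets at ε = 1, so here powers of ε are absorbed into the coefficients; ε is
fixed wherever this is used. -/
theorem IsDP.evalJet (ε : ℂ) (p : DiffPoly τ) {G : τ → (σ → CircleFun) → CircleFun}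
    (hG : ∀ t, IsDP (G t)) : IsDP fun u => evalJet ε p fun t => G t u := by
  induction p using MvPolynomial.induction_on with
  | C c =>
    have h : (MvPolynomial.C c : DiffPoly τ) = algebraMap ℂ _ c := rfl
    simp only [evalJet_eq, h, AlgHom.commutes]
    exact isDP_algebraMap c
  | add p q hp hq =>
    simp only [evalJet_eq, map_add] at hp hq ⊢
    exact hp.add hq
  | mul_X p ik hp =>
    simp only [evalJet_eq, map_mul, evalJetHom_X] at hp ⊢
    exact hp.mul (((hG ik.1).iterate_dx ik.2).smul _)

end IsDP

/-! ### Differential operators -/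

section DiffOp
variable {σ : Type*}

theorem DiffOp.act_eq_sum {ε : ℂ} (T : DiffOp σ) (u : σ → CircleFun) (φ : CircleFun)
    {s : Finset ℕ} (hs : T.support ⊆ s) :
    T.act ε u φ = ∑ r ∈ s, evalJetHom ε u (T r) * (ε ^ r • (dx^[r] φ)) :=
  Finsupp.sum_of_support_subset T hs _ fun r _ => by rw [evalJet_eq, map_zero, zero_mul]

theorem DiffOp.add_act (ε : ℂ) (T T' : DiffOp σ) (u : σ → CircleFun) (φ : CircleFun) :
    (T + T').act ε u φ = T.act ε u φ + T'.act ε u φ := by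
  classical
  refine Finsupp.sum_add_index' (fun r => ?_) fun r c c' => ?_
  · rw [evalJet_eq, map_zero, zero_mul]
  · rw [evalJet_eq, map_add, add_mul]; rfl

theorem DiffOp.zero_act (ε : ℂ) (u : σ → CircleFun) (φ : CircleFun) :
    (0 : DiffOp σ).act ε u φ = 0 := Finsupp.sum_zero_index

theorem DiffOp.smul_act (ε : ℂ) (c : ℂ) (T : DiffOp σ) (u : σ → CircleFun) (φ : CircleFun) :
    (c • T).act ε u φ = c • T.act ε u φ := by
  rw [DiffOp.act_eq_sum _ u φ (Finsupp.support_smul (b := c) (g := T)),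
    DiffOp.act_eq_sum T u φ subset_rfl, Finset.smul_sum]
  refine Finset.sum_congr rfl fun r _ => ?_
  rw [Finsupp.smul_apply, map_smul, smul_mul_assoc]

theorem DiffOp.single_act (ε : ℂ) (r : ℕ) (p : DiffPoly σ) (u : σ → CircleFun) (φ : CircleFun) :
    DiffOp.act ε (Finsupp.single r p) u φ = evalJetHom ε u p * (ε ^ r • (dx^[r] φ)) :=
  Finsupp.sum_single_index (by rw [evalJet_eq, map_zero, zero_mul])

/-- The family of operators `T`, indexed by `ε`, is given by a differential operator. -/
def IsDO (T : ℂ → (σ → CircleFun) → CircleFun → CircleFun) : Prop :=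
  ∃ D : DiffOp σ, ∀ ε u φ, T ε u φ = D.act ε u φ

variable {T T' : ℂ → (σ → CircleFun) → CircleFun → CircleFun}

theorem isDO_smul_id (c : ℂ) : IsDO fun _ (_ : σ → CircleFun) φ => c • φ :=
  ⟨Finsupp.single 0 (algebraMap ℂ _ c), fun ε u φ => by
    beta_reduce
    rw [DiffOp.single_act, AlgHom.commutes, pow_zero, one_smul, Algebra.smul_def]; rfl⟩

theorem isDO_zero : IsDO fun _ (_ : σ → CircleFun) _ => 0 :=
  ⟨0, fun ε u φ => (DiffOp.zero_act ε u φ).symm⟩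

theorem IsDO.add (h : IsDO T) (h' : IsDO T') : IsDO fun ε u φ => T ε u φ + T' ε u φ := by
  obtain ⟨D, hD⟩ := h
  obtain ⟨D', hD'⟩ := h'
  exact ⟨D + D', fun ε u φ => by
    beta_reduce
    rw [hD, hD', DiffOp.add_act]⟩

theorem IsDO.smul (c : ℂ) (h : IsDO T) : IsDO fun ε u φ => c • T ε u φ := by
  obtain ⟨D, hD⟩ := h
  exact ⟨c • D, fun ε u φ => by
    beta_reduce
    rw [hD, DiffOp.smul_act]⟩

theorem isDO_sum {τ : Type*} (s : Finset τ) {T : τ → ℂ → (σ → CircleFun) → CircleFun → CircleFun}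
    (hT : ∀ t ∈ s, IsDO (T t)) : IsDO fun ε u φ => ∑ t ∈ s, T t ε u φ := by
  classical
  induction s using Finset.induction_on with
  | empty => simpa using isDO_zero
  | insert t s ht ih =>
    simp only [Finset.sum_insert ht]
    exact (hT t (Finset.mem_insert_self t s)).add
      (ih fun t' h' => hT t' (Finset.mem_insert_of_mem h'))

theorem IsDO.coord_mul (i : σ) (h : IsDO T) : IsDO fun ε u φ => u i * T ε u φ := by
  obtain ⟨D, hD⟩ := h
  have h1 : IsDO fun ε u φ => ∑ r ∈ D.support,
      u i * (evalJetHom ε u (D r) * (ε ^ r • (WAlg.dx^[r] φ))) := by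
    refine isDO_sum _ fun r _ => ⟨Finsupp.single r (MvPolynomial.X (i, 0) * D r), fun ε u φ => ?_⟩
    rw [DiffOp.single_act, map_mul, evalJetHom_X, mul_assoc]
    simp
  simpa only [hD, DiffOp.act_eq_sum D _ _ subset_rfl, Finset.mul_sum] using h1

/-- Leibniz rule for ε∂_x ∘ c(ε∂_x)^r. Composing with ε∂_x, not ∂_x, keeps the coefficients
independent of ε. -/
theorem IsDO.dx (h : IsDO T) : IsDO fun ε u φ => ε • dx (T ε u φ) := by
  obtain ⟨D, hD⟩ := h
  have h1 : IsDO fun ε u φ => ∑ r ∈ D.support,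
      ε • WAlg.dx (evalJetHom ε u (D r) * (ε ^ r • (WAlg.dx^[r] φ))) := by
    refine isDO_sum _ fun r _ => ⟨Finsupp.single r (totalDeriv σ (D r)) +
      Finsupp.single (r + 1) (D r), fun ε u φ => ?_⟩
    beta_reduce
    rw [DiffOp.add_act, DiffOp.single_act, DiffOp.single_act, evalJetHom_totalDeriv, dx_mul,
      Function.iterate_succ_apply', map_smul, smul_add, pow_succ', smul_mul_assoc, mul_smul_comm,
      mul_smul_comm, mul_smul_comm, mul_smul]
  simpa only [hD, DiffOp.act_eq_sum D _ _ subset_rfl, map_sum, Finset.smul_sum] using h1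

theorem DiffOp.isDP_act (ε : ℂ) (D : DiffOp σ) {G : (σ → CircleFun) → CircleFun} (hG : IsDP G) :
    IsDP fun u => D.act ε u (G u) := by
  simp only [DiffOp.act_eq_sum D _ _ subset_rfl]
  refine isDP_sum _ fun r _ => ?_
  exact (IsDP.evalJet ε (D r) (G := fun t u => u t) isDP_coord).mul ((hG.iterate_dx r).smul _)

end DiffOp

/-! ### Polynomial curves of functions on the circle -/

/-- The curve `γ` is polynomial, with derivative `γ'` at `0`. -/
def PolyCurve (γ : ℂ → CircleFun) (γ' : CircleFun) : Prop :=
  ∃ P : Polynomial CircleFun,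
    (∀ θ, γ θ = P.eval (algebraMap ℂ CircleFun θ)) ∧ P.coeff 1 = γ'

namespace PolyCurve
variable {γ δ : ℂ → CircleFun} {γ' δ' : CircleFun}

theorem const (φ : CircleFun) : PolyCurve (fun _ => φ) 0 :=
  ⟨Polynomial.C φ, fun θ => by rw [Polynomial.eval_C], Polynomial.coeff_C_of_ne_zero one_ne_zero⟩

theorem line (φ ψ : CircleFun) : PolyCurve (fun θ => φ + θ • ψ) ψ :=
  ⟨Polynomial.C φ + Polynomial.X * Polynomial.C ψ, fun θ => by
    beta_reduce
    rw [Polynomial.eval_add, Polynomial.eval_mul, Polynomial.eval_C, Polynomial.eval_C,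
      Polynomial.eval_X, Algebra.smul_def], by simp [Polynomial.coeff_C]⟩

theorem add (h : PolyCurve γ γ') (k : PolyCurve δ δ') :
    PolyCurve (fun θ => γ θ + δ θ) (γ' + δ') := by
  obtain ⟨P, hP, hP'⟩ := h
  obtain ⟨Q, hQ, hQ'⟩ := k
  exact ⟨P + Q, fun θ => by
    beta_reduce
    rw [hP, hQ, Polynomial.eval_add], by
    rw [Polynomial.coeff_add, hP', hQ']⟩

theorem mul (h : PolyCurve γ γ') (k : PolyCurve δ δ') :
    PolyCurve (fun θ => γ θ * δ θ) (γ' * δ 0 + γ 0 * δ') := by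
  obtain ⟨P, hP, hP'⟩ := h
  obtain ⟨Q, hQ, hQ'⟩ := k
  refine ⟨P * Q, fun θ => by
    beta_reduce
    rw [hP, hQ, Polynomial.eval_mul], ?_⟩
  rw [Polynomial.mul_coeff_one, hP', hQ', hP, hQ, map_zero, ← Polynomial.coeff_zero_eq_eval_zero,
    ← Polynomial.coeff_zero_eq_eval_zero, add_comm]

theorem smul (c : ℂ) (h : PolyCurve γ γ') : PolyCurve (fun θ => c • γ θ) (c • γ') := by
  have := (PolyCurve.const (algebraMap ℂ CircleFun c)).mul h
  simpa only [zero_mul, zero_add, ← Algebra.smul_def] using this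

theorem sum {τ : Type*} (s : Finset τ) {γ : τ → ℂ → CircleFun} {γ' : τ → CircleFun}
    (h : ∀ t ∈ s, PolyCurve (γ t) (γ' t)) :
    PolyCurve (fun θ => ∑ t ∈ s, γ t θ) (∑ t ∈ s, γ' t) := by
  classical
  induction s using Finset.induction_on with
  | empty => simpa using PolyCurve.const 0
  | insert t s ht ih =>
    simp only [Finset.sum_insert ht]
    exact (h t (Finset.mem_insert_self t s)).add
      (ih fun t' h' => h t' (Finset.mem_insert_of_mem h'))

theorem eval_eq (P : Polynomial CircleFun) (θ : ℂ) :
    P.eval (algebraMap ℂ CircleFun θ) = ∑ k ∈ Finset.range (P.natDegree + 1), θ ^ k • P.coeff k := by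
  rw [Polynomial.eval_eq_sum_range]
  refine Finset.sum_congr rfl fun k _ => ?_
  rw [← map_pow, Algebra.smul_def, mul_comm]

theorem of_sum (n : ℕ) (c : ℕ → CircleFun) (h : ∀ θ : ℂ, γ θ = ∑ k ∈ Finset.range n, θ ^ k • c k) :
    PolyCurve γ (if 1 < n then c 1 else 0) := by
  refine ⟨∑ k ∈ Finset.range n, Polynomial.monomial k (c k), fun θ => ?_, ?_⟩
  · rw [h, Polynomial.eval_finsetSum]
    refine Finset.sum_congr rfl fun k _ => ?_
    rw [Polynomial.eval_monomial, ← map_pow, Algebra.smul_def, mul_comm]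
  · simp [Polynomial.coeff_monomial]

/-- A polynomial curve has finitely many coefficients, so a linear map acts on them one by one and
no continuity is needed. -/
theorem map (L : CircleFun →ₗ[ℂ] CircleFun) (h : PolyCurve γ γ') :
    PolyCurve (fun θ => L (γ θ)) (L γ') := by
  obtain ⟨P, hP, hP'⟩ := h
  have := of_sum (γ := fun θ => L (γ θ)) (P.natDegree + 1) (fun k => L (P.coeff k)) fun θ => by
    rw [hP, eval_eq, map_sum]
    simp only [map_smul]
  convert this using 1
  split_ifs with hd
  · rw [hP']
  · rw [← hP', Polynomial.coeff_eq_zero_of_natDegree_lt (by omega), map_zero]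

theorem iterate_dx (k : ℕ) (h : PolyCurve γ γ') :
    PolyCurve (fun θ => dx^[k] (γ θ)) (dx^[k] γ') := by
  have := h.map (dx ^ k)
  simpa only [Module.End.pow_apply] using this

theorem hasDerivAt (h : PolyCurve γ γ') :
    HasDerivAt (fun θ => circleInt (γ θ)) (circleInt γ') 0 := by
  obtain ⟨P, hP, hP'⟩ := h
  have h1 : (fun θ => circleInt (γ θ)) = fun θ : ℂ =>
      (∑ k ∈ Finset.range (P.natDegree + 1), Polynomial.monomial k (circleIntL (P.coeff k))).eval
        θ := by
    funext θ
    rw [hP, eval_eq, circleInt_eq, map_sum, Polynomial.eval_finsetSum]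
    refine Finset.sum_congr rfl fun k _ => ?_
    rw [map_smul, Polynomial.eval_monomial, smul_eq_mul, mul_comm]
  rw [h1]
  refine (Polynomial.hasDerivAt _ _).congr_deriv ?_
  rw [← Polynomial.coeff_zero_eq_eval_zero, Polynomial.coeff_derivative,
    Polynomial.finsetSum_coeff]
  simp only [Polynomial.coeff_monomial]
  rw [circleInt_eq, ← hP']
  simp only [zero_add, Finset.sum_ite_eq', Finset.mem_range]
  split_ifs with hd
  · simp
  · rw [Polynomial.coeff_eq_zero_of_natDegree_lt (by omega), map_zero]; simp

/-- The sum runs over any sufficiently large finite set of jets: variables can cancel in a sum of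
polynomials, and this form survives the induction. -/
theorem evalJet_aux {σ : Type*} [DecidableEq σ] (ε : ℂ) (p : DiffPoly σ)
    {γ : σ → ℂ → CircleFun} {γ' : σ → CircleFun} (h : ∀ i, PolyCurve (γ i) (γ' i)) :
    ∃ E₀ : Finset (σ × ℕ), ∀ E, E₀ ⊆ E → PolyCurve (fun θ => evalJetHom ε (fun i => γ i θ) p)
      (∑ ik ∈ E, evalJetHom ε (fun i => γ i 0) (MvPolynomial.pderiv ik p) *
        (ε ^ ik.2 • dx^[ik.2] (γ' ik.1))) := by
  induction p using MvPolynomial.induction_on with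
  | C c =>
    refine ⟨∅, fun E _ => ?_⟩
    have h : (MvPolynomial.C c : DiffPoly σ) = algebraMap ℂ _ c := rfl
    simp only [MvPolynomial.pderiv_C, map_zero, zero_mul, Finset.sum_const_zero]
    simp only [h, AlgHom.commutes]
    exact PolyCurve.const _
  | add p q hp hq =>
    obtain ⟨E₁, h₁⟩ := hp
    obtain ⟨E₂, h₂⟩ := hq
    refine ⟨E₁ ∪ E₂, fun E hE => ?_⟩
    simp only [map_add, add_mul, Finset.sum_add_distrib]
    exact (h₁ E (Finset.union_subset_left hE)).add (h₂ E (Finset.union_subset_right hE))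
  | mul_X p j hp =>
    obtain ⟨E₁, h₁⟩ := hp
    refine ⟨insert j E₁, fun E hE => ?_⟩
    have hj : j ∈ E := hE (Finset.mem_insert_self _ _)
    have := (h₁ E fun x hx => hE (Finset.mem_insert_of_mem hx)).mul
      (((h j.1).iterate_dx j.2).smul (ε ^ j.2))
    simp only [map_mul, evalJetHom_X]
    convert this using 1
    simp only [Derivation.leibniz, MvPolynomial.pderiv_X, smul_eq_mul, map_add, map_mul, add_mul,
      Finset.sum_add_distrib, evalJetHom_X]
    rw [add_comm]
    congr 1
    · rw [Finset.sum_mul]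
      exact Finset.sum_congr rfl fun _ _ => by ring
    · rw [Finset.sum_eq_single j]
      · simp
      · intro b _ hb
        simp [hb.symm]
      · exact fun hn => absurd hj hn

theorem evalJet {σ : Type*} (ε : ℂ) (p : DiffPoly σ) {γ : σ → ℂ → CircleFun}
    {γ' : σ → CircleFun} (h : ∀ i, PolyCurve (γ i) (γ' i)) {E : Finset (σ × ℕ)} (hE : p.vars ⊆ E) :
    PolyCurve (fun θ => evalJet ε p (fun i => γ i θ))
      (∑ ik ∈ E, WAlg.evalJet ε (MvPolynomial.pderiv ik p) (fun i => γ i 0) *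
        (ε ^ ik.2 • dx^[ik.2] (γ' ik.1))) := by
  classical
  obtain ⟨E₀, h₀⟩ := evalJet_aux ε p h
  have := h₀ (E₀ ∪ E) Finset.subset_union_left
  simp only [evalJet_eq]
  convert this using 1
  refine Finset.sum_subset Finset.subset_union_right fun ik _ hn => ?_
  rw [MvPolynomial.pderiv_eq_zero_of_notMem_vars fun hv => hn (hE hv), map_zero, zero_mul]

end PolyCurve

theorem pderiv_pderiv_comm {σ R : Type*} [CommRing R] (i j : σ) (p : MvPolynomial σ R) :
    MvPolynomial.pderiv i (MvPolynomial.pderiv j p) =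
      MvPolynomial.pderiv j (MvPolynomial.pderiv i p) := by
  classical
  have h : ⁅(MvPolynomial.pderiv i : Derivation R (MvPolynomial σ R) (MvPolynomial σ R)),
      (MvPolynomial.pderiv j : Derivation R (MvPolynomial σ R) (MvPolynomial σ R))⁆ = 0 := by
    refine MvPolynomial.derivation_ext fun k => ?_
    rw [Derivation.commutator_apply, MvPolynomial.pderiv_X, MvPolynomial.pderiv_X]
    simp only [Pi.single_apply]
    split_ifs <;> simp
  have := congrArg (fun D => D p) h
  simpa [Derivation.commutator_apply, sub_eq_zero] using this

/-! ### Variational derivatives -/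

section VarDeriv
variable {ι : Type*}

theorem IsVarDeriv.unique [Fintype ι] {f : (ι → CircleFun) → ℂ} {u g g' : ι → CircleFun}
    (h : IsVarDeriv f u g) (h' : IsVarDeriv f u g') : g = g' := by
  classical
  funext i
  rw [← sub_eq_zero]
  refine eq_zero_of_circleInt_mul _ fun ψ => ?_
  have := (h (Pi.single i ψ)).unique (h' (Pi.single i ψ))
  have e : ∀ k : ι → CircleFun, ∑ j, circleInt (k j * (Pi.single i ψ : ι → CircleFun) j) =
      circleInt (k i * ψ) := by
    intro k
    rw [Finset.sum_eq_single i]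
    · rw [Pi.single_eq_same]
    · intro j _ hj
      rw [Pi.single_eq_of_ne hj, mul_zero, circleInt_eq, map_zero]
    · simp
  rw [e, e] at this
  rw [sub_mul, circleInt_eq, map_sub, ← circleInt_eq, ← circleInt_eq, this, sub_self]

theorem IsVarDeriv.varDeriv_eq [Fintype ι] {f : (ι → CircleFun) → ℂ} {u g : ι → CircleFun}
    (h : IsVarDeriv f u g) : varDeriv f u = g :=
  (Classical.epsilon_spec (p := IsVarDeriv f u) ⟨g, h⟩).unique h

open Classical in
/-- The variational derivative of a density. -/
def euler (p : DiffPoly ι) (i : ι) (u : ι → CircleFun) : CircleFun :=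
  ∑ jk ∈ p.vars, if jk.1 = i then
    (-1 : ℂ) ^ jk.2 • dx^[jk.2] (evalJet 1 (MvPolynomial.pderiv jk p) u) else 0

theorem isDP_euler (p : DiffPoly ι) (i : ι) : IsDP (euler p i) := by
  refine isDP_sum _ fun jk _ => ?_
  split_ifs
  · exact ((isDP_evalJet_one _).iterate_dx _).smul _
  · exact isDP_zero

/-- Integration by parts: the Euler expression represents the first variation of the density. -/
theorem sum_circleInt_euler_mul [Fintype ι] (p : DiffPoly ι) (u s : ι → CircleFun) :
    ∑ i, circleInt (euler p i u * s i) =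
      circleInt (∑ ik ∈ p.vars, evalJet 1 (MvPolynomial.pderiv ik p) u * dx^[ik.2] (s ik.1)) := by
  classical
  simp only [euler, Finset.sum_mul, circleInt_eq, map_sum]
  rw [Finset.sum_comm]
  refine Finset.sum_congr rfl fun jk _ => ?_
  simp only [ite_mul, zero_mul]
  rw [Finset.sum_eq_single jk.1]
  · rw [if_pos rfl, ← circleInt_eq, ← circleInt_eq, circleInt_mul_iterate]
  · intro i _ hi
    rw [if_neg hi.symm, map_zero]
  · simp

theorem isVarDeriv_euler [Fintype ι] (p : DiffPoly ι) (u : ι → CircleFun) :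
    IsVarDeriv (localFunctional p) u fun i => euler p i u := by
  intro s
  rw [sum_circleInt_euler_mul]
  have := (PolyCurve.evalJet 1 p (fun i => PolyCurve.line (u i) (s i)) subset_rfl).hasDerivAt
  simp only [one_pow, one_smul, zero_smul, add_zero] at this
  exact this

theorem varDeriv_localFunctional [Fintype ι] (p : DiffPoly ι) (u : ι → CircleFun) :
    varDeriv (localFunctional p) u = fun i => euler p i u := (isVarDeriv_euler p u).varDeriv_eq

/-- Chain rule along curves that need not be straight lines, as required for gauge orbits. -/
theorem hasDerivAt_localFunctional [Fintype ι] (p : DiffPoly ι) (u : ι → CircleFun)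
    {γ : ι → ℂ → CircleFun} {s : ι → CircleFun} (h : ∀ i, PolyCurve (γ i) (s i))
    (h0 : ∀ i, γ i 0 = u i) :
    HasDerivAt (fun θ => localFunctional p fun i => γ i θ)
      (∑ i, circleInt (euler p i u * s i)) 0 := by
  have := (PolyCurve.evalJet 1 p h subset_rfl).hasDerivAt
  rw [sum_circleInt_euler_mul]
  simp only [one_pow, one_smul, h0] at this
  exact this

theorem IsDP.polyCurve {F : (ι → CircleFun) → CircleFun} (hF : IsDP F) (u s : ι → CircleFun) :
    ∃ γ', PolyCurve (fun θ : ℂ => F (u + θ • s)) γ' := by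
  obtain ⟨p, hp⟩ := hF
  simp only [hp]
  exact ⟨_, PolyCurve.evalJet 1 p (fun i => PolyCurve.line (u i) (s i)) subset_rfl⟩

/-- The second variation of a local functional is symmetric. -/
theorem hessian_symm [Fintype ι] (p : DiffPoly ι) (u s t a b : ι → CircleFun)
    (ha : ∀ i, PolyCurve (fun θ : ℂ => euler p i (u + θ • s)) (a i))
    (hb : ∀ i, PolyCurve (fun θ : ℂ => euler p i (u + θ • t)) (b i)) :
    ∑ i, circleInt (a i * t i) = ∑ i, circleInt (b i * s i) := by
  classical
  -- Differentiating the first variation in direction t along s gives a double sum in which s and t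
  -- play the same role, up to commuting partial derivatives.
  have key : ∀ s t a : ι → CircleFun,
      (∀ i, PolyCurve (fun θ : ℂ => euler p i (u + θ • s)) (a i)) →
      ∑ i, circleInt (a i * t i) = ∑ ik ∈ p.vars, ∑ jl ∈ p.vars,
        circleInt (evalJet 1 (MvPolynomial.pderiv jl (MvPolynomial.pderiv ik p)) u *
          dx^[jl.2] (s jl.1) * dx^[ik.2] (t ik.1)) := by
    intro s t a ha
    have h1 : HasDerivAt (fun θ : ℂ => circleInt (∑ i, euler p i (u + θ • s) * t i))
        (circleInt (∑ i, (a i * t i + 0))) 0 := by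
      refine PolyCurve.hasDerivAt (PolyCurve.sum _ fun i _ => ?_)
      have := (ha i).mul (PolyCurve.const (t i))
      rwa [mul_zero] at this
    have h2 : ∀ θ : ℂ, circleInt (∑ i, euler p i (u + θ • s) * t i) =
        circleInt (∑ ik ∈ p.vars, evalJet 1 (MvPolynomial.pderiv ik p) (u + θ • s) *
          dx^[ik.2] (t ik.1)) := by
      intro θ
      rw [← sum_circleInt_euler_mul, circleInt_eq, map_sum]
      rfl
    simp only [h2] at h1
    have h3 : HasDerivAt (fun θ : ℂ => circleInt (∑ ik ∈ p.vars,
        evalJet 1 (MvPolynomial.pderiv ik p) (u + θ • s) * dx^[ik.2] (t ik.1)))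
        (circleInt (∑ ik ∈ p.vars, ((∑ jl ∈ p.vars ∪ (MvPolynomial.pderiv ik p).vars,
          evalJet 1 (MvPolynomial.pderiv jl (MvPolynomial.pderiv ik p)) u *
          dx^[jl.2] (s jl.1)) * dx^[ik.2] (t ik.1) + 0))) 0 := by
      refine PolyCurve.hasDerivAt (PolyCurve.sum _ fun ik _ => ?_)
      have := (PolyCurve.evalJet 1 (MvPolynomial.pderiv ik p)
        (fun i => PolyCurve.line (u i) (s i))
        (Finset.subset_union_right (s₁ := p.vars))).mul (PolyCurve.const (dx^[ik.2] (t ik.1)))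
      simp only [one_pow, one_smul, zero_smul, add_zero, mul_zero] at this ⊢
      exact this
    have h4 := h1.unique h3
    simp only [add_zero] at h4
    rw [circleInt_eq, map_sum] at h4
    simp only [← circleInt_eq] at h4
    rw [h4]
    simp only [circleInt_eq, map_sum, Finset.sum_mul]
    refine Finset.sum_congr rfl fun ik _ => ?_
    -- The enlarged index set changes nothing: a second partial derivative in a variable absent from
    -- `p` vanishes.
    refine (Finset.sum_subset Finset.subset_union_left fun jl _ hn => ?_).symm
    have : MvPolynomial.pderiv jl (MvPolynomial.pderiv ik p) = 0 := by
      rw [pderiv_pderiv_comm]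
      rw [MvPolynomial.pderiv_eq_zero_of_notMem_vars hn, map_zero]
    rw [this, evalJet_eq, map_zero, zero_mul, zero_mul, map_zero]
  rw [key s t a ha, key t s b hb, Finset.sum_comm]
  refine Finset.sum_congr rfl fun ik _ => Finset.sum_congr rfl fun jl _ => ?_
  rw [pderiv_pderiv_comm, mul_right_comm]

end VarDeriv

/-! ### The loop algebra -/

section Loop
variable {𝔤 : Type*} [LieRing 𝔤] [LieAlgebra ℂ 𝔤]

instance loopAddCommGroup : AddCommGroup (Loop 𝔤) := TensorProduct.addCommGroup

instance loopAddGroup : AddGroup (Loop 𝔤) := AddCommGroup.toAddGroup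

/-- The loop algebra as a Lie ring, with the additive structure found by unification. -/
instance loopLieRing : LieRing (Loop 𝔤) where
  toAddCommGroup := loopAddCommGroup
  toBracket := LieAlgebra.ExtendScalars.instBracketTensorProduct ℂ CircleFun 𝔤 𝔤
  add_lie u v w := by
    have h := @add_lie (Loop 𝔤) (Loop 𝔤) (LieAlgebra.ExtendScalars.instLieRing ℂ CircleFun 𝔤) _ _
      u v w
    exact h
  lie_add u v w := by
    have h := @lie_add (Loop 𝔤) (Loop 𝔤) (LieAlgebra.ExtendScalars.instLieRing ℂ CircleFun 𝔤) _ _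
      u v w
    exact h
  lie_self u := by
    have h := @lie_self (Loop 𝔤) (LieAlgebra.ExtendScalars.instLieRing ℂ CircleFun 𝔤) u
    exact h
  leibniz_lie u v w := by
    have h := @LieRing.leibniz_lie (Loop 𝔤) (LieAlgebra.ExtendScalars.instLieRing ℂ CircleFun 𝔤)
      u v w
    exact h

instance loopLieAlgebra : LieAlgebra ℂ (Loop 𝔤) where
  lie_smul c u v := by
    have h := @LieAlgebra.lie_smul ℂ (Loop 𝔤) _
      (LieAlgebra.ExtendScalars.instLieRing ℂ CircleFun 𝔤) _ c u v
    exact h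

/-- Evaluation of functions at a point. -/
def evalAt (x : ℝ) : CircleFun →ₐ[ℂ] ℂ where
  toFun φ := φ.1 x
  map_one' := rfl
  map_mul' _ _ := rfl
  map_zero' := rfl
  map_add' _ _ := rfl
  commutes' _ := rfl

theorem circleFun_ext {φ ψ : CircleFun} (h : ∀ x, evalAt x φ = evalAt x ψ) : φ = ψ :=
  Subtype.ext (funext h)

/-- Evaluation of loops at a point. -/
def ev (x : ℝ) : Loop 𝔤 →ₗ[ℂ] 𝔤 :=
  (TensorProduct.lid ℂ 𝔤).toLinearMap ∘ₗ LinearMap.rTensor 𝔤 (evalAt x).toLinearMap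

theorem ev_tmul (x : ℝ) (φ : CircleFun) (y : 𝔤) : ev x (φ ⊗ₜ[ℂ] y) = evalAt x φ • y := rfl

theorem ev_const (x : ℝ) (y : 𝔤) : ev x (const y) = y := by
  rw [const, ev_tmul, map_one, one_smul]

theorem ev_smul (x : ℝ) (φ : CircleFun) (u : Loop 𝔤) : ev x (φ • u) = evalAt x φ • ev x u := by
  induction u using TensorProduct.induction_on with
  | zero => simp
  | tmul ψ y => rw [TensorProduct.smul_tmul', ev_tmul, ev_tmul, smul_eq_mul, map_mul, mul_smul]
  | add u v hu hv => rw [smul_add, map_add, map_add, hu, hv, smul_add]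

theorem ev_lie (x : ℝ) (u v : Loop 𝔤) : ev x ⁅u, v⁆ = ⁅ev x u, ev x v⁆ := by
  induction u using TensorProduct.induction_on with
  | zero => simp
  | add u u' hu hu' => rw [add_lie, map_add, map_add, hu, hu', add_lie]
  | tmul φ y =>
    induction v using TensorProduct.induction_on with
    | zero => simp
    | add u v hu hv => rw [lie_add, map_add, map_add, hu, hv, lie_add]
    | tmul ψ z =>
      rw [LieAlgebra.ExtendScalars.bracket_tmul, ev_tmul, ev_tmul, ev_tmul, map_mul, smul_lie,
        lie_smul, smul_smul]

/-- Application of a linear functional to the values of a loop. -/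
def app (ℓ : Module.Dual ℂ 𝔤) : Loop 𝔤 →ₗ[CircleFun] CircleFun :=
  (TensorProduct.AlgebraTensorModule.rid ℂ CircleFun CircleFun).toLinearMap ∘ₗ
    LinearMap.baseChange CircleFun ℓ

theorem app_tmul (ℓ : Module.Dual ℂ 𝔤) (φ : CircleFun) (y : 𝔤) : app ℓ (φ ⊗ₜ[ℂ] y) = ℓ y • φ := rfl

theorem app_smul_complex (ℓ : Module.Dual ℂ 𝔤) (c : ℂ) (u : Loop 𝔤) :
    app ℓ (c • u) = c • app ℓ u := by
  rw [← algebraMap_smul CircleFun c u, map_smul, algebraMap_smul]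

theorem evalAt_app (x : ℝ) (ℓ : Module.Dual ℂ 𝔤) (u : Loop 𝔤) :
    evalAt x (app ℓ u) = ℓ (ev x u) := by
  induction u using TensorProduct.induction_on with
  | zero => simp
  | tmul φ y => rw [app_tmul, ev_tmul, map_smul, map_smul, smul_eq_mul, smul_eq_mul, mul_comm]
  | add u v hu hv => rw [map_add, map_add, map_add, map_add, hu, hv]

theorem evalAt_pairing (x : ℝ) (u v : Loop 𝔤) :
    evalAt x (pairing u v) = killingForm ℂ 𝔤 (ev x u) (ev x v) := by
  unfold pairing
  induction u using TensorProduct.induction_on with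
  | zero => simp
  | add u u' hu hu' => simp only [map_add, LinearMap.add_apply, hu, hu']
  | tmul φ y =>
    induction v using TensorProduct.induction_on with
    | zero => simp
    | add u v hu hv => simp only [map_add, hu, hv]
    | tmul ψ z =>
      rw [LinearMap.BilinForm.baseChange_tmul, ev_tmul, ev_tmul, map_smul, map_smul, map_smul,
        LinearMap.smul_apply, map_mul]
      simp only [smul_eq_mul]
      ring

theorem ev_baseChange {V : Type*} [LieRing V] [LieAlgebra ℂ V] (x : ℝ) (M : 𝔤 →ₗ[ℂ] V)
    (u : Loop 𝔤) : ev x (M.baseChange CircleFun u) = M (ev x u) := by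
  induction u using TensorProduct.induction_on with
  | zero => simp
  | tmul φ y => rw [LinearMap.baseChange_tmul, ev_tmul, ev_tmul, map_smul]
  | add u v hu hv => rw [map_add, map_add, map_add, map_add, hu, hv]

theorem app_baseChange {V : Type*} [LieRing V] [LieAlgebra ℂ V] (ℓ : Module.Dual ℂ V)
    (M : 𝔤 →ₗ[ℂ] V) (u : Loop 𝔤) : app ℓ (M.baseChange CircleFun u) = app (ℓ ∘ₗ M) u := by
  refine circleFun_ext fun x => ?_
  rw [evalAt_app, evalAt_app, ev_baseChange, LinearMap.comp_apply]

theorem loop_eq_sum {κ : Type*} [Fintype κ] (B : Module.Basis κ ℂ 𝔤) (u : Loop 𝔤) :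
    u = ∑ k, app (B.coord k) u ⊗ₜ[ℂ] B k := by
  induction u using TensorProduct.induction_on with
  | zero => simp
  | tmul φ y =>
    simp only [app_tmul, TensorProduct.smul_tmul]
    rw [← TensorProduct.tmul_sum]
    simp only [Module.Basis.coord_apply, Module.Basis.sum_repr]
  | add u v hu hv =>
    simp only [map_add, TensorProduct.add_tmul, Finset.sum_add_distrib]
    rw [← hu, ← hv]

theorem loopDeriv_tmul (φ : CircleFun) (y : 𝔤) : loopDeriv (φ ⊗ₜ[ℂ] y) = dx φ ⊗ₜ[ℂ] y := rfl

theorem loopDeriv_const (y : 𝔤) : loopDeriv (const y) = 0 := by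
  rw [const, loopDeriv_tmul, dx_one, TensorProduct.zero_tmul]

theorem loopDeriv_smul (φ : CircleFun) (u : Loop 𝔤) :
    loopDeriv (φ • u) = dx φ • u + φ • loopDeriv u := by
  induction u using TensorProduct.induction_on with
  | zero => simp
  | tmul ψ y =>
    rw [TensorProduct.smul_tmul', TensorProduct.smul_tmul', loopDeriv_tmul, loopDeriv_tmul,
      TensorProduct.smul_tmul', smul_eq_mul, dx_mul, TensorProduct.add_tmul]
    rfl
  | add u v hu hv =>
    rw [smul_add, map_add, hu, hv, map_add, smul_add, smul_add, add_add_add_comm]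

theorem loopDeriv_lie (u v : Loop 𝔤) : loopDeriv ⁅u, v⁆ = ⁅loopDeriv u, v⁆ + ⁅u, loopDeriv v⁆ := by
  induction u using TensorProduct.induction_on with
  | zero => simp
  | add u u' hu hu' =>
    rw [add_lie, map_add, map_add, hu, hu', add_lie, add_lie, add_add_add_comm]
  | tmul φ y =>
    induction v using TensorProduct.induction_on with
    | zero => simp
    | add u v hu hv => rw [lie_add, map_add, map_add, hu, hv, lie_add, lie_add, add_add_add_comm]
    | tmul ψ z =>
      simp only [LieAlgebra.ExtendScalars.bracket_tmul, loopDeriv_tmul, dx_mul,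
        TensorProduct.add_tmul]

theorem app_loopDeriv (ℓ : Module.Dual ℂ 𝔤) (u : Loop 𝔤) : app ℓ (loopDeriv u) = dx (app ℓ u) := by
  induction u using TensorProduct.induction_on with
  | zero => simp
  | tmul φ y => rw [loopDeriv_tmul, app_tmul, app_tmul, map_smul]
  | add u v hu hv => rw [map_add, map_add, map_add, map_add, hu, hv]

theorem dx_pairing (u v : Loop 𝔤) :
    dx (pairing u v) = pairing (loopDeriv u) v + pairing u (loopDeriv v) := by
  unfold pairing
  induction u using TensorProduct.induction_on with
  | zero => simp
  | add u u' hu hu' =>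
    simp only [map_add, LinearMap.add_apply, hu, hu']
    abel
  | tmul φ y =>
    induction v using TensorProduct.induction_on with
    | zero => simp
    | add u v hu hv =>
      simp only [map_add, hu, hv]
      abel
    | tmul ψ z =>
      rw [loopDeriv_tmul, loopDeriv_tmul, LinearMap.BilinForm.baseChange_tmul,
        LinearMap.BilinForm.baseChange_tmul, LinearMap.BilinForm.baseChange_tmul, map_smul,
        ← smul_add, dx_mul]

theorem pairing_lie (u v w : Loop 𝔤) : pairing ⁅u, v⁆ w = pairing u ⁅v, w⁆ := by
  refine circleFun_ext fun x => ?_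
  rw [evalAt_pairing, evalAt_pairing, ev_lie, ev_lie]
  exact LieModule.traceForm_apply_lie_apply ℂ 𝔤 𝔤 _ _ _

theorem pairing_comm (u v : Loop 𝔤) : pairing u v = pairing v u := by
  refine circleFun_ext fun x => ?_
  rw [evalAt_pairing, evalAt_pairing]
  exact LieModule.traceForm_comm ℂ 𝔤 𝔤 _ _

theorem pairing_const_left (y : 𝔤) (u : Loop 𝔤) :
    pairing (const y) u = app (killingForm ℂ 𝔤 y) u := by
  refine circleFun_ext fun x => ?_
  rw [evalAt_pairing, evalAt_app, ev_const]

theorem pairing_tmul_left (φ : CircleFun) (y : 𝔤) (u : Loop 𝔤) :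
    pairing (φ ⊗ₜ[ℂ] y) u = φ * app (killingForm ℂ 𝔤 y) u := by
  refine circleFun_ext fun x => ?_
  rw [evalAt_pairing, map_mul, evalAt_app, ev_tmul, map_smul, LinearMap.smul_apply, smul_eq_mul]

/-- The form on loops as a bilinear map. -/
def loopFormL : Loop 𝔤 →ₗ[ℂ] Loop 𝔤 →ₗ[ℂ] ℂ :=
  LinearMap.mk₂ ℂ loopForm
    (fun u u' v => by
      simp only [loopForm, pairing, map_add, LinearMap.add_apply, circleInt_eq])
    (fun c u v => by
      simp only [loopForm, pairing, circleInt_eq]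
      rw [← algebraMap_smul CircleFun c u, map_smul, LinearMap.smul_apply, algebraMap_smul,
        map_smul])
    (fun u v v' => by
      simp only [loopForm, pairing, map_add, circleInt_eq])
    (fun c u v => by
      simp only [loopForm, pairing, circleInt_eq]
      rw [← algebraMap_smul CircleFun c v, map_smul, algebraMap_smul, map_smul])

theorem loopForm_eq (u v : Loop 𝔤) : loopForm u v = loopFormL u v := rfl

theorem loopForm_comm (u v : Loop 𝔤) : loopForm u v = loopForm v u := by
  rw [loopForm, pairing_comm, loopForm]

theorem loopForm_lie (u v w : Loop 𝔤) : loopForm ⁅u, v⁆ w = loopForm u ⁅v, w⁆ := by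
  rw [loopForm, pairing_lie, loopForm]

theorem loopForm_loopDeriv (u v : Loop 𝔤) :
    loopForm (loopDeriv u) v = -loopForm u (loopDeriv v) := by
  have h := circleInt_dx (pairing u v)
  rw [dx_pairing, circleInt_eq, map_add] at h
  exact eq_neg_of_add_eq_zero_left h

/-- The operator `[ε ∂_x + z, ·]`. -/
def conn (ε : ℂ) (z : Loop 𝔤) : Loop 𝔤 →ₗ[ℂ] Loop 𝔤 :=
  ε • loopDeriv + LieAlgebra.ad ℂ (Loop 𝔤) z

theorem conn_apply (ε : ℂ) (z v : Loop 𝔤) : conn ε z v = ε • loopDeriv v + ⁅z, v⁆ := rfl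

theorem conn_add_apply (ε : ℂ) (z w v : Loop 𝔤) : conn ε (z + w) v = conn ε z v + ⁅w, v⁆ := by
  rw [conn_apply, conn_apply, add_lie, add_assoc]

/-- Integration by parts for ∂_x and invariance of the Killing form for ad z. This is the
skew-symmetry of all the brackets. -/
theorem loopForm_conn (ε : ℂ) (z u v : Loop 𝔤) :
    loopForm (conn ε z u) v = -loopForm u (conn ε z v) := by
  have h1 := loopForm_loopDeriv u v
  have h2 : loopForm ⁅z, u⁆ v = -loopForm u ⁅z, v⁆ := by
    rw [← lie_skew, loopForm_eq, map_neg, LinearMap.neg_apply, ← loopForm_eq, loopForm_lie]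
  rw [loopForm_eq] at h1 h2 ⊢
  rw [loopForm_eq] at h1 h2 ⊢
  rw [conn_apply, conn_apply, map_add, map_add, map_smul, map_smul, LinearMap.add_apply,
    LinearMap.smul_apply, h1, h2, smul_neg, neg_add]

theorem conn_lie (ε : ℂ) (z u v : Loop 𝔤) :
    conn ε z ⁅u, v⁆ = ⁅conn ε z u, v⁆ + ⁅u, conn ε z v⁆ := by
  simp only [conn_apply, loopDeriv_lie, add_lie, lie_add, smul_add, smul_lie, lie_smul]
  rw [leibniz_lie z u v]
  abel

/-- The pencil is again a single connection, with the base point shifted by c a; everything proved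
for one connection applies to all members. -/
theorem pencil_eq (a : 𝔤) (c ε : ℂ) (z v : Loop 𝔤) :
    pencil a c ε z v = ε⁻¹ • conn ε (z + c • const a) v := by
  rw [pencil, P₂, P₁, conn_add_apply, conn_apply, smul_lie, smul_add _ _ (c • ⁅const a, v⁆),
    smul_comm c]

theorem loop_ext [FiniteDimensional ℂ 𝔤] {u v : Loop 𝔤} (h : ∀ x, ev x u = ev x v) : u = v := by
  have B := Module.finBasis ℂ 𝔤
  rw [loop_eq_sum B u, loop_eq_sum B v]
  refine Finset.sum_congr rfl fun k _ => ?_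
  congr 1
  refine circleFun_ext fun x => ?_
  rw [evalAt_app, evalAt_app, h]

theorem lie_smul_loop [FiniteDimensional ℂ 𝔤] (φ : CircleFun) (u v : Loop 𝔤) :
    ⁅u, φ • v⁆ = φ • ⁅u, v⁆ := by
  refine loop_ext fun x => ?_
  rw [ev_lie, ev_smul, ev_smul, ev_lie, lie_smul]

/-- Turns membership in L(V) into a pointwise condition, so that statements about 𝔤 transfer to
loops. -/
theorem mem_loops_iff [FiniteDimensional ℂ 𝔤] {V : Submodule ℂ 𝔤} {u : Loop 𝔤} :
    u ∈ loops V ↔ ∀ x, ev x u ∈ V := by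
  constructor
  · intro hu x
    rw [loops, Submodule.baseChange_eq_span] at hu
    induction hu using Submodule.span_induction with
    | mem u hu =>
      obtain ⟨y, hy, rfl⟩ := hu
      change ev x ((1 : CircleFun) ⊗ₜ[ℂ] y) ∈ V
      rw [ev_tmul]
      exact V.smul_mem _ hy
    | zero => simp
    | add u v _ _ hu hv => rw [map_add]; exact V.add_mem hu hv
    | smul φ u _ hu => rw [ev_smul]; exact V.smul_mem _ hu
  · intro h
    -- A projection onto V, extended to loops, fixes `u` by the pointwise hypothesis, and its image
    -- is contained in L(V).
    obtain ⟨W, hW⟩ := V.exists_isCompl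
    let π : 𝔤 →ₗ[ℂ] 𝔤 := V.subtype ∘ₗ V.projectionOnto W hW
    have hu : u = π.baseChange CircleFun u := by
      refine loop_ext fun x => ?_
      rw [ev_baseChange]
      exact (congrArg Subtype.val (Submodule.projectionOnto_apply_left hW ⟨_, h x⟩)).symm
    rw [hu]
    generalize u = w
    induction w using TensorProduct.induction_on with
    | zero => simp
    | tmul φ y =>
      rw [LinearMap.baseChange_tmul]
      exact Submodule.tmul_mem_baseChange_of_mem φ (V.projectionOnto W hW y).2
    | add u v hu hv => rw [map_add]; exact (loops V).add_mem hu hv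

theorem tmul_mem_loops {V : Submodule ℂ 𝔤} (φ : CircleFun) {y : 𝔤} (hy : y ∈ V) :
    φ ⊗ₜ[ℂ] y ∈ loops V := Submodule.tmul_mem_baseChange_of_mem φ hy

theorem const_mem_loops {V : Submodule ℂ 𝔤} {y : 𝔤} (hy : y ∈ V) : const y ∈ loops V :=
  tmul_mem_loops 1 hy

theorem smul_mem_loops {V : Submodule ℂ 𝔤} (c : ℂ) {u : Loop 𝔤} (hu : u ∈ loops V) :
    c • u ∈ loops V := by
  rw [← algebraMap_smul CircleFun c u]
  exact (loops V).smul_mem _ hu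

theorem loopDeriv_mem_loops [FiniteDimensional ℂ 𝔤] {V : Submodule ℂ 𝔤} {u : Loop 𝔤}
    (hu : u ∈ loops V) : loopDeriv u ∈ loops V := by
  rw [loops, Submodule.baseChange_eq_span] at hu
  induction hu using Submodule.span_induction with
  | mem u hu =>
    obtain ⟨y, hy, rfl⟩ := hu
    change loopDeriv (const y) ∈ loops V
    rw [loopDeriv_const]
    exact zero_mem _
  | zero => simp
  | add u v _ _ hu hv => rw [map_add]; exact add_mem hu hv
  | smul φ u hu' hu =>
    rw [loopDeriv_smul]
    rw [← Submodule.baseChange_eq_span] at hu'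
    exact add_mem ((loops V).smul_mem _ hu') ((loops V).smul_mem _ hu)

theorem loops_mono [FiniteDimensional ℂ 𝔤] {V W : Submodule ℂ 𝔤} (h : V ≤ W) {u : Loop 𝔤}
    (hu : u ∈ loops V) : u ∈ loops W :=
  mem_loops_iff.mpr fun x => h (mem_loops_iff.mp hu x)

theorem loopForm_tmul_left (φ : CircleFun) (y : 𝔤) (u : Loop 𝔤) :
    loopForm (φ ⊗ₜ[ℂ] y) u = circleInt (φ * app (killingForm ℂ 𝔤 y) u) := by
  rw [loopForm, pairing_tmul_left]

theorem loopForm_eq_zero {u v : Loop 𝔤} (h : ∀ x, killingForm ℂ 𝔤 (ev x u) (ev x v) = 0) :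
    loopForm u v = 0 := by
  have : pairing u v = 0 := circleFun_ext fun x => by rw [evalAt_pairing, h, map_zero]
  rw [loopForm, this, circleInt_eq, map_zero]

/-- If a loop is orthogonal to all loops in `V`, its values are orthogonal to `V`. -/
theorem killingForm_ev_eq_zero {V : Submodule ℂ 𝔤} {u : Loop 𝔤}
    (h : ∀ v ∈ loops V, loopForm v u = 0) (x : ℝ) {y : 𝔤} (hy : y ∈ V) :
    killingForm ℂ 𝔤 y (ev x u) = 0 := by
  rw [← evalAt_app, eq_zero_of_circleInt_mul (app (killingForm ℂ 𝔤 y) u), map_zero]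
  intro ψ
  rw [mul_comm, ← loopForm_tmul_left]
  exact h _ (tmul_mem_loops ψ hy)

theorem loopForm_nondegenerate [FiniteDimensional ℂ 𝔤] [LieAlgebra.IsKilling ℂ 𝔤] {u : Loop 𝔤}
    (h : ∀ v, loopForm v u = 0) : u = 0 := by
  refine loop_ext fun x => ?_
  rw [map_zero]
  refine (LieAlgebra.IsKilling.killingForm_nondegenerate ℂ 𝔤).2 _ fun y => ?_
  exact killingForm_ev_eq_zero (V := ⊤) (fun v _ => h v) x trivial

theorem IsGradient.unique [FiniteDimensional ℂ 𝔤] [LieAlgebra.IsKilling ℂ 𝔤] {F : Loop 𝔤 → ℂ}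
    {z g g' : Loop 𝔤} (h : IsGradient F z g) (h' : IsGradient F z g') : g = g' := by
  rw [← sub_eq_zero]
  refine loopForm_nondegenerate fun v => ?_
  have h1 := (h v).unique (h' v)
  rw [loopForm_comm, loopForm_eq, map_sub, LinearMap.sub_apply, ← loopForm_eq, ← loopForm_eq, h1,
    sub_self]

theorem IsGradient.gradient_eq [FiniteDimensional ℂ 𝔤] [LieAlgebra.IsKilling ℂ 𝔤]
    {F : Loop 𝔤 → ℂ} {z g : Loop 𝔤} (h : IsGradient F z g) : gradient F z = g :=
  (Classical.epsilon_spec (p := IsGradient F z) ⟨g, h⟩).unique h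

theorem const_add (y z : 𝔤) : const (y + z) = const y + const z := TensorProduct.tmul_add _ _ _

end Loop

/-! ### Finite-dimensional representations of `sl₂` -/

section Sl2
open Polynomial
variable {V : Type*} [AddCommGroup V] [Module ℂ V] {E H F : Module.End ℂ V}

theorem sl2_commute_pow (hef : E * F = F * E + H) (hhf : H * F = F * H - (2 : ℂ) • F) (n : ℕ) :
    E * F ^ (n + 1) = F ^ (n + 1) * E + ((n : ℂ) + 1) • (F ^ n * (H - (n : ℂ) • 1)) := by
  induction n with
  | zero => simp [hef]
  | succ n ih =>
    have h1 : F ^ n * F = F ^ (n + 1) := (pow_succ F n).symm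
    have h2 : F ^ (n + 1) * F = F ^ (n + 1 + 1) := (pow_succ F (n + 1)).symm
    have h3 : E * F ^ (n + 1 + 1) = E * F ^ (n + 1) * F := by rw [mul_assoc, h2]
    rw [h3, ih, add_mul, smul_mul_assoc, mul_assoc, mul_assoc, hef, sub_mul, hhf, smul_mul_assoc,
      one_mul, mul_add, mul_sub, mul_sub, mul_sub, ← mul_assoc, h2, ← mul_assoc, h1, mul_smul_comm,
      mul_smul_comm, h1, mul_smul_comm, mul_one]
    push_cast
    module

/-- Highest weights are nonnegative integers. Applying E to F^(n+1) x = 0 gives F^n (H - n) x = 0,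
and (H - n) x is again killed by E. -/
theorem sl2_ker_left (hef : E * F = F * E + H) (hhe : E * H = H * E - (2 : ℂ) • E)
    (hhf : H * F = F * H - (2 : ℂ) • F) (n : ℕ) {x : V} (hx : E x = 0) (hn : (F ^ n) x = 0) :
    aeval H (∏ i ∈ Finset.range n, (X - C (i : ℂ))) x = 0 := by
  induction n generalizing x with
  | zero => simpa using hn
  | succ n ih =>
    have h1 := congrArg (fun T => T x) (sl2_commute_pow hef hhf n)
    simp only [Module.End.mul_apply, hn, map_zero, LinearMap.add_apply, hx, zero_add,
      LinearMap.smul_apply, LinearMap.sub_apply, Module.End.one_apply] at h1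
    have h2 : (F ^ n) (H x - (n : ℂ) • x) = 0 :=
      (smul_eq_zero.mp h1.symm).resolve_left (by exact_mod_cast n.succ_ne_zero)
    have h3 : E (H x - (n : ℂ) • x) = 0 := by
      have := congrArg (fun T => T x) hhe
      simp only [Module.End.mul_apply, LinearMap.sub_apply, LinearMap.smul_apply, hx, map_zero,
        smul_zero, sub_zero] at this
      rw [map_sub, map_smul, this, hx, smul_zero, sub_zero]
    have h4 := ih h3 h2
    rw [Finset.prod_range_succ, map_mul, Module.End.mul_apply]
    simp only [map_sub, aeval_X, aeval_C, LinearMap.sub_apply, Module.algebraMap_end_apply]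
    simpa only [map_sub, aeval_X, aeval_C] using h4

/-- The same induction for the triple (F, E, -H), with the hypothesis E F y = 0 weakening F y = 0;
it bounds the weights of y by 0 from above. -/
theorem sl2_ker_comp (hef : E * F = F * E + H) (hhe : E * H = H * E - (2 : ℂ) • E)
    (hhf : H * F = F * H - (2 : ℂ) • F) (n : ℕ) {y : V} (hy : E (F y) = 0) (hn : (E ^ n) y = 0) :
    aeval H (∏ i ∈ Finset.range n, (X - C (-(i : ℂ)))) y = 0 := by
  induction n generalizing y with
  | zero => simpa using hn
  | succ n ih =>
    have h1 := congrArg (fun T => T y) (sl2_commute_pow (E := F) (F := E) (H := -H)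
      (by rw [hef]; abel) (by rw [neg_mul, mul_neg, hhe]; module) n)
    have h0 : (E ^ (n + 1)) (F y) = 0 := by
      rw [pow_succ, Module.End.mul_apply, hy, map_zero]
    simp only [Module.End.mul_apply, hn, map_zero, LinearMap.add_apply, h0, zero_add,
      LinearMap.smul_apply, LinearMap.sub_apply, Module.End.one_apply, LinearMap.neg_apply] at h1
    have h2 : (E ^ n) (H y - (-(n : ℂ)) • y) = 0 := by
      have := (smul_eq_zero.mp h1.symm).resolve_left (by exact_mod_cast n.succ_ne_zero)
      rw [← neg_eq_zero, ← map_neg]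
      convert this using 2
      module
    have h3 : E (F (H y - (-(n : ℂ)) • y)) = 0 := by
      have a1 := congrArg (fun T => T y) hhf
      have a2 := congrArg (fun T => T (F y)) hhe
      simp only [Module.End.mul_apply, LinearMap.sub_apply, LinearMap.smul_apply, hy, map_zero,
        smul_zero, sub_zero] at a1 a2
      rw [eq_sub_iff_add_eq] at a1
      rw [map_sub, map_smul, ← a1, map_sub, map_add, map_smul, map_smul, a2, hy]
      simp
    have h4 := ih h3 h2
    rw [Finset.prod_range_succ, map_mul, Module.End.mul_apply]
    simp only [map_sub, aeval_X, aeval_C, LinearMap.sub_apply, Module.algebraMap_end_apply]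
    simpa only [map_sub, aeval_X, aeval_C] using h4

theorem sl2_aeval_comp (hhf : H * F = F * H - (2 : ℂ) • F) (n : ℕ) (y : V) :
    aeval H (∏ i ∈ Finset.range n, (X - C (-(i : ℂ) - 2))) (F y) =
      F (aeval H (∏ i ∈ Finset.range n, (X - C (-(i : ℂ)))) y) := by
  induction n generalizing y with
  | zero => simp
  | succ n ih =>
    have a1 := congrArg (fun T => T y) hhf
    simp only [Module.End.mul_apply, LinearMap.sub_apply, LinearMap.smul_apply] at a1
    have h1 : aeval H (X - C (-(n : ℂ) - 2)) (F y) = F (aeval H (X - C (-(n : ℂ))) y) := by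
      simp only [map_sub, aeval_X, aeval_C, LinearMap.sub_apply, a1,
        Module.algebraMap_end_apply, map_smul]
      module
    rw [Finset.prod_range_succ, map_mul, Module.End.mul_apply, h1, ih, Finset.prod_range_succ,
      map_mul, Module.End.mul_apply]

/-- In a representation of `sl₂` with nilpotent `e` and `f`, `ker e ∩ im f = 0`. -/
theorem sl2_eq_zero (hef : E * F = F * E + H) (hhe : E * H = H * E - (2 : ℂ) • E)
    (hhf : H * F = F * H - (2 : ℂ) • F) (hE : IsNilpotent E) (hF : IsNilpotent F) {y : V}
    (hy : E (F y) = 0) : F y = 0 := by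
  obtain ⟨m, hm⟩ := hE
  obtain ⟨n, hn⟩ := hF
  have h1 := sl2_ker_left hef hhe hhf n hy (by rw [hn]; rfl)
  have h2 : aeval H (∏ i ∈ Finset.range m, (X - C (-(i : ℂ) - 2))) (F y) = 0 := by
    rw [sl2_aeval_comp hhf, sl2_ker_comp hef hhe hhf m hy (by rw [hm]; rfl), map_zero]
  -- F y is annihilated by a polynomial in H with roots ≥ 0, being killed by E, and by one with
  -- roots ≤ -2, coming from y shifted by F. Their coprimality forces F y = 0, without complete
  -- reducibility.
  have hco : IsCoprime (∏ i ∈ Finset.range n, (X - C (i : ℂ)))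
      (∏ i ∈ Finset.range m, (X - C (-(i : ℂ) - 2))) := by
    refine IsCoprime.prod_left fun i _ => IsCoprime.prod_right fun j _ => ?_
    refine isCoprime_X_sub_C_of_isUnit_sub (isUnit_iff_ne_zero.mpr ?_)
    have : ((i + j + 2 : ℕ) : ℂ) ≠ 0 := Nat.cast_ne_zero.mpr (by omega)
    intro h
    apply this
    push_cast
    linear_combination h
  obtain ⟨p, q, hpq⟩ := hco
  have h3 := congrArg (fun P => aeval H P (F y)) hpq
  simp only [map_add, map_mul, LinearMap.add_apply, Module.End.mul_apply, h1, h2, map_zero,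
    add_zero, map_one, Module.End.one_apply] at h3
  exact h3.symm

end Sl2

/-! ### The graded structure -/

section Killing
variable {𝔤 : Type*} [LieRing 𝔤] [LieAlgebra ℂ 𝔤] [FiniteDimensional ℂ 𝔤]

theorem killingForm_lie_left (x y z : 𝔤) :
    killingForm ℂ 𝔤 ⁅x, y⁆ z = killingForm ℂ 𝔤 x ⁅y, z⁆ :=
  LieModule.traceForm_apply_lie_apply ℂ 𝔤 𝔤 x y z

theorem killingForm_symm (x y : 𝔤) : killingForm ℂ 𝔤 x y = killingForm ℂ 𝔤 y x :=
  LieModule.traceForm_comm ℂ 𝔤 𝔤 x y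

theorem killingForm_lie_middle (x y z : 𝔤) :
    killingForm ℂ 𝔤 y ⁅x, z⁆ = -killingForm ℂ 𝔤 ⁅x, y⁆ z := by
  rw [← killingForm_lie_left, ← lie_skew, map_neg, LinearMap.neg_apply]

variable [LieAlgebra.IsKilling ℂ 𝔤]

theorem exists_killingForm_eq (ℓ : Module.Dual ℂ 𝔤) :
    ∃ y, ∀ x, killingForm ℂ 𝔤 y x = ℓ x :=
  ⟨(LinearMap.BilinForm.toDual _ (LieAlgebra.IsKilling.killingForm_nondegenerate ℂ 𝔤)).symm ℓ,
    fun _ => LinearMap.BilinForm.apply_toDual_symm_apply _ _⟩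

theorem exists_killingForm_ne_zero {W : Submodule ℂ 𝔤} {x : 𝔤} (hx : x ∉ W) :
    ∃ y, (∀ w ∈ W, killingForm ℂ 𝔤 y w = 0) ∧ killingForm ℂ 𝔤 y x ≠ 0 := by
  obtain ⟨ℓ, h1, h2⟩ := Submodule.exists_dual_map_eq_bot_of_notMem hx inferInstance
  obtain ⟨y, hy⟩ := exists_killingForm_eq ℓ
  refine ⟨y, fun w hw => ?_, by rwa [hy]⟩
  rw [hy, ← Submodule.mem_bot ℂ, ← h2]
  exact Submodule.mem_map_of_mem hw

theorem eq_zero_of_killingForm {x : 𝔤} (h : ∀ y, killingForm ℂ 𝔤 x y = 0) : x = 0 :=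
  (LieAlgebra.IsKilling.killingForm_nondegenerate ℂ 𝔤).1 x h

end Killing

namespace ReductionData
variable {𝔤 : Type*} [LieRing 𝔤] [LieAlgebra ℂ 𝔤] (d : ReductionData 𝔤)

/-- The projection to the graded piece `𝔤_j`. -/
def comp (j : ℤ) : 𝔤 →ₗ[ℂ] 𝔤 :=
  (d.gr j).subtype ∘ₗ DirectSum.component ℂ ℤ (fun i => d.gr i) j ∘ₗ
    (LinearEquiv.ofBijective (DirectSum.coeLinearMap d.gr) d.internal).symm.toLinearMap

theorem comp_mem (j : ℤ) (x : 𝔤) : d.comp j x ∈ d.gr j := Submodule.coe_mem _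

theorem comp_of_mem' {i : ℤ} (j : ℤ) {x : 𝔤} (hx : x ∈ d.gr i) :
    d.comp j x = if i = j then x else 0 := by
  have h : (LinearEquiv.ofBijective (DirectSum.coeLinearMap d.gr) d.internal).symm x =
      DirectSum.lof ℂ ℤ (fun i => d.gr i) i ⟨x, hx⟩ := by
    rw [LinearEquiv.symm_apply_eq]
    exact (DirectSum.coeLinearMap_lof d.gr i ⟨x, hx⟩).symm
  simp only [comp, LinearMap.comp_apply, LinearEquiv.coe_coe, h]
  split_ifs with hij
  · subst hij
    rw [DirectSum.component.lof_self]
    rfl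
  · rw [DirectSum.component.of, dif_neg hij]
    rfl

theorem comp_of_mem {j : ℤ} {x : 𝔤} (hx : x ∈ d.gr j) : d.comp j x = x := by
  rw [d.comp_of_mem' j hx, if_pos rfl]

theorem comp_of_ne {i j : ℤ} (hij : i ≠ j) {x : 𝔤} (hx : x ∈ d.gr i) : d.comp j x = 0 := by
  rw [d.comp_of_mem' j hx, if_neg hij]

theorem gr_induction {p : 𝔤 → Prop} (hg : ∀ i, ∀ x ∈ d.gr i, p x) (h0 : p 0)
    (ha : ∀ x y, p x → p y → p (x + y)) (x : 𝔤) : p x :=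
  Submodule.iSup_induction d.gr (motive := p)
    (by rw [d.internal.submodule_iSup_eq_top]; trivial) hg h0 ha

theorem comp_lie {i : ℤ} {y : 𝔤} (hy : y ∈ d.gr i) (j : ℤ) (x : 𝔤) :
    d.comp (i + j) ⁅y, x⁆ = ⁅y, d.comp j x⁆ := by
  refine d.gr_induction (p := fun x => d.comp (i + j) ⁅y, x⁆ = ⁅y, d.comp j x⁆) ?_ (by simp) ?_ x
  · intro k x hx
    rw [d.comp_of_mem' _ (d.lie_mem i k y hy x hx), d.comp_of_mem' _ hx]
    by_cases h : k = j
    · rw [if_pos h, if_pos (by omega)]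
    · rw [if_neg h, if_neg (by omega), lie_zero]
  · intro x x' hx hx'
    rw [lie_add, map_add, hx, hx', map_add, lie_add]

/-- The filtration `⨁_{i ≤ k} 𝔤_i`. -/
def fil (k : ℤ) : Submodule ℂ 𝔤 := ⨅ j : ℤ, ⨅ _ : k < j, LinearMap.ker (d.comp j)

theorem mem_fil {k : ℤ} {x : 𝔤} : x ∈ d.fil k ↔ ∀ j, k < j → d.comp j x = 0 := by
  simp [fil, Submodule.mem_iInf]

theorem gr_le_fil {i k : ℤ} (h : i ≤ k) : d.gr i ≤ d.fil k := fun _ hx =>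
  d.mem_fil.mpr fun _ hj => d.comp_of_ne (by omega) hx

theorem fil_mono {i k : ℤ} (h : i ≤ k) : d.fil i ≤ d.fil k := fun _ hx =>
  d.mem_fil.mpr fun j hj => d.mem_fil.mp hx j (by omega)

theorem exists_bound [FiniteDimensional ℂ 𝔤] :
    ∃ N : ℕ, ∀ i : ℤ, (N : ℤ) < |i| → d.gr i = ⊥ := by
  have hN : {i | d.gr i ≠ ⊥}.Finite :=
    WellFoundedGT.finite_ne_bot_of_iSupIndep d.internal.submodule_iSupIndep
  obtain ⟨N, hN⟩ := (hN.image fun i => i.natAbs).bddAbove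
  refine ⟨N, fun i hi => ?_⟩
  by_contra h
  have h1 : i.natAbs ≤ N := hN (Set.mem_image_of_mem _ h)
  rw [Int.abs_eq_natAbs] at hi
  omega

/-- A bound for the degrees that occur. -/
def bound [FiniteDimensional ℂ 𝔤] : ℕ := d.exists_bound.choose

section
variable [FiniteDimensional ℂ 𝔤]

theorem gr_eq_bot {i : ℤ} (hi : (d.bound : ℤ) < |i|) : d.gr i = ⊥ := d.exists_bound.choose_spec i hi

theorem sum_comp (x : 𝔤) : ∑ j ∈ Finset.Icc (-(d.bound : ℤ)) d.bound, d.comp j x = x := by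
  refine d.gr_induction
    (p := fun x => ∑ j ∈ Finset.Icc (-(d.bound : ℤ)) d.bound, d.comp j x = x) ?_ (by simp) ?_ x
  · intro i x hx
    by_cases hi : (d.bound : ℤ) < |i|
    · rw [d.gr_eq_bot hi, Submodule.mem_bot] at hx
      simp [hx]
    · rw [Finset.sum_eq_single i, d.comp_of_mem hx]
      · intro j _ hj
        exact d.comp_of_ne hj.symm hx
      · intro h
        exact absurd (Finset.mem_Icc.mpr (abs_le.mp (not_lt.mp hi))) h
  · intro x y hx hy
    simp only [map_add, Finset.sum_add_distrib, hx, hy]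

theorem fil_le {k : ℤ} {W : Submodule ℂ 𝔤} (h : ∀ i ≤ k, d.gr i ≤ W) : d.fil k ≤ W := by
  intro x hx
  rw [← d.sum_comp x]
  refine Submodule.sum_mem _ fun j _ => ?_
  by_cases hj : k < j
  · rw [d.mem_fil.mp hx j hj]
    exact W.zero_mem
  · exact h j (by omega) (d.comp_mem j x)

theorem fil_eq_bot {k : ℤ} (hk : k < -(d.bound : ℤ)) : d.fil k = ⊥ :=
  le_bot_iff.mp (d.fil_le fun i hi => (d.gr_eq_bot (by rw [lt_abs]; omega)).le)

theorem fil_eq_top {k : ℤ} (hk : (d.bound : ℤ) ≤ k) : d.fil k = ⊤ := by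
  refine top_le_iff.mp fun x _ => d.mem_fil.mpr fun j hj => ?_
  have := d.comp_mem j x
  rw [d.gr_eq_bot (by rw [lt_abs]; omega), Submodule.mem_bot] at this
  exact this

theorem lie_mem_fil {i j : ℤ} {x y : 𝔤} (hx : x ∈ d.fil i) (hy : y ∈ d.fil j) :
    ⁅x, y⁆ ∈ d.fil (i + j) := by
  have h1 : ∀ a ≤ i, ∀ x ∈ d.gr a, ∀ y ∈ d.fil j, ⁅x, y⁆ ∈ d.fil (i + j) := by
    intro a ha x hx y hy
    refine d.fil_le (W := (d.fil (i + j)).comap (LieAlgebra.ad ℂ 𝔤 x)) ?_ hy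
    intro b hb y hy
    exact d.gr_le_fil (by omega) (d.lie_mem a b x hx y hy)
  have h2 := d.fil_le (W := (d.fil (i + j)).comap (LieAlgebra.ad ℂ 𝔤 y)) (k := i) ?_ hx
  · rw [Submodule.mem_comap, LieAlgebra.ad_apply, ← lie_skew, neg_mem_iff] at h2
    exact h2
  · intro a ha x hx
    rw [Submodule.mem_comap, LieAlgebra.ad_apply, ← lie_skew, neg_mem_iff]
    exact h1 a ha x hx y hy

/-- ad x ad y shifts the degree by i + j ≠ 0, so its trace vanishes. -/
theorem killingForm_gr {i j : ℤ} (hij : i + j ≠ 0) {x y : 𝔤} (hx : x ∈ d.gr i) (hy : y ∈ d.gr j) :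
    killingForm ℂ 𝔤 x y = 0 := by
  rw [killingForm_apply_apply]
  refine LinearMap.trace_eq_zero_of_mapsTo_ne d.internal (fun k => i + j + k) (by simpa using hij)
    fun k z hz => ?_
  have := d.lie_mem _ _ x hx _ (d.lie_mem _ _ y hy z hz)
  rwa [← add_assoc] at this

theorem killingForm_fil {i j : ℤ} (hij : i + j < 0) {x y : 𝔤} (hx : x ∈ d.fil i)
    (hy : y ∈ d.fil j) : killingForm ℂ 𝔤 x y = 0 := by
  have h1 : ∀ a ≤ i, ∀ x ∈ d.gr a, killingForm ℂ 𝔤 x y = 0 := by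
    intro a ha x hx
    refine d.fil_le (W := LinearMap.ker (killingForm ℂ 𝔤 x)) ?_ hy
    intro b hb y hy
    exact d.killingForm_gr (by omega) hx hy
  have h2 := d.fil_le (W := LinearMap.ker (killingForm ℂ 𝔤 y)) (k := i) ?_ hx
  · rw [killingForm_symm]
    exact h2
  · intro a ha x hx
    rw [LinearMap.mem_ker, killingForm_symm]
    exact h1 a ha x hx

theorem isNilpotent_of_mapsTo_fil {T : Module.End ℂ 𝔤}
    (h : ∀ k, ∀ x ∈ d.fil k, T x ∈ d.fil (k - 1)) : IsNilpotent T := by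
  have h1 : ∀ n : ℕ, ∀ x, (T ^ n) x ∈ d.fil (d.bound - n) := by
    intro n
    induction n with
    | zero => intro x; rw [d.fil_eq_top (by simp)]; trivial
    | succ n ih =>
      intro x
      rw [pow_succ', Module.End.mul_apply]
      have := h _ _ (ih x)
      convert this using 2
      push_cast
      ring
  refine ⟨2 * d.bound + 1, LinearMap.ext fun x => ?_⟩
  have := h1 (2 * d.bound + 1) x
  rwa [d.fil_eq_bot (by push_cast; omega), Submodule.mem_bot] at this

/-! ### The `sl₂`-triple -/

theorem isNilpotent_ad_f : IsNilpotent (LieAlgebra.ad ℂ 𝔤 d.f) :=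
  d.isNilpotent_of_mapsTo_fil fun k x hx => d.fil_mono (by omega)
    (d.lie_mem_fil (d.gr_le_fil le_rfl d.f_mem) hx)

theorem isNilpotent_ad_e : IsNilpotent (LieAlgebra.ad ℂ 𝔤 d.e) := by
  have h1 : ∀ n : ℕ, ∀ i : ℤ, ∀ x ∈ d.gr i, ((LieAlgebra.ad ℂ 𝔤 d.e) ^ n) x ∈ d.gr (2 * n + i) := by
    intro n
    induction n with
    | zero => intro i x hx; simpa using hx
    | succ n ih =>
      intro i x hx
      rw [pow_succ', Module.End.mul_apply]
      have := d.lie_mem 2 _ d.e d.e_mem _ (ih i x hx)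
      rw [show 2 * ((n + 1 : ℕ) : ℤ) + i = 2 + (2 * n + i) by push_cast; ring]
      exact this
  refine ⟨d.bound + 1, LinearMap.ext fun x => ?_⟩
  refine d.gr_induction (p := fun x => ((LieAlgebra.ad ℂ 𝔤 d.e) ^ (d.bound + 1)) x = 0) ?_
    (map_zero _) (fun x y hx hy => by rw [map_add, hx, hy, add_zero]) x
  intro i x hx
  by_cases hi : (d.bound : ℤ) < |i|
  · rw [d.gr_eq_bot hi, Submodule.mem_bot] at hx
    rw [hx, map_zero]
  · have := h1 (d.bound + 1) i x hx
    rwa [d.gr_eq_bot, Submodule.mem_bot] at this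
    rw [not_lt, abs_le] at hi
    rw [lt_abs]
    push_cast
    omega

theorem ad_relations : let E := LieAlgebra.ad ℂ 𝔤 d.e; let F := LieAlgebra.ad ℂ 𝔤 d.f
    let H := LieAlgebra.ad ℂ 𝔤 d.h
    E * F = F * E + H ∧ E * H = H * E - (2 : ℂ) • E ∧ H * F = F * H - (2 : ℂ) • F := by
  refine ⟨LinearMap.ext fun x => ?_, LinearMap.ext fun x => ?_, LinearMap.ext fun x => ?_⟩
  · simp only [Module.End.mul_apply, LieAlgebra.ad_apply, LinearMap.add_apply]
    rw [leibniz_lie, d.lie_e_f, add_comm]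
  · simp only [Module.End.mul_apply, LieAlgebra.ad_apply, LinearMap.sub_apply,
      LinearMap.smul_apply]
    rw [leibniz_lie d.h, d.lie_h_e, smul_lie]
    abel
  · simp only [Module.End.mul_apply, LieAlgebra.ad_apply, LinearMap.sub_apply,
      LinearMap.smul_apply]
    rw [leibniz_lie d.h, d.lie_h_f, smul_lie]
    module

theorem lie_f_eq_zero_of_lie_e {y : 𝔤} (h : ⁅d.e, ⁅d.f, y⁆⁆ = 0) : ⁅d.f, y⁆ = 0 :=
  sl2_eq_zero d.ad_relations.1 d.ad_relations.2.1 d.ad_relations.2.2 d.isNilpotent_ad_e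
    d.isNilpotent_ad_f h

theorem lie_e_eq_zero_of_lie_f {y : 𝔤} (h : ⁅d.f, ⁅d.e, y⁆⁆ = 0) : ⁅d.e, y⁆ = 0 := by
  obtain ⟨h1, h2, h3⟩ := d.ad_relations
  exact sl2_eq_zero (E := LieAlgebra.ad ℂ 𝔤 d.f) (F := LieAlgebra.ad ℂ 𝔤 d.e)
    (H := -LieAlgebra.ad ℂ 𝔤 d.h) (by rw [h1]; abel) (by rw [neg_mul, mul_neg, h3]; module)
    (by rw [neg_mul, mul_neg, h2]; module) d.isNilpotent_ad_f d.isNilpotent_ad_e h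

/-- The image of `ad f`. -/
def imF : Submodule ℂ 𝔤 := LinearMap.range (LieAlgebra.ad ℂ 𝔤 d.f)

theorem mem_centralizer {x : 𝔤} : x ∈ d.centralizer ↔ ⁅d.f, x⁆ = 0 := Iff.rfl

/-- The map `[f, 𝔤] × 𝔤_f → 𝔤`, `(v, w) ↦ [e, v] + w`. -/
def splitMap : d.imF × d.centralizer →ₗ[ℂ] 𝔤 :=
  (LieAlgebra.ad ℂ 𝔤 d.e ∘ₗ d.imF.subtype).coprod d.centralizer.subtype

/-- If [e,v] + w = 0 with v ∈ [f,𝔤] and w ∈ 𝔤_f, then [e,v] lies in ker ad f ∩ im ad e = 0, and so v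
lies in ker ad e ∩ im ad f = 0. Rank–nullity for ad f then upgrades injectivity to a decomposition
of 𝔤. -/
theorem splitMap_injective : Function.Injective d.splitMap := by
  rw [injective_iff_map_eq_zero]
  rintro ⟨⟨v, y, rfl⟩, ⟨w, hw⟩⟩ h
  simp only [splitMap, LinearMap.coprod_apply, LinearMap.comp_apply, Submodule.subtype_apply,
    LieAlgebra.ad_apply] at h
  have h1 : ⁅d.f, ⁅d.e, ⁅d.f, y⁆⁆⁆ = 0 := by
    rw [eq_neg_of_add_eq_zero_left h, lie_neg, d.mem_centralizer.mp hw, neg_zero]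
  have h2 := d.lie_e_eq_zero_of_lie_f h1
  have h3 := d.lie_f_eq_zero_of_lie_e h2
  rw [h2, zero_add] at h
  ext
  · exact h3
  · exact h

/-- The decomposition `𝔤 = [e, [f, 𝔤]] ⊕ 𝔤_f`. -/
def splitEquiv : (d.imF × d.centralizer) ≃ₗ[ℂ] 𝔤 :=
  LinearEquiv.ofInjectiveOfFinrankEq d.splitMap d.splitMap_injective (by
    rw [Module.finrank_prod]
    exact LinearMap.finrank_range_add_finrank_ker _)

/-- The partial inverse of `ad e`, with values in `[f, 𝔤]` and kernel `𝔤_f`. -/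
def theta : 𝔤 →ₗ[ℂ] 𝔤 := d.imF.subtype ∘ₗ LinearMap.fst ℂ _ _ ∘ₗ d.splitEquiv.symm.toLinearMap

theorem theta_add {v w : 𝔤} (hv : v ∈ d.imF) (hw : w ∈ d.centralizer) :
    d.theta (⁅d.e, v⁆ + w) = v := by
  have h : d.splitEquiv.symm (⁅d.e, v⁆ + w) = (⟨v, hv⟩, ⟨w, hw⟩) := by
    rw [LinearEquiv.symm_apply_eq]
    rfl
  simp [theta, h]

theorem theta_lie_e {v : 𝔤} (hv : v ∈ d.imF) : d.theta ⁅d.e, v⁆ = v := by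
  have := d.theta_add hv d.centralizer.zero_mem
  rwa [add_zero] at this

theorem theta_centralizer {w : 𝔤} (hw : w ∈ d.centralizer) : d.theta w = 0 := by
  have := d.theta_add d.imF.zero_mem hw
  rwa [lie_zero, zero_add] at this

theorem theta_mem (x : 𝔤) : d.theta x ∈ d.imF := Submodule.coe_mem _

theorem sub_lie_theta_mem (x : 𝔤) : x - ⁅d.e, d.theta x⁆ ∈ d.centralizer := by
  have h : x = ⁅d.e, d.theta x⁆ + (d.splitEquiv.symm x).2 :=
    (d.splitEquiv.apply_symm_apply x).symm
  nth_rw 1 [h]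
  rw [add_sub_cancel_left]
  exact Submodule.coe_mem _

theorem mem_centralizer_of_theta {x : 𝔤} (h : d.theta x = 0) : x ∈ d.centralizer := by
  have := d.sub_lie_theta_mem x
  rwa [h, lie_zero, sub_zero] at this

theorem comp_mem_imF (j : ℤ) {v : 𝔤} (hv : v ∈ d.imF) : d.comp j v ∈ d.imF := by
  obtain ⟨y, rfl⟩ := hv
  have := d.comp_lie d.f_mem (j + 2) y
  rw [show -2 + (j + 2) = j by ring] at this
  exact ⟨_, this.symm⟩

theorem comp_mem_centralizer (j : ℤ) {w : 𝔤} (hw : w ∈ d.centralizer) :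
    d.comp j w ∈ d.centralizer := by
  rw [mem_centralizer, ← d.comp_lie d.f_mem, d.mem_centralizer.mp hw, map_zero]

/-- Both [f,𝔤] and 𝔤_f are graded, so the decomposition of a homogeneous element can be projected to
the right degrees; uniqueness does the rest. -/
theorem theta_gr {i : ℤ} {x : 𝔤} (hx : x ∈ d.gr i) : d.theta x ∈ d.gr (i - 2) := by
  have h1 : x = ⁅d.e, d.comp (i - 2) (d.theta x)⁆ + d.comp i (x - ⁅d.e, d.theta x⁆) := by
    rw [← d.comp_lie d.e_mem, show 2 + (i - 2) = i by ring, ← map_add, add_sub_cancel,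
      d.comp_of_mem hx]
  rw [h1, d.theta_add (d.comp_mem_imF _ (d.theta_mem x))
    (d.comp_mem_centralizer _ (d.sub_lie_theta_mem x))]
  exact d.comp_mem _ _

theorem theta_fil {k : ℤ} {x : 𝔤} (hx : x ∈ d.fil k) : d.theta x ∈ d.fil (k - 2) :=
  d.fil_le (W := (d.fil (k - 2)).comap d.theta)
    (fun _ hi _ hy => d.gr_le_fil (by omega) (d.theta_gr hy)) hx

/-- This is the injectivity half of the good grading; it makes ad x for x ∈ 𝔤_f preserve the
filtration. -/
theorem centralizer_le_fil : d.centralizer ≤ d.fil 0 := fun x hx =>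
  d.mem_fil.mpr fun j hj => d.ad_f_injective j (by omega) _ (d.comp_mem j x)
    (d.comp_mem_centralizer j hx)

/-- This is the surjectivity half of the good grading. -/
theorem fil_le_imF : d.fil (-1) ≤ d.imF := d.fil_le fun i hi y hy => by
  obtain ⟨x, _, hx⟩ := d.ad_f_surjective (i + 2) (by omega) y (by rwa [add_sub_cancel_right])
  exact ⟨x, hx⟩

/-- Negative degrees lie in [f,𝔤], where `theta` inverts ad e, while `theta` kills 𝔤_f. Both the
identification of 𝔪 and the uniqueness of gauge fixing rest on this. -/
theorem eq_zero_of_lie_e_mem {x : 𝔤} (hx : x ∈ d.fil (-1)) (h : ⁅d.e, x⁆ ∈ d.centralizer) :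
    x = 0 := by
  rw [← d.theta_lie_e (d.fil_le_imF hx), d.theta_centralizer h]

/-! ### The subspaces `m`, `n`, `b` -/

theorem gr_le_nil {i : ℤ} (hi : i ≤ -2) : d.gr i ≤ d.nil :=
  le_sup_of_le_right (le_iSup₂_of_le i hi le_rfl)

theorem gr_le_gaugeAlg {i : ℤ} (hi : i ≤ -2) : d.gr i ≤ d.gaugeAlg :=
  le_sup_of_le_right (le_iSup₂_of_le i hi le_rfl)

theorem nil_le_fil : d.nil ≤ d.fil (-1) :=
  sup_le (fun _ hx => d.gr_le_fil le_rfl hx.1) (iSup₂_le fun _ hi => d.gr_le_fil (by omega))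

theorem gaugeAlg_le_nil : d.gaugeAlg ≤ d.nil :=
  sup_le_sup_right (fun x hx => ⟨d.l_le hx, d.isotropic x hx⟩) _

/-- Keeps q + c a inside L(𝔤_f), so that the solution theory is uniform in the spectral parameter.
-/
theorem a_mem_centralizer : d.a ∈ d.centralizer := by
  rw [mem_centralizer, ← lie_skew, d.a_centralizes_low (-2) le_rfl _ d.f_mem, neg_zero]

theorem lie_a_nil {x : 𝔤} (hx : x ∈ d.nil) : ⁅d.a, x⁆ = 0 := by
  have h : d.nil ≤ LinearMap.ker (LieAlgebra.ad ℂ 𝔤 d.a) :=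
    sup_le (fun x hx => d.a_centralizes_coisotropic x hx.1 hx.2)
      (iSup₂_le fun i hi x hx => d.a_centralizes_low i hi x hx)
  exact h hx

/-- Together with `b_le_fil` this places 𝔟 between degrees ≤ 0 and degrees ≤ 1; only the degree 1
part of 𝔟 depends on 𝔩. -/
theorem fil_le_b : d.fil 0 ≤ d.b := fun _ hx _ hy =>
  d.killingForm_fil (by norm_num) hx (d.nil_le_fil hy)

/-- By invariance, since a centralizes 𝔫. Hence the condition ∇v ∈ L(𝔟) on gradients does not depend
on the spectral parameter. -/
theorem lie_a_mem_b (x : 𝔤) : ⁅d.a, x⁆ ∈ d.b := fun y hy => by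
  rw [← neg_eq_zero, ← killingForm_lie_middle, d.lie_a_nil hy, map_zero]

theorem killingForm_imF_centralizer {v w : 𝔤} (hv : v ∈ d.imF) (hw : w ∈ d.centralizer) :
    killingForm ℂ 𝔤 v w = 0 := by
  obtain ⟨y, rfl⟩ := hv
  rw [LieAlgebra.ad_apply, ← neg_eq_zero, ← killingForm_lie_middle, d.mem_centralizer.mp hw,
    map_zero]

variable [LieAlgebra.IsKilling ℂ 𝔤]

theorem comp_eq_zero_of_killingForm {x : 𝔤} {j : ℤ}
    (h : ∀ y ∈ d.gr (-j), killingForm ℂ 𝔤 x y = 0) : d.comp j x = 0 := by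
  refine eq_zero_of_killingForm fun y => ?_
  have key : ∀ i, ∀ y ∈ d.gr i, killingForm ℂ 𝔤 (d.comp j x) y = 0 := by
    intro i y hy
    by_cases hij : j + i = 0
    · obtain rfl : i = -j := by omega
      rw [← h y hy]
      by_cases hb : (d.bound : ℤ) < |j|
      · have : ∀ z, z ∈ d.gr j → z = 0 := fun z hz => by
          rwa [d.gr_eq_bot hb, Submodule.mem_bot] at hz
        rw [d.gr_eq_bot (by rwa [abs_neg]), Submodule.mem_bot] at hy
        simp [hy]
      · conv_rhs => rw [← d.sum_comp x, map_sum, LinearMap.sum_apply]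
        rw [Finset.sum_eq_single j]
        · intro k _ hk
          exact d.killingForm_gr (by omega) (d.comp_mem k x) hy
        · intro hn
          exact absurd (Finset.mem_Icc.mpr (abs_le.mp (not_lt.mp hb))) hn
    · exact d.killingForm_gr hij (d.comp_mem j x) hy
  exact d.gr_induction (p := fun y => killingForm ℂ 𝔤 (d.comp j x) y = 0) key (map_zero _)
    (fun y z hy hz => by rw [map_add, hy, hz, add_zero]) y

theorem b_le_fil : d.b ≤ d.fil 1 := fun _ hx => d.mem_fil.mpr fun j hj =>
  d.comp_eq_zero_of_killingForm fun y hy => hx y (d.gr_le_nil (by omega) hy)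

/-- A functional separating x from [f,𝔤] is ⟨y|·⟩ with y ⊥ [f,𝔤], and invariance puts this y in 𝔤_f.
-/
theorem mem_imF_of_killingForm {x : 𝔤} (h : ∀ w ∈ d.centralizer, killingForm ℂ 𝔤 x w = 0) :
    x ∈ d.imF := by
  by_contra hx
  obtain ⟨y, h1, h2⟩ := exists_killingForm_ne_zero hx
  refine h2 ?_
  rw [killingForm_symm]
  refine h y (d.mem_centralizer.mpr (eq_zero_of_killingForm fun z => ?_))
  rw [← neg_eq_zero, ← killingForm_lie_middle]
  exact h1 _ ⟨z, rfl⟩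

/-- Only degree -1 matters, where the claim is that 𝔩 is the orthogonal of 𝔩' for (·,·): this
double-orthogonality holds because ad e is injective on 𝔤_{-1}. -/
theorem mem_gaugeAlg {x : 𝔤} (hx : x ∈ d.fil (-1))
    (h : ∀ y ∈ d.nil, killingForm ℂ 𝔤 ⁅d.e, x⁆ y = 0) : x ∈ d.gaugeAlg := by
  have hu : d.comp (-1) x ∈ d.l := by
    by_contra hn
    -- `W` is [e,𝔩] plus everything without a degree 1 component, so a vector orthogonal to `W` has
    -- degree -1 and lies in 𝔩'. One that detects [e,x] contradicts `h`.
    let W : Submodule ℂ 𝔤 := d.l.map (LieAlgebra.ad ℂ 𝔤 d.e) ⊔ LinearMap.ker (d.comp 1)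
    have hW : ⁅d.e, x⁆ ∉ W := by
      intro hmem
      obtain ⟨_, ⟨y, hy, rfl⟩, z, hz, hyz⟩ := Submodule.mem_sup.mp hmem
      have h1 := congrArg (d.comp 1) hyz
      rw [map_add, LinearMap.mem_ker.mp hz, add_zero, LieAlgebra.ad_apply,
        show (1 : ℤ) = 2 + -1 by norm_num, d.comp_lie d.e_mem, d.comp_lie d.e_mem,
        d.comp_of_mem (d.l_le hy)] at h1
      have h2 : d.comp (-1) x - y = 0 := by
        refine d.eq_zero_of_lie_e_mem (sub_mem (d.gr_le_fil le_rfl (d.comp_mem _ _))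
          (d.gr_le_fil le_rfl (d.l_le hy))) ?_
        rw [lie_sub, h1, sub_self]
        exact zero_mem _
      rw [sub_eq_zero] at h2
      exact hn (h2 ▸ hy)
    obtain ⟨y, hy1, hy2⟩ := exists_killingForm_ne_zero hW
    have hyj : ∀ j ≠ -1, d.comp j y = 0 := by
      intro j hj
      refine d.comp_eq_zero_of_killingForm fun z hz => hy1 z (Submodule.mem_sup_right ?_)
      exact d.comp_of_ne (by omega) hz
    have hyg : y ∈ d.gr (-1) := by
      have hs := d.sum_comp y
      by_cases hb : (-1 : ℤ) ∈ Finset.Icc (-(d.bound : ℤ)) d.bound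
      · rw [Finset.sum_eq_single_of_mem _ hb fun j _ hj => hyj j hj] at hs
        rw [← hs]
        exact d.comp_mem _ _
      · rw [Finset.sum_eq_zero fun j hj => hyj j fun h => hb (h ▸ hj)] at hs
        rw [← hs]
        exact zero_mem _
    refine hy2 ?_
    rw [killingForm_symm]
    refine h y (Submodule.mem_sup_left ⟨hyg, fun z hz => ?_⟩)
    have h1 : killingForm ℂ 𝔤 y ⁅d.e, z⁆ = 0 := hy1 _ (Submodule.mem_sup_left ⟨z, hz, rfl⟩)
    rw [← lie_skew, map_neg, ← killingForm_lie_left, killingForm_symm, h1, neg_zero]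
  rw [← d.sum_comp x]
  refine Submodule.sum_mem _ fun j _ => ?_
  rcases lt_trichotomy j (-1) with hj | rfl | hj
  · exact d.gr_le_gaugeAlg (by omega) (d.comp_mem j x)
  · exact Submodule.mem_sup_left hu
  · rw [d.mem_fil.mp hx j hj]
    exact zero_mem _

end
end ReductionData

/-! ### Solving `[ε ∂_x + e + x, v] ≡ w` modulo `L(𝔤_f)` -/

namespace ReductionData
variable {𝔤 : Type*} [LieRing 𝔤] [LieAlgebra ℂ 𝔤] (d : ReductionData 𝔤)
variable [FiniteDimensional ℂ 𝔤]

/-- The extension of `theta` to loops. -/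
def thetaL : Loop 𝔤 →ₗ[ℂ] Loop 𝔤 := (d.theta.baseChange CircleFun).restrictScalars ℂ

theorem ev_thetaL (x : ℝ) (u : Loop 𝔤) : ev x (d.thetaL u) = d.theta (ev x u) :=
  ev_baseChange x d.theta u

theorem thetaL_mem (u : Loop 𝔤) : d.thetaL u ∈ loops d.imF :=
  mem_loops_iff.mpr fun x => by rw [d.ev_thetaL]; exact d.theta_mem _

theorem thetaL_fil {k : ℤ} {u : Loop 𝔤} (hu : u ∈ loops (d.fil k)) :
    d.thetaL u ∈ loops (d.fil (k - 2)) :=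
  mem_loops_iff.mpr fun x => by rw [d.ev_thetaL]; exact d.theta_fil (mem_loops_iff.mp hu x)

theorem thetaL_centralizer {u : Loop 𝔤} (hu : u ∈ loops d.centralizer) : d.thetaL u = 0 :=
  loop_ext fun x => by
    rw [d.ev_thetaL, d.theta_centralizer (mem_loops_iff.mp hu x), map_zero]

theorem thetaL_lie_e {u : Loop 𝔤} (hu : u ∈ loops d.imF) : d.thetaL ⁅const d.e, u⁆ = u :=
  loop_ext fun x => by
    rw [d.ev_thetaL, ev_lie, ev_const, d.theta_lie_e (mem_loops_iff.mp hu x)]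

theorem mem_loops_centralizer_of_thetaL {u : Loop 𝔤} (hu : d.thetaL u = 0) :
    u ∈ loops d.centralizer :=
  mem_loops_iff.mpr fun x => d.mem_centralizer_of_theta (by rw [← d.ev_thetaL, hu, map_zero])

theorem lie_mem_loops_fil {i j : ℤ} {u v : Loop 𝔤} (hu : u ∈ loops (d.fil i))
    (hv : v ∈ loops (d.fil j)) : ⁅u, v⁆ ∈ loops (d.fil (i + j)) :=
  mem_loops_iff.mpr fun x => by
    rw [ev_lie]
    exact d.lie_mem_fil (mem_loops_iff.mp hu x) (mem_loops_iff.mp hv x)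

theorem loopForm_imF_centralizer {u v : Loop 𝔤} (hu : u ∈ loops d.imF)
    (hv : v ∈ loops d.centralizer) : loopForm u v = 0 :=
  loopForm_eq_zero fun x =>
    d.killingForm_imF_centralizer (mem_loops_iff.mp hu x) (mem_loops_iff.mp hv x)

variable (ε : ℂ) {x : Loop 𝔤}

theorem conn_mem_fil (hx : x ∈ loops d.centralizer) {k : ℤ} {u : Loop 𝔤}
    (hu : u ∈ loops (d.fil k)) : conn ε x u ∈ loops (d.fil k) := by
  rw [conn_apply]
  refine add_mem (smul_mem_loops ε (loopDeriv_mem_loops hu)) ?_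
  have := d.lie_mem_loops_fil (loops_mono d.centralizer_le_fil hx) hu
  rwa [zero_add] at this

/-- The nilpotent operator `θ ∘ [ε ∂_x + x, ·]`. -/
def step (x : Loop 𝔤) : Module.End ℂ (Loop 𝔤) := d.thetaL ∘ₗ conn ε x

theorem step_mem_fil (hx : x ∈ loops d.centralizer) {k : ℤ} {u : Loop 𝔤}
    (hu : u ∈ loops (d.fil k)) : d.step ε x u ∈ loops (d.fil (k - 2)) :=
  d.thetaL_fil (d.conn_mem_fil ε hx hu)

theorem mem_loops_top (u : Loop 𝔤) {k : ℤ} (hk : (d.bound : ℤ) ≤ k) : u ∈ loops (d.fil k) :=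
  mem_loops_iff.mpr fun _ => by rw [d.fil_eq_top hk]; trivial

theorem eq_zero_of_mem_fil {u : Loop 𝔤} {k : ℤ} (hk : k < -(d.bound : ℤ))
    (hu : u ∈ loops (d.fil k)) : u = 0 :=
  loop_ext fun x => by
    have := mem_loops_iff.mp hu x
    rw [d.fil_eq_bot hk, Submodule.mem_bot] at this
    rw [this, map_zero]

/-- Each factor lowers the filtration by 2 and the degrees range over [-bound, bound]. The exponent
depends neither on x nor on ε, which is why `solve` is a differential operator uniformly in ε. -/
theorem step_pow (hx : x ∈ loops d.centralizer) : (-d.step ε x) ^ (d.bound + 1) = 0 := by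
  have h : ∀ n : ℕ, ∀ u, ((-d.step ε x) ^ n) u ∈ loops (d.fil (d.bound - 2 * n)) := by
    intro n
    induction n with
    | zero => exact fun u => d.mem_loops_top u (by simp)
    | succ n ih =>
      intro u
      rw [pow_succ', Module.End.mul_apply, LinearMap.neg_apply]
      have := d.step_mem_fil ε hx (ih u)
      rw [show (d.bound : ℤ) - 2 * n - 2 = d.bound - 2 * (n + 1 : ℕ) by push_cast; ring] at this
      exact neg_mem this
  exact LinearMap.ext fun u => d.eq_zero_of_mem_fil (by push_cast; omega) (h (d.bound + 1) u)

/-- The solution operator `w ↦ v` of `[ε ∂_x + e + x, v] ≡ w` modulo `L(𝔤_f)`, `v ∈ L([f, 𝔤])`. -/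
def solve (x : Loop 𝔤) : Loop 𝔤 →ₗ[ℂ] Loop 𝔤 :=
  (∑ k ∈ Finset.range (d.bound + 1), (-d.step ε x) ^ k) ∘ₗ d.thetaL

theorem solve_add_step (hx : x ∈ loops d.centralizer) (w : Loop 𝔤) :
    d.solve ε x w + d.step ε x (d.solve ε x w) = d.thetaL w := by
  have h := mul_neg_geom_sum (-d.step ε x) (d.bound + 1)
  rw [d.step_pow ε hx, sub_zero, sub_neg_eq_add, add_mul, one_mul] at h
  exact congrArg (fun T => T (d.thetaL w)) h

theorem solve_mem (hx : x ∈ loops d.centralizer) (w : Loop 𝔤) :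
    d.solve ε x w ∈ loops d.imF := by
  rw [eq_sub_of_add_eq (d.solve_add_step ε hx w)]
  exact sub_mem (d.thetaL_mem _) (d.thetaL_mem _)

theorem conn_e_add (x v : Loop 𝔤) :
    conn ε (const d.e + x) v = ⁅const d.e, v⁆ + conn ε x v := by
  rw [add_comm (const d.e), conn_add_apply, add_comm]

/-- `thetaL` has kernel L(𝔤_f), and it turns the equation into (1 + `step`) v = `thetaL` w, which
the geometric series solves. -/
theorem conn_solve_sub_mem (hx : x ∈ loops d.centralizer) (w : Loop 𝔤) :
    conn ε (const d.e + x) (d.solve ε x w) - w ∈ loops d.centralizer := by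
  refine d.mem_loops_centralizer_of_thetaL ?_
  rw [map_sub, d.conn_e_add, map_add, d.thetaL_lie_e (d.solve_mem ε hx w), sub_eq_zero]
  exact d.solve_add_step ε hx w

theorem solve_conn (hx : x ∈ loops d.centralizer) {v : Loop 𝔤} (hv : v ∈ loops d.imF) :
    d.solve ε x (conn ε (const d.e + x) v) = v := by
  have h := geom_sum_mul_neg (-d.step ε x) (d.bound + 1)
  rw [d.step_pow ε hx, sub_zero, sub_neg_eq_add, mul_add, mul_one] at h
  have h2 := congrArg (fun T => T v) h
  rw [d.conn_e_add, solve, LinearMap.comp_apply, map_add, d.thetaL_lie_e hv, map_add]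
  exact h2

theorem solve_centralizer {w : Loop 𝔤} (hw : w ∈ loops d.centralizer) : d.solve ε x w = 0 := by
  rw [solve, LinearMap.comp_apply, d.thetaL_centralizer hw, map_zero]

/-- The correction of `φ` by an element of `L([f, 𝔤])` for which `[ε ∂_x + e + x, ·]` has values
in `L(𝔤_f)`. -/
def lift (x : Loop 𝔤) : Loop 𝔤 →ₗ[ℂ] Loop 𝔤 :=
  LinearMap.id - d.solve ε x ∘ₗ conn ε (const d.e + x)

theorem lift_apply (φ : Loop 𝔤) :
    d.lift ε x φ = φ - d.solve ε x (conn ε (const d.e + x) φ) := rfl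

theorem conn_lift_mem (hx : x ∈ loops d.centralizer) (φ : Loop 𝔤) :
    conn ε (const d.e + x) (d.lift ε x φ) ∈ loops d.centralizer := by
  rw [lift_apply, map_sub, ← neg_mem_iff, neg_sub]
  exact d.conn_solve_sub_mem ε hx _

theorem sub_lift_mem (hx : x ∈ loops d.centralizer) (φ : Loop 𝔤) :
    φ - d.lift ε x φ ∈ loops d.imF := by
  rw [lift_apply, sub_sub_cancel]
  exact d.solve_mem ε hx _

/-- Since [f,𝔤] ⊥ 𝔤_f, the correction in the first slot is invisible. -/
theorem loopForm_lift (hx : x ∈ loops d.centralizer) (φ ψ : Loop 𝔤) :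
    loopForm (d.lift ε x φ) (conn ε (const d.e + x) (d.lift ε x ψ)) =
      loopForm φ (conn ε (const d.e + x) (d.lift ε x ψ)) := by
  have h := d.loopForm_imF_centralizer (d.sub_lift_mem ε hx φ) (d.conn_lift_mem ε hx ψ)
  rw [loopForm_eq, map_sub, LinearMap.sub_apply, sub_eq_zero] at h
  exact h.symm

variable [LieAlgebra.IsKilling ℂ 𝔤]

/-- The rigidity behind both reductions: admissible gradients with the same restriction to Q differ
only by gauge directions. -/
theorem mem_loops_gaugeAlg (hx : x ∈ loops d.centralizer) {v : Loop 𝔤} (hv : v ∈ loops d.imF)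
    (h : conn ε (const d.e + x) v ∈ loops d.b) : v ∈ loops d.gaugeAlg := by
  have h0 : v = d.thetaL (conn ε (const d.e + x) v) - d.step ε x v := by
    rw [d.conn_e_add, map_add, d.thetaL_lie_e hv]
    exact (add_sub_cancel_right _ _).symm
  have h1 := d.thetaL_fil (loops_mono d.b_le_fil h)
  -- Bootstrap from `h0`: the first term has degree ≤ -1 and the second is lower than v by 2, so any
  -- bound on the degree of v descends to -1.
  have h2 : ∀ k : ℕ, v ∈ loops (d.fil (k - 1)) → v ∈ loops (d.fil (-1)) := by
    intro k
    induction k with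
    | zero => exact fun h => by simpa using h
    | succ k ih =>
      intro hk
      refine ih ?_
      rw [h0]
      refine sub_mem (loops_mono (d.fil_mono (by omega)) h1) ?_
      exact loops_mono (d.fil_mono (by push_cast; omega)) (d.step_mem_fil ε hx hk)
  have h3 : v ∈ loops (d.fil (-1)) := h2 (d.bound + 1) (d.mem_loops_top v (by push_cast; omega))
  -- The remaining part [ε∂_x + x, v] has degree ≤ -1 and thus lies in L(𝔟) by itself.
  have h4 : ⁅const d.e, v⁆ ∈ loops d.b := by
    rw [d.conn_e_add] at h
    refine (Submodule.add_mem_iff_left _ ?_).mp h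
    exact loops_mono ((d.fil_mono (by norm_num)).trans d.fil_le_b) (d.conn_mem_fil ε hx h3)
  refine mem_loops_iff.mpr fun t => d.mem_gaugeAlg (mem_loops_iff.mp h3 t) ?_
  have := mem_loops_iff.mp h4 t
  rw [ev_lie, ev_const] at this
  exact this

theorem loopForm_nil_b {u v : Loop 𝔤} (hu : u ∈ loops d.nil) (hv : v ∈ loops d.b) :
    loopForm u v = 0 :=
  loopForm_eq_zero fun x => by
    rw [killingForm_symm]
    exact mem_loops_iff.mp hv x _ (mem_loops_iff.mp hu x)

/-- The bilinear form of the pencil does not depend on the choice of admissible lifts. -/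
theorem loopForm_eq_lift {q : Loop 𝔤} (hq : q ∈ loops d.centralizer) (c : ℂ) {v w φ ψ : Loop 𝔤}
    (hv : conn ε (const d.e + q) v ∈ loops d.b) (hw : conn ε (const d.e + q) w ∈ loops d.b)
    (hφ : v - φ ∈ loops d.imF) (hψ : w - ψ ∈ loops d.imF) :
    loopForm v (conn ε (const d.e + q + c • const d.a) w) =
      loopForm φ (conn ε (const d.e + (q + c • const d.a)) (d.lift ε (q + c • const d.a) ψ)) := by
  have hx : q + c • const d.a ∈ loops d.centralizer :=
    add_mem hq (smul_mem_loops c (const_mem_loops d.a_mem_centralizer))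
  have hb : ∀ v, conn ε (const d.e + q) v ∈ loops d.b →
      conn ε (const d.e + (q + c • const d.a)) v ∈ loops d.b := by
    intro v hv
    rw [← add_assoc, conn_add_apply]
    refine add_mem hv ?_
    rw [smul_lie]
    refine smul_mem_loops c (mem_loops_iff.mpr fun t => ?_)
    rw [ev_lie, ev_const]
    exact d.lie_a_mem_b _
  rw [add_assoc]
  have hcb : d.centralizer ≤ d.b := d.centralizer_le_fil.trans d.fil_le_b
  set x := q + c • const d.a
  have e1 : v - d.lift ε x φ ∈ loops d.imF := by
    rw [← sub_add_sub_cancel v φ]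
    exact add_mem hφ (d.sub_lift_mem ε hx φ)
  have e2 : w - d.lift ε x ψ ∈ loops d.imF := by
    rw [← sub_add_sub_cancel w ψ]
    exact add_mem hψ (d.sub_lift_mem ε hx ψ)
  -- The given vector and the Dirac lift differ by L(𝔪) ⊂ L(𝔫), which is orthogonal to L(𝔟). This
  -- replaces the left argument.
  have e3 : v - d.lift ε x φ ∈ loops d.gaugeAlg := by
    refine d.mem_loops_gaugeAlg ε hx e1 ?_
    rw [map_sub]
    exact sub_mem (hb v hv) (loops_mono hcb (d.conn_lift_mem ε hx φ))
  have e4 := d.loopForm_nil_b (loops_mono d.gaugeAlg_le_nil e3) (hb w hw)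
  -- The right argument is replaced after moving the connection to the left one, where it takes
  -- values in L(𝔤_f) ⊥ L([f,𝔤]).
  have e5 : loopForm (d.lift ε x φ) (conn ε (const d.e + x) (w - d.lift ε x ψ)) = 0 := by
    rw [← neg_eq_zero, ← loopForm_conn, loopForm_comm]
    exact d.loopForm_imF_centralizer e2 (d.conn_lift_mem ε hx φ)
  rw [← d.loopForm_lift ε hx]
  rw [loopForm_eq, map_sub, LinearMap.sub_apply, sub_eq_zero] at e4
  rw [loopForm_eq, map_sub, map_sub, sub_eq_zero] at e5
  rw [loopForm_eq, loopForm_eq, e4, e5]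

end ReductionData

/-! ### Loop-valued differential operators -/

section LoopOperators
variable {𝔤 : Type*} [LieRing 𝔤] [LieAlgebra ℂ 𝔤] [FiniteDimensional ℂ 𝔤] {σ : Type*}

/-- The components of the loop-valued operator are differential operators. -/
def IsLoopDO (T : ℂ → (σ → CircleFun) → CircleFun → Loop 𝔤) : Prop :=
  ∀ ℓ : Module.Dual ℂ 𝔤, IsDO fun ε q φ => app ℓ (T ε q φ)

variable {T T' : ℂ → (σ → CircleFun) → CircleFun → Loop 𝔤}

theorem isLoopDO_tmul (y : 𝔤) : IsLoopDO fun _ (_ : σ → CircleFun) φ => φ ⊗ₜ[ℂ] y := fun ℓ =>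
  isDO_smul_id (ℓ y)

theorem IsLoopDO.add (h : IsLoopDO T) (h' : IsLoopDO T') :
    IsLoopDO fun ε q φ => T ε q φ + T' ε q φ := fun ℓ => by
  simpa only [map_add] using (h ℓ).add (h' ℓ)

theorem IsLoopDO.smul (c : ℂ) (h : IsLoopDO T) : IsLoopDO fun ε q φ => c • T ε q φ := fun ℓ => by
  simpa only [app_smul_complex] using (h ℓ).smul c

theorem IsLoopDO.neg (h : IsLoopDO T) : IsLoopDO fun ε q φ => -T ε q φ := by
  simpa only [neg_one_smul] using h.smul (-1)

theorem IsLoopDO.sub (h : IsLoopDO T) (h' : IsLoopDO T') :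
    IsLoopDO fun ε q φ => T ε q φ - T' ε q φ := by
  simpa only [sub_eq_add_neg] using h.add h'.neg

theorem isLoopDO_sum {τ : Type*} (s : Finset τ)
    {T : τ → ℂ → (σ → CircleFun) → CircleFun → Loop 𝔤} (hT : ∀ t ∈ s, IsLoopDO (T t)) :
    IsLoopDO fun ε q φ => ∑ t ∈ s, T t ε q φ := fun ℓ => by
  simpa only [map_sum] using isDO_sum s fun t ht => hT t ht ℓ

theorem IsLoopDO.baseChange (M : 𝔤 →ₗ[ℂ] 𝔤) (h : IsLoopDO T) :
    IsLoopDO fun ε q φ => M.baseChange CircleFun (T ε q φ) := fun ℓ => by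
  simpa only [app_baseChange] using h (ℓ ∘ₗ M)

theorem IsLoopDO.loopDeriv (h : IsLoopDO T) :
    IsLoopDO fun ε q φ => ε • loopDeriv (T ε q φ) := fun ℓ => by
  simpa only [app_smul_complex, app_loopDeriv] using (h ℓ).dx

theorem const_lie (y : 𝔤) (u : Loop 𝔤) :
    ⁅const y, u⁆ = (LieAlgebra.ad ℂ 𝔤 y).baseChange CircleFun u :=
  loop_ext fun x => by rw [ev_lie, ev_const, ev_baseChange, LieAlgebra.ad_apply]

theorem tmul_lie (φ : CircleFun) (y : 𝔤) (u : Loop 𝔤) :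
    ⁅(φ ⊗ₜ[ℂ] y : Loop 𝔤), u⁆ = φ • ⁅const y, u⁆ :=
  loop_ext fun x => by rw [ev_lie, ev_smul, ev_lie, ev_const, ev_tmul, smul_lie]

theorem IsLoopDO.const_lie (y : 𝔤) (h : IsLoopDO T) :
    IsLoopDO fun ε q φ => ⁅const y, T ε q φ⁆ := by
  simpa only [WAlg.const_lie] using h.baseChange (LieAlgebra.ad ℂ 𝔤 y)

theorem IsLoopDO.coord_lie (i : σ) (y : 𝔤) (h : IsLoopDO T) :
    IsLoopDO fun ε q φ => ⁅(q i ⊗ₜ[ℂ] y : Loop 𝔤), T ε q φ⁆ := fun ℓ => by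
  simpa only [tmul_lie, map_smul, smul_eq_mul] using (h.const_lie y ℓ).coord_mul i

end LoopOperators

/-! ### Coordinates adapted to 𝔤_f and the Dirac formula -/

section Coordinates
variable {𝔤 : Type*} [LieRing 𝔤] [LieAlgebra ℂ 𝔤] [FiniteDimensional ℂ 𝔤]
  [LieAlgebra.IsSimple ℂ 𝔤]
variable {ι κ : Type*} [Fintype ι] [Fintype κ] [DecidableEq ι] [DecidableEq κ]
variable (d : ReductionData 𝔤) (ξ : Module.Basis (ι ⊕ κ) ℂ 𝔤)

/-! ### Dual bases -/

theorem killingForm_dual_left (I J : ι ⊕ κ) :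
    killingForm ℂ 𝔤 (dual ξ I) (ξ J) = if J = I then 1 else 0 :=
  LinearMap.BilinForm.apply_dualBasis_left _ _ _ _

theorem coord_eq_killingForm (I : ι ⊕ κ) : ξ.coord I = killingForm ℂ 𝔤 (dual ξ I) := by
  refine ξ.ext fun J => ?_
  rw [killingForm_dual_left, Module.Basis.coord_apply, Module.Basis.repr_self,
    Finsupp.single_apply]

theorem dual_coord_eq_killingForm (I : ι ⊕ κ) :
    (dual ξ).coord I = killingForm ℂ 𝔤 (ξ I) := by
  refine (dual ξ).ext fun J => ?_
  rw [killingForm_symm, killingForm_dual_left, Module.Basis.coord_apply, Module.Basis.repr_self,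
    Finsupp.single_apply]
  simp only [eq_comm]

/-- The `ξ_I`-coordinate of a loop. -/
def cf (I : ι ⊕ κ) : Loop 𝔤 →ₗ[CircleFun] CircleFun := app (killingForm ℂ 𝔤 (dual ξ I))

/-- The `ξ^I`-coordinate of a loop. -/
def dcf (I : ι ⊕ κ) : Loop 𝔤 →ₗ[CircleFun] CircleFun := app (killingForm ℂ 𝔤 (ξ I))

theorem eq_sum_cf (u : Loop 𝔤) : u = ∑ I, cf ξ I u ⊗ₜ[ℂ] ξ I := by
  have := loop_eq_sum ξ u
  simp only [coord_eq_killingForm] at this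
  exact this

theorem eq_sum_dcf (u : Loop 𝔤) : u = ∑ I, dcf ξ I u ⊗ₜ[ℂ] dual ξ I := by
  have := loop_eq_sum (dual ξ) u
  simp only [dual_coord_eq_killingForm] at this
  exact this

theorem cf_tmul (I J : ι ⊕ κ) (φ : CircleFun) :
    cf ξ I (φ ⊗ₜ[ℂ] ξ J) = if J = I then φ else 0 := by
  rw [cf, app_tmul, killingForm_dual_left]
  split_ifs <;> simp

theorem dcf_tmul (I J : ι ⊕ κ) (φ : CircleFun) :
    dcf ξ I (φ ⊗ₜ[ℂ] dual ξ J) = if I = J then φ else 0 := by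
  rw [dcf, app_tmul, killingForm_symm, killingForm_dual_left]
  split_ifs <;> simp

variable {d ξ}
variable (hξ : Submodule.span ℂ (Set.range fun i : ι => ξ (Sum.inl i)) = d.centralizer)
include hξ

theorem xi_mem_centralizer (i : ι) : ξ (Sum.inl i) ∈ d.centralizer := by
  rw [← hξ]
  exact Submodule.subset_span ⟨i, rfl⟩

theorem killingForm_dual_centralizer (α : κ) {w : 𝔤} (hw : w ∈ d.centralizer) :
    killingForm ℂ 𝔤 (dual ξ (Sum.inr α)) w = 0 := by
  have : d.centralizer ≤ LinearMap.ker (killingForm ℂ 𝔤 (dual ξ (Sum.inr α))) := by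
    rw [← hξ, Submodule.span_le]
    rintro _ ⟨i, rfl⟩
    exact (killingForm_dual_left ξ _ _).trans (if_neg (by simp))
  exact this hw

theorem cf_centralizer (α : κ) {w : Loop 𝔤} (hw : w ∈ loops d.centralizer) :
    cf ξ (Sum.inr α) w = 0 :=
  circleFun_ext fun x => by
    rw [cf, evalAt_app, killingForm_dual_centralizer hξ α (mem_loops_iff.mp hw x), map_zero]

theorem sum_mem_centralizer (φ : ι → CircleFun) :
    ∑ i, φ i ⊗ₜ[ℂ] ξ (Sum.inl i) ∈ loops d.centralizer :=
  sum_mem fun i _ => tmul_mem_loops _ (xi_mem_centralizer hξ i)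

theorem eq_sum_of_mem_centralizer {w : Loop 𝔤} (hw : w ∈ loops d.centralizer) :
    w = ∑ i, cf ξ (Sum.inl i) w ⊗ₜ[ℂ] ξ (Sum.inl i) := by
  conv_lhs => rw [eq_sum_cf ξ w]
  rw [Fintype.sum_sum_type, add_eq_left]
  exact Finset.sum_eq_zero fun α _ => by rw [cf_centralizer hξ α hw, TensorProduct.zero_tmul]

theorem dcf_imF (i : ι) {v : Loop 𝔤} (hv : v ∈ loops d.imF) : dcf ξ (Sum.inl i) v = 0 :=
  circleFun_ext fun x => by
    rw [dcf, evalAt_app, killingForm_symm, d.killingForm_imF_centralizer (mem_loops_iff.mp hv x)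
      (xi_mem_centralizer hξ i), map_zero]

theorem dual_mem_imF (α : κ) : dual ξ (Sum.inr α) ∈ d.imF :=
  d.mem_imF_of_killingForm fun _ hw => killingForm_dual_centralizer hξ α hw

theorem sum_mem_imF (φ : κ → CircleFun) :
    ∑ α, φ α ⊗ₜ[ℂ] dual ξ (Sum.inr α) ∈ loops d.imF :=
  sum_mem fun α _ => tmul_mem_loops _ (dual_mem_imF hξ α)

theorem mem_imF_of_dcf {v : Loop 𝔤} (h : ∀ i, dcf ξ (Sum.inl i) v = 0) : v ∈ loops d.imF := by
  rw [eq_sum_dcf ξ v, Fintype.sum_sum_type]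
  refine add_mem (sum_mem fun i _ => ?_) (sum_mem_imF hξ _)
  rw [h, TensorProduct.zero_tmul]
  exact zero_mem _

theorem eq_sum_of_mem_imF {v : Loop 𝔤} (hv : v ∈ loops d.imF) :
    v = ∑ α, dcf ξ (Sum.inr α) v ⊗ₜ[ℂ] dual ξ (Sum.inr α) := by
  conv_lhs => rw [eq_sum_dcf ξ v]
  rw [Fintype.sum_sum_type, add_eq_right]
  exact Finset.sum_eq_zero fun i _ => by rw [dcf_imF hξ i hv, TensorProduct.zero_tmul]

/-! ### The operators -/

omit hξ
variable (d ξ)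

/-- The loop `∑ q^i ξ_i + c a`. -/
def shift (c : ℂ) (q : ι → CircleFun) : Loop 𝔤 :=
  ∑ i, q i ⊗ₜ[ℂ] ξ (Sum.inl i) + c • const d.a

theorem slice_add (c : ℂ) (q : ι → CircleFun) :
    slice d ξ q + c • const d.a = const d.e + shift d ξ c q := by
  rw [slice, shift, add_assoc]

variable {d ξ}

include hξ in
theorem shift_mem (c : ℂ) (q : ι → CircleFun) : shift d ξ c q ∈ loops d.centralizer :=
  add_mem (sum_mem_centralizer hξ q) (smul_mem_loops c (const_mem_loops d.a_mem_centralizer))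

variable (d ξ)

section IsLoopDO
variable {T : ℂ → (ι → CircleFun) → CircleFun → Loop 𝔤}

theorem IsLoopDO.conn_shift (c : ℂ) (h : IsLoopDO T) :
    IsLoopDO fun ε q φ => conn ε (shift d ξ c q) (T ε q φ) := by
  have := h.loopDeriv.add
    ((isLoopDO_sum Finset.univ fun i _ => h.coord_lie i (ξ (Sum.inl i))).add
      ((h.const_lie d.a).smul c))
  simpa only [conn_apply, shift, add_lie, smul_lie, sum_lie] using this

theorem IsLoopDO.conn_e_shift (c : ℂ) (h : IsLoopDO T) :
    IsLoopDO fun ε q φ => conn ε (const d.e + shift d ξ c q) (T ε q φ) := by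
  simp only [d.conn_e_add]
  exact (h.const_lie d.e).add (h.conn_shift d ξ c)

theorem IsLoopDO.neg_step_pow (c : ℂ) (h : IsLoopDO T) (k : ℕ) :
    IsLoopDO fun ε q φ => ((-d.step ε (shift d ξ c q)) ^ k) (T ε q φ) := by
  induction k with
  | zero => exact h
  | succ k ih =>
    simp only [pow_succ', Module.End.mul_apply]
    exact ((ih.conn_shift d ξ c).baseChange d.theta).neg

theorem IsLoopDO.solve (c : ℂ) (h : IsLoopDO T) :
    IsLoopDO fun ε q φ => d.solve ε (shift d ξ c q) (T ε q φ) := by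
  simp only [ReductionData.solve, LinearMap.comp_apply, LinearMap.sum_apply]
  exact isLoopDO_sum _ fun k _ => (h.baseChange d.theta).neg_step_pow d ξ c k

theorem IsLoopDO.lift (c : ℂ) (h : IsLoopDO T) :
    IsLoopDO fun ε q φ => d.lift ε (shift d ξ c q) (T ε q φ) := by
  simp only [d.lift_apply]
  exact h.sub ((h.conn_e_shift d ξ c).solve d ξ c)

end IsLoopDO

/-- One operator serves all ε, because `lift` is built from ε∂_x, brackets and a fixed number of
series terms. -/
theorem exists_diracOp (c : ℂ) : ∃ K : MatDiffOp ι ι ι, ∀ ε q i j φ,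
    (K i j).act ε q φ = cf ξ (Sum.inl i) (conn ε (const d.e + shift d ξ c q)
      (d.lift ε (shift d ξ c q) (φ ⊗ₜ[ℂ] dual ξ (Sum.inl j)))) := by
  have h : ∀ i j, _ := fun i j : ι =>
    (((isLoopDO_tmul (σ := ι) (dual ξ (Sum.inl j))).lift d ξ c).conn_e_shift d ξ c
      (killingForm ℂ 𝔤 (dual ξ (Sum.inl i))) : IsDO _)
  choose K hK using h
  exact ⟨K, fun ε q i j φ => (hK i j ε q φ).symm⟩

/-- The operators `K_c`, restricting the pencil to `Q`. -/
def reducedOp (c : ℂ) : MatDiffOp ι ι ι := (exists_diracOp d ξ c).choose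

theorem reducedOp_act (c ε : ℂ) (q : ι → CircleFun) (i j : ι) (φ : CircleFun) :
    (reducedOp d ξ c i j).act ε q φ = cf ξ (Sum.inl i) (conn ε (const d.e + shift d ξ c q)
      (d.lift ε (shift d ξ c q) (φ ⊗ₜ[ℂ] dual ξ (Sum.inl j)))) :=
  (exists_diracOp d ξ c).choose_spec ε q i j φ

theorem exists_minorInverse (c : ℂ) : ∃ S : MatDiffOp ι κ κ, ∀ ε q α β φ,
    (S α β).act ε q φ =
      dcf ξ (Sum.inr α) (d.solve ε (shift d ξ c q) (φ ⊗ₜ[ℂ] ξ (Sum.inr β))) := by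
  have h : ∀ α β, _ := fun α β : κ =>
    ((isLoopDO_tmul (σ := ι) (ξ (Sum.inr β))).solve d ξ c
      (killingForm ℂ 𝔤 (ξ (Sum.inr α))) : IsDO _)
  choose K hK using h
  exact ⟨K, fun ε q i j φ => (hK i j ε q φ).symm⟩

/-- The inverse of the minor of the matrix of the pencil. -/
def minorInverse (c : ℂ) : MatDiffOp ι κ κ := (exists_minorInverse d ξ c).choose

theorem minorInverse_act (c ε : ℂ) (q : ι → CircleFun) (α β : κ) (φ : CircleFun) :
    (minorInverse d ξ c α β).act ε q φ =
      dcf ξ (Sum.inr α) (d.solve ε (shift d ξ c q) (φ ⊗ₜ[ℂ] ξ (Sum.inr β))) :=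
  (exists_minorInverse d ξ c).choose_spec ε q α β φ

theorem pencilOp_eq (c : ℂ) {ε : ℂ} (hε : ε ≠ 0) (q : ι → CircleFun) (I J : ι ⊕ κ)
    (φ : CircleFun) : pencilOp d ξ c ε (slice d ξ q) I J φ =
      cf ξ I (conn ε (const d.e + shift d ξ c q) (φ ⊗ₜ[ℂ] dual ξ J)) := by
  rw [pencilOp, pencil_eq, smul_inv_smul₀ hε, pairing_const_left, slice_add, cf]

theorem sum_minorInverse_act (c ε : ℂ) (q : ι → CircleFun) (α : κ) (φ : κ → CircleFun) :
    ∑ β, (minorInverse d ξ c α β).act ε q (φ β) =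
      dcf ξ (Sum.inr α) (d.solve ε (shift d ξ c q) (∑ β, φ β ⊗ₜ[ℂ] ξ (Sum.inr β))) := by
  simp only [minorInverse_act, map_sum]

theorem sum_pencilOp (c : ℂ) {ε : ℂ} (hε : ε ≠ 0) (q : ι → CircleFun) (I : ι ⊕ κ)
    (φ : κ → CircleFun) : ∑ β, pencilOp d ξ c ε (slice d ξ q) I (Sum.inr β) (φ β) =
      cf ξ I (conn ε (const d.e + shift d ξ c q) (∑ β, φ β ⊗ₜ[ℂ] dual ξ (Sum.inr β))) := by
  simp only [pencilOp_eq d ξ c hε, map_sum]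

variable {d ξ}
include hξ

/-- `solve` ignores components along 𝔤_f, so the Greek components of `w` suffice. -/
theorem solve_sum_cf (c ε : ℂ) (q : ι → CircleFun) (w : Loop 𝔤) :
    d.solve ε (shift d ξ c q) (∑ β, cf ξ (Sum.inr β) w ⊗ₜ[ℂ] ξ (Sum.inr β)) =
      d.solve ε (shift d ξ c q) w := by
  conv_rhs => rw [eq_sum_cf ξ w, Fintype.sum_sum_type, map_add,
    d.solve_centralizer ε (sum_mem_centralizer hξ _), zero_add]

/-- The ξ^α span [f,𝔤] and the Greek ξ-coordinates are coordinates on 𝔤/𝔤_f. The minor is therefore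
∇ as a map L([f,𝔤]) → L(𝔤)/L(𝔤_f), and `solve` is its inverse. -/
theorem isMinorInverse_minorInverse (c : ℂ) {ε : ℂ} (hε : ε ≠ 0) :
    IsMinorInverse d ξ c ε (minorInverse d ξ c) := by
  intro q φ α
  have hx := shift_mem hξ c q
  constructor
  · simp only [sum_minorInverse_act]
    rw [sum_pencilOp d ξ c hε, ← eq_sum_of_mem_imF hξ (d.solve_mem ε hx _)]
    have h := cf_centralizer hξ α
      (d.conn_solve_sub_mem ε hx (∑ β, φ β ⊗ₜ[ℂ] ξ (Sum.inr β)))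
    rw [map_sub, sub_eq_zero] at h
    rw [h, map_sum, Finset.sum_eq_single α]
    · rw [cf_tmul, if_pos rfl]
    · intro β _ hβ
      rw [cf_tmul, if_neg (by simpa using hβ)]
    · simp
  · simp only [sum_pencilOp d ξ c hε]
    rw [sum_minorInverse_act, solve_sum_cf hξ, d.solve_conn ε hx (sum_mem_imF hξ φ), map_sum,
      Finset.sum_eq_single α]
    · rw [dcf_tmul, if_pos rfl]
    · intro β _ hβ
      rw [dcf_tmul, if_neg (by simpa using hβ.symm)]
    · simp

/-- The subtracted term of the Dirac formula is ∇ applied to `solve` (∇φ), so the difference is ∇ of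
the lift. -/
theorem diracOp_minorInverse (c : ℂ) {ε : ℂ} (hε : ε ≠ 0) (q : ι → CircleFun) (i j : ι)
    (φ : CircleFun) :
    diracOp d ξ c ε (minorInverse d ξ c) q i j φ = (reducedOp d ξ c i j).act ε q φ := by
  have hx := shift_mem hξ c q
  have hlin : ∀ α : κ, ∑ β, pencilOp d ξ c ε (slice d ξ q) (Sum.inl i) (Sum.inr α)
      ((minorInverse d ξ c α β).act ε q
        (pencilOp d ξ c ε (slice d ξ q) (Sum.inr β) (Sum.inl j) φ)) =
      pencilOp d ξ c ε (slice d ξ q) (Sum.inl i) (Sum.inr α) (∑ β, (minorInverse d ξ c α β).act ε q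
        (pencilOp d ξ c ε (slice d ξ q) (Sum.inr β) (Sum.inl j) φ)) := by
    intro α
    simp only [pencilOp_eq d ξ c hε, TensorProduct.sum_tmul, map_sum]
  rw [diracOp, reducedOp_act, d.lift_apply, map_sub, map_sub, pencilOp_eq d ξ c hε]
  congr 1
  simp only [hlin]
  rw [sum_pencilOp d ξ c hε]
  simp only [sum_minorInverse_act, pencilOp_eq d ξ c hε]
  rw [solve_sum_cf hξ, ← eq_sum_of_mem_imF hξ (d.solve_mem ε hx _)]

end Coordinates

/-! ### Polynomial curves of loops -/

section LoopCurve
variable {𝔤 : Type*} [LieRing 𝔤] [LieAlgebra ℂ 𝔤] [FiniteDimensional ℂ 𝔤]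

/-- The curve `u` of loops is polynomial, with derivative `u'` at `0`. -/
def LoopCurve (u : ℂ → Loop 𝔤) (u' : Loop 𝔤) : Prop :=
  ∀ ℓ : Module.Dual ℂ 𝔤, PolyCurve (fun θ => app ℓ (u θ)) (app ℓ u')

namespace LoopCurve
variable {u w : ℂ → Loop 𝔤} {u' w' : Loop 𝔤}

theorem const (u : Loop 𝔤) : LoopCurve (fun _ => u) 0 := fun ℓ => by
  simpa only [map_zero] using PolyCurve.const (app ℓ u)

theorem add (h : LoopCurve u u') (k : LoopCurve w w') :
    LoopCurve (fun θ => u θ + w θ) (u' + w') := fun ℓ => by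
  simpa only [map_add] using (h ℓ).add (k ℓ)

theorem smul (c : ℂ) (h : LoopCurve u u') : LoopCurve (fun θ => c • u θ) (c • u') := fun ℓ => by
  simpa only [app_smul_complex] using (h ℓ).smul c

theorem tmul {γ : ℂ → CircleFun} {γ' : CircleFun} (h : PolyCurve γ γ') (y : 𝔤) :
    LoopCurve (fun θ => γ θ ⊗ₜ[ℂ] y) (γ' ⊗ₜ[ℂ] y) := fun ℓ => by
  simpa only [app_tmul] using h.smul (ℓ y)

theorem sum {τ : Type*} (s : Finset τ) {u : τ → ℂ → Loop 𝔤} {u' : τ → Loop 𝔤}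
    (h : ∀ t ∈ s, LoopCurve (u t) (u' t)) :
    LoopCurve (fun θ => ∑ t ∈ s, u t θ) (∑ t ∈ s, u' t) := fun ℓ => by
  simpa only [map_sum] using PolyCurve.sum s fun t ht => h t ht ℓ

theorem loopDeriv (h : LoopCurve u u') :
    LoopCurve (fun θ => loopDeriv (u θ)) (loopDeriv u') := fun ℓ => by
  simpa only [app_loopDeriv] using (h ℓ).map dx

theorem lie_eq_sum {τ : Type*} [Fintype τ] (B : Module.Basis τ ℂ 𝔤) (u w : Loop 𝔤) :
    ⁅u, w⁆ = ∑ i, ∑ j, (app (B.coord i) u * app (B.coord j) w) ⊗ₜ[ℂ] ⁅B i, B j⁆ := by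
  conv_lhs => rw [loop_eq_sum B u, loop_eq_sum B w]
  rw [sum_lie]
  simp only [lie_sum, LieAlgebra.ExtendScalars.bracket_tmul]

theorem lie (h : LoopCurve u u') (k : LoopCurve w w') :
    LoopCurve (fun θ => ⁅u θ, w θ⁆) (⁅u', w 0⁆ + ⁅u 0, w'⁆) := by
  let B := Module.finBasis ℂ 𝔤
  have := LoopCurve.sum Finset.univ fun i _ => LoopCurve.sum Finset.univ fun j _ =>
    LoopCurve.tmul ((h (B.coord i)).mul (k (B.coord j))) ⁅B i, B j⁆
  simp only [TensorProduct.add_tmul, Finset.sum_add_distrib, ← lie_eq_sum] at this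
  exact this

theorem conn (ε : ℂ) (h : LoopCurve u u') (k : LoopCurve w w') :
    LoopCurve (fun θ => conn ε (u θ) (w θ)) (⁅u', w 0⁆ + conn ε (u 0) w') := by
  have := (k.loopDeriv.smul ε).add (h.lie k)
  simp only [conn_apply]
  rw [add_left_comm] at this
  exact this

theorem pairing [LieAlgebra.IsKilling ℂ 𝔤] (h : LoopCurve u u') (k : LoopCurve w w') :
    PolyCurve (fun θ => pairing (u θ) (w θ)) (pairing u' (w 0) + pairing (u 0) w') := by
  let B := Module.finBasis ℂ 𝔤
  have e : ∀ u w : Loop 𝔤, WAlg.pairing u w = ∑ i, app (B.coord i) u *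
      app (killingForm ℂ 𝔤 (B i)) w := by
    intro u w
    refine circleFun_ext fun x => ?_
    conv_lhs => rw [evalAt_pairing, loop_eq_sum B u]
    simp only [map_sum, LinearMap.sum_apply, map_mul, ev_tmul, map_smul, LinearMap.smul_apply,
      evalAt_app, smul_eq_mul]
  simp only [e]
  rw [← Finset.sum_add_distrib]
  exact PolyCurve.sum _ fun i _ => (h _).mul (k _)

theorem hasDerivAt_loopForm [LieAlgebra.IsKilling ℂ 𝔤] (h : LoopCurve u u')
    (k : LoopCurve w w') : HasDerivAt (fun θ => loopForm (u θ) (w θ))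
      (loopForm u' (w 0) + loopForm (u 0) w') 0 := by
  have := (h.pairing k).hasDerivAt
  rw [circleInt_eq, map_add] at this
  exact this

end LoopCurve

end LoopCurve

/-- The bracket of two local functionals is a local functional. -/
theorem exists_opBracket_eq {ι : Type*} [Fintype ι] (ε : ℂ) (K : MatDiffOp ι ι ι)
    (p r : DiffPoly ι) :
    ∃ t : DiffPoly ι, opBracket ε K (localFunctional p) (localFunctional r) = localFunctional t := by
  have h : IsDP fun u => ε⁻¹ • ∑ i, ∑ j, euler p i u * (K i j).act ε u (euler r j u) :=
    (isDP_sum _ fun i _ => isDP_sum _ fun j _ =>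
      (isDP_euler p i).mul ((K i j).isDP_act ε (isDP_euler r j))).smul _
  obtain ⟨t, ht⟩ := h
  refine ⟨t, funext fun u => ?_⟩
  rw [localFunctional, ← ht]
  simp only [opBracket, varDeriv_localFunctional, circleInt_eq, map_smul, map_sum, smul_eq_mul]

/-! ### The reduced pencil: affine dependence and the Jacobi identity -/

section Poisson
variable {𝔤 : Type*} [LieRing 𝔤] [LieAlgebra ℂ 𝔤] [FiniteDimensional ℂ 𝔤]
  [LieAlgebra.IsSimple ℂ 𝔤]
variable {ι κ : Type*} [Fintype ι] [Fintype κ] [DecidableEq ι] [DecidableEq κ]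
variable {d : ReductionData 𝔤} {ξ : Module.Basis (ι ⊕ κ) ℂ 𝔤}
variable (hξ : Submodule.span ℂ (Set.range fun i : ι => ξ (Sum.inl i)) = d.centralizer)

/-! ### The reduced operators depend affinely on the spectral parameter -/

include hξ in
-- The lifts at c = 0 are admissible for every c in `loopForm_eq_lift`, so c enters only through the
-- explicit term c a.
theorem circleInt_mul_reducedOp_act (c ε : ℂ) (q : ι → CircleFun) (i j : ι) (ψ φ : CircleFun) :
    circleInt (ψ * (reducedOp d ξ c i j).act ε q φ) =
      loopForm (d.lift ε (shift d ξ 0 q) (ψ ⊗ₜ[ℂ] dual ξ (Sum.inl i)))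
          (conn ε (const d.e + shift d ξ 0 q)
            (d.lift ε (shift d ξ 0 q) (φ ⊗ₜ[ℂ] dual ξ (Sum.inl j)))) +
        c * loopForm (d.lift ε (shift d ξ 0 q) (ψ ⊗ₜ[ℂ] dual ξ (Sum.inl i)))
          ⁅const d.a, d.lift ε (shift d ξ 0 q) (φ ⊗ₜ[ℂ] dual ξ (Sum.inl j))⁆ := by
  have hx := shift_mem hξ 0 q
  have hb : ∀ u, conn ε (const d.e + shift d ξ 0 q) (d.lift ε (shift d ξ 0 q) u) ∈ loops d.b :=
    fun u => loops_mono (d.centralizer_le_fil.trans d.fil_le_b) (d.conn_lift_mem ε hx u)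
  have hF : ∀ u, d.lift ε (shift d ξ 0 q) u - u ∈ loops d.imF := fun u => by
    rw [← neg_mem_iff, neg_sub]
    exact d.sub_lift_mem ε hx u
  have h := d.loopForm_eq_lift ε hx c (hb (ψ ⊗ₜ[ℂ] dual ξ (Sum.inl i)))
    (hb (φ ⊗ₜ[ℂ] dual ξ (Sum.inl j))) (hF _) (hF _)
  have hs : shift d ξ 0 q + c • const d.a = shift d ξ c q := by
    rw [shift, shift, zero_smul, add_zero]
  rw [hs, loopForm_tmul_left, conn_add_apply] at h
  rw [reducedOp_act, cf, ← h, loopForm_eq, map_add, smul_lie, map_smul]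
  rfl

include hξ in
theorem reducedOp_affine (c ε : ℂ) (q : ι → CircleFun) (i j : ι) (φ : CircleFun) :
    ((reducedOp d ξ 0 + c • (reducedOp d ξ 1 - reducedOp d ξ 0)) i j).act ε q φ =
      (reducedOp d ξ c i j).act ε q φ := by
  have e : (reducedOp d ξ 0 + c • (reducedOp d ξ 1 - reducedOp d ξ 0)) i j =
      reducedOp d ξ 0 i j + c • (reducedOp d ξ 1 i j + (-1 : ℂ) • reducedOp d ξ 0 i j) := by
    rw [neg_one_smul, ← sub_eq_add_neg]
    rfl
  rw [e, DiffOp.add_act, DiffOp.smul_act, DiffOp.add_act, DiffOp.smul_act, ← sub_eq_zero]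
  refine eq_zero_of_circleInt_mul _ fun ψ => ?_
  have h0 := circleInt_mul_reducedOp_act hξ 0 ε q i j ψ φ
  have h1 := circleInt_mul_reducedOp_act hξ 1 ε q i j ψ φ
  have hc := circleInt_mul_reducedOp_act hξ c ε q i j ψ φ
  rw [mul_comm, mul_sub, mul_add, mul_smul_comm, mul_add, mul_smul_comm]
  rw [circleInt_eq] at h0 h1 hc ⊢
  rw [map_sub, map_add, map_smul, map_add, map_smul, h0, h1, hc, smul_eq_mul, smul_eq_mul]
  ring

/-! ### The reduced bracket is a Poisson bracket -/

variable (d ξ)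

/-- The gradient of a local functional on `Q`, lifted so that the pencil maps it to `L(𝔤_f)`. -/
def hamVec (c ε : ℂ) (p : DiffPoly ι) (q : ι → CircleFun) : Loop 𝔤 :=
  d.lift ε (shift d ξ c q) (∑ i, euler p i q ⊗ₜ[ℂ] dual ξ (Sum.inl i))

/-- The Hamiltonian vector field. -/
def hamField (c ε : ℂ) (p : DiffPoly ι) (q : ι → CircleFun) (i : ι) : CircleFun :=
  ε⁻¹ • cf ξ (Sum.inl i) (conn ε (const d.e + shift d ξ c q) (hamVec d ξ c ε p q))

variable {d ξ}

theorem sum_reducedOp_act (c ε : ℂ) (p : DiffPoly ι) (q : ι → CircleFun) (i : ι) :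
    ∑ j, (reducedOp d ξ c i j).act ε q (euler p j q) =
      cf ξ (Sum.inl i) (conn ε (const d.e + shift d ξ c q) (hamVec d ξ c ε p q)) := by
  simp only [reducedOp_act, hamVec, map_sum]

theorem opBracket_reducedOp (c ε : ℂ) (p r : DiffPoly ι) (q : ι → CircleFun) :
    opBracket ε (reducedOp d ξ c) (localFunctional p) (localFunctional r) q =
      ∑ i, circleInt (euler p i q * hamField d ξ c ε r q i) := by
  simp only [opBracket, varDeriv_localFunctional, hamField, ← sum_reducedOp_act]
  rw [Finset.mul_sum]
  refine Finset.sum_congr rfl fun i _ => ?_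
  simp only [circleInt_eq, mul_smul_comm, map_smul, Finset.mul_sum, map_sum, smul_eq_mul]

include hξ

/-- Lifting the first gradient costs nothing by `loopForm_lift`; in this symmetric shape skewness is
that of the connection. -/
theorem opBracket_eq_loopForm (c ε : ℂ) (p r : DiffPoly ι) (q : ι → CircleFun) :
    opBracket ε (reducedOp d ξ c) (localFunctional p) (localFunctional r) q =
      ε⁻¹ * loopForm (hamVec d ξ c ε p q)
        (conn ε (const d.e + shift d ξ c q) (hamVec d ξ c ε r q)) := by
  rw [opBracket_reducedOp, hamVec, hamVec, d.loopForm_lift ε (shift_mem hξ c q), loopForm_eq,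
    map_sum, LinearMap.sum_apply, Finset.mul_sum]
  refine Finset.sum_congr rfl fun i _ => ?_
  rw [← loopForm_eq, loopForm_tmul_left, hamField, circleInt_eq, mul_smul_comm, map_smul]
  rfl

theorem dcf_hamVec (c ε : ℂ) (p : DiffPoly ι) (q : ι → CircleFun) (i : ι) :
    dcf ξ (Sum.inl i) (hamVec d ξ c ε p q) = euler p i q := by
  have h := dcf_imF hξ i (d.sub_lift_mem ε (shift_mem hξ c q)
    (∑ i, euler p i q ⊗ₜ[ℂ] dual ξ (Sum.inl i)))
  rw [map_sub, sub_eq_zero, map_sum, Finset.sum_eq_single i] at h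
  · rw [dcf_tmul, if_pos rfl] at h
    exact h.symm
  · intro j _ hj
    rw [dcf_tmul, if_neg (by simpa using hj.symm)]
  · simp

/-- The lifted gradient generates a field tangent to Q: no components are lost by reading only the
coordinates along 𝔤_f. -/
theorem conn_hamVec_eq (c ε : ℂ) (p : DiffPoly ι) (q : ι → CircleFun) :
    ∑ i, hamField d ξ c ε p q i ⊗ₜ[ℂ] ξ (Sum.inl i) =
      ε⁻¹ • conn ε (const d.e + shift d ξ c q) (hamVec d ξ c ε p q) := by
  have h : conn ε (const d.e + shift d ξ c q) (hamVec d ξ c ε p q) ∈ loops d.centralizer :=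
    d.conn_lift_mem ε (shift_mem hξ c q) _
  conv_rhs => rw [eq_sum_of_mem_centralizer hξ h]
  rw [Finset.smul_sum]
  rfl

omit hξ in
theorem exists_loopCurve_hamVec (c ε : ℂ) (p : DiffPoly ι) (q X : ι → CircleFun) :
    ∃ v', LoopCurve (fun θ : ℂ => hamVec d ξ c ε p (q + θ • X)) v' := by
  have h1 : ∀ I, IsDP fun q : ι → CircleFun => cf ξ I (hamVec d ξ c ε p q) := by
    intro I
    simp only [hamVec, map_sum]
    refine isDP_sum _ fun i _ => ?_
    obtain ⟨D, hD⟩ := (isLoopDO_tmul (σ := ι) (dual ξ (Sum.inl i))).lift d ξ c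
      (killingForm ℂ 𝔤 (dual ξ I))
    simp only [cf, hD]
    exact D.isDP_act ε (isDP_euler p i)
  choose γ' hγ using fun I => (h1 I).polyCurve q X
  refine ⟨∑ I, γ' I ⊗ₜ[ℂ] ξ I, ?_⟩
  have h2 := LoopCurve.sum Finset.univ fun I _ => (LoopCurve.tmul (hγ I) (ξ I))
  simp only [← eq_sum_cf] at h2
  exact h2

omit hξ in
theorem loopCurve_shift (c : ℂ) (q X : ι → CircleFun) :
    LoopCurve (fun θ : ℂ => const d.e + shift d ξ c (q + θ • X))
      (∑ i, X i ⊗ₜ[ℂ] ξ (Sum.inl i)) := by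
  have h := (LoopCurve.const (const d.e)).add ((LoopCurve.sum Finset.univ fun i _ =>
    LoopCurve.tmul (PolyCurve.line (q i) (X i)) (ξ (Sum.inl i))).add
      (LoopCurve.const (c • const d.a)))
  rw [add_zero, zero_add] at h
  exact h

omit hξ in
variable (d ξ) in
/-- The derivative of `hamVec` along the Hamiltonian field of `s`. -/
def hamDeriv (c ε : ℂ) (p s : DiffPoly ι) (q : ι → CircleFun) : Loop 𝔤 :=
  (exists_loopCurve_hamVec (d := d) (ξ := ξ) c ε p q (hamField d ξ c ε s q)).choose

omit hξ in
theorem loopCurve_hamVec (c ε : ℂ) (p s : DiffPoly ι) (q : ι → CircleFun) :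
    LoopCurve (fun θ : ℂ => hamVec d ξ c ε p (q + θ • hamField d ξ c ε s q))
      (hamDeriv d ξ c ε p s q) :=
  (exists_loopCurve_hamVec c ε p q (hamField d ξ c ε s q)).choose_spec

omit hξ in
variable (d ξ) in
/-- The second variation of `p` along the Hamiltonian fields of `s` and `r`. -/
def hess (c ε : ℂ) (p s r : DiffPoly ι) (q : ι → CircleFun) : ℂ :=
  ∑ i, circleInt (dcf ξ (Sum.inl i) (hamDeriv d ξ c ε p s q) * hamField d ξ c ε r q i)

/-- Modulo L([f,𝔤]) the lifted gradient is the Euler derivative, so `hess` is a genuine second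
variation and the derivative of the correction drops out. -/
theorem hess_symm (c ε : ℂ) (p s r : DiffPoly ι) (q : ι → CircleFun) :
    hess d ξ c ε p s r q = hess d ξ c ε p r s q := by
  refine hessian_symm p q _ _ _ _ (fun i => ?_) (fun i => ?_)
  · have h := loopCurve_hamVec (d := d) (ξ := ξ) c ε p s q (killingForm ℂ 𝔤 (ξ (Sum.inl i)))
    have e : ∀ q, app (killingForm ℂ 𝔤 (ξ (Sum.inl i))) (hamVec d ξ c ε p q) = euler p i q :=
      fun q => dcf_hamVec hξ c ε p q i
    simp only [e] at h
    exact h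
  · have h := loopCurve_hamVec (d := d) (ξ := ξ) c ε p r q (killingForm ℂ 𝔤 (ξ (Sum.inl i)))
    have e : ∀ q, app (killingForm ℂ 𝔤 (ξ (Sum.inl i))) (hamVec d ξ c ε p q) = euler p i q :=
      fun q => dcf_hamVec hξ c ε p q i
    simp only [e] at h
    exact h

theorem loopForm_conn_hamVec (c : ℂ) {ε : ℂ} (hε : ε ≠ 0) (r : DiffPoly ι) (q : ι → CircleFun)
    (u : Loop 𝔤) : loopForm u (conn ε (const d.e + shift d ξ c q) (hamVec d ξ c ε r q)) =
      ε * ∑ i, circleInt (dcf ξ (Sum.inl i) u * hamField d ξ c ε r q i) := by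
  have h : conn ε (const d.e + shift d ξ c q) (hamVec d ξ c ε r q) =
      ε • ∑ i, hamField d ξ c ε r q i ⊗ₜ[ℂ] ξ (Sum.inl i) := by
    rw [conn_hamVec_eq hξ c ε, smul_inv_smul₀ hε]
  rw [h, loopForm_eq, map_smul, map_sum, smul_eq_mul]
  congr 1
  refine Finset.sum_congr rfl fun i _ => ?_
  rw [← loopForm_eq, loopForm_comm, loopForm_tmul_left, mul_comm, dcf]

/-- The derivative of the reduced bracket along a Hamiltonian field. -/
theorem opBracket_opBracket (c : ℂ) {ε : ℂ} (hε : ε ≠ 0) (p r s : DiffPoly ι)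
    (q : ι → CircleFun) :
    opBracket ε (reducedOp d ξ c)
      (opBracket ε (reducedOp d ξ c) (localFunctional p) (localFunctional r))
      (localFunctional s) q =
    hess d ξ c ε p s r q - hess d ξ c ε r s p q + ε⁻¹ * ε⁻¹ * loopForm (hamVec d ξ c ε p q)
      ⁅conn ε (const d.e + shift d ξ c q) (hamVec d ξ c ε s q), hamVec d ξ c ε r q⁆ := by
  obtain ⟨t, ht⟩ := exists_opBracket_eq ε (reducedOp d ξ c) p r
  rw [ht, opBracket_reducedOp]
  have h1 := isVarDeriv_euler t q (hamField d ξ c ε s q)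
  simp only [← ht, opBracket_eq_loopForm hξ] at h1
  -- Three contributions: the two lifted gradients give second variations, and the motion of the
  -- base point inside the connection gives the bracket term.
  have h2 := ((loopCurve_hamVec (d := d) (ξ := ξ) c ε p s q).hasDerivAt_loopForm
    ((loopCurve_shift (d := d) (ξ := ξ) c q (hamField d ξ c ε s q)).conn ε
      (loopCurve_hamVec (d := d) (ξ := ξ) c ε r s q))).const_mul ε⁻¹
  rw [h1.unique h2]
  simp only [zero_smul, add_zero]
  rw [conn_hamVec_eq hξ c ε]
  have e1 : ∀ u v w : Loop 𝔤, loopForm u (v + w) = loopForm u v + loopForm u w := fun u v w => by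
    rw [loopForm_eq, map_add]; rfl
  have e2 : loopForm (hamVec d ξ c ε p q) (conn ε (const d.e + shift d ξ c q)
      (hamDeriv d ξ c ε r s q)) = -loopForm (hamDeriv d ξ c ε r s q)
        (conn ε (const d.e + shift d ξ c q) (hamVec d ξ c ε p q)) := by
    rw [loopForm_comm, loopForm_conn]
  have e3 : ∀ u v w : Loop 𝔤, loopForm u ⁅ε⁻¹ • v, w⁆ = ε⁻¹ * loopForm u ⁅v, w⁆ :=
    fun u v w => by
      rw [smul_lie, loopForm_eq, map_smul]; rfl
  rw [e1, e2, e3, loopForm_conn_hamVec hξ c hε, loopForm_conn_hamVec hξ c hε, hess, hess]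
  field_simp
  ring

omit hξ in
-- Move ∇ off u by skew-adjointness, then use that ∇ is a derivation of the bracket and that the
-- form is invariant.
theorem sum_loopForm_lie_conn (ε : ℂ) (z u v w : Loop 𝔤) :
    loopForm u ⁅conn ε z w, v⁆ + loopForm v ⁅conn ε z u, w⁆ + loopForm w ⁅conn ε z v, u⁆ = 0 := by
  have h := loopForm_conn ε z u ⁅w, v⁆
  rw [conn_lie, loopForm_eq u, map_add, ← loopForm_eq, ← loopForm_eq] at h
  have e1 : loopForm v ⁅conn ε z u, w⁆ = loopForm (conn ε z u) ⁅w, v⁆ := by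
    rw [loopForm_comm, loopForm_lie]
  have e2 : loopForm w ⁅conn ε z v, u⁆ = loopForm u ⁅w, conn ε z v⁆ := by
    rw [← loopForm_lie, loopForm_comm]
  rw [e1, e2, h]
  ring

theorem isLocalPoisson_reducedOp (c : ℂ) {ε : ℂ} (hε : ε ≠ 0) :
    IsLocalPoisson ε (reducedOp d ξ c) where
  closed := exists_opBracket_eq ε _
  skew p r := by
    funext q
    rw [Pi.neg_apply, opBracket_eq_loopForm hξ, opBracket_eq_loopForm hξ, loopForm_comm,
      loopForm_conn, mul_neg]
  -- The six second variations cancel in pairs after `hess_symm`; the three cubic terms form the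
  -- cyclic sum above.
  jacobi p r s := by
    funext q
    rw [Pi.add_apply, Pi.add_apply, opBracket_opBracket hξ c hε, opBracket_opBracket hξ c hε,
      opBracket_opBracket hξ c hε, hess_symm hξ c ε p s r, hess_symm hξ c ε r s p,
      hess_symm hξ c ε s p r, Pi.zero_apply]
    have h := sum_loopForm_lie_conn ε (const d.e + shift d ξ c q) (hamVec d ξ c ε p q)
      (hamVec d ξ c ε r q) (hamVec d ξ c ε s q)
    linear_combination (ε⁻¹ * ε⁻¹) * h

end Poisson

/-! ### Divided powers of a derivation -/

section DividedPowers
variable {M : Type*} [AddCommGroup M] [Module ℂ M]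

/-- The divided power `T^k / k!`. -/
def divPow (T : Module.End ℂ M) (k : ℕ) : Module.End ℂ M := (k.factorial : ℂ)⁻¹ • T ^ k

theorem divPow_zero (T : Module.End ℂ M) (u : M) : divPow T 0 u = u := by
  simp [divPow]

theorem divPow_apply (T : Module.End ℂ M) (k : ℕ) (u : M) :
    divPow T k u = (k.factorial : ℂ)⁻¹ • (T ^ k) u := rfl

theorem apply_divPow (T : Module.End ℂ M) (k : ℕ) (u : M) :
    T (divPow T k u) = ((k : ℂ) + 1) • divPow T (k + 1) u := by
  have h : (k : ℂ) + 1 ≠ 0 := Nat.cast_add_one_ne_zero k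
  rw [divPow_apply, divPow_apply, map_smul, smul_smul, Nat.factorial_succ, pow_succ',
    Module.End.mul_apply]
  push_cast
  rw [mul_inv, mul_inv_cancel_left₀ h]

/-- The Leibniz rule for divided powers. -/
theorem divPow_leibniz (T : Module.End ℂ M) (F : ℕ → ℕ → M)
    (h : ∀ i j, T (F i j) = ((i : ℂ) + 1) • F (i + 1) j + ((j : ℂ) + 1) • F i (j + 1)) (n : ℕ) :
    divPow T n (F 0 0) = ∑ p ∈ Finset.HasAntidiagonal.antidiagonal n, F p.1 p.2 := by
  induction n with
  | zero => simp [divPow_zero]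
  | succ n ih =>
    have hn : (n : ℂ) + 1 ≠ 0 := Nat.cast_add_one_ne_zero n
    refine smul_right_injective M hn ?_
    beta_reduce
    rw [← apply_divPow, ih, map_sum]
    simp only [h, Finset.sum_add_distrib]
    have h1 := Finset.Nat.sum_antidiagonal_succ (n := n) (f := fun p => (p.1 : ℂ) • F p.1 p.2)
    have h2 := Finset.Nat.sum_antidiagonal_succ' (n := n) (f := fun p => (p.2 : ℂ) • F p.1 p.2)
    simp only [Nat.cast_zero, zero_smul, zero_add, Nat.cast_add, Nat.cast_one] at h1 h2
    rw [← h1, ← h2, ← Finset.sum_add_distrib, Finset.smul_sum]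
    refine Finset.sum_congr rfl fun p hp => ?_
    rw [← add_smul]
    congr 1
    exact_mod_cast Finset.HasAntidiagonal.mem_antidiagonal.mp hp

/-- Multiplicativity of the truncated exponential. The abstract double family `F` covers brackets of
two loops and also the action of a connection, whose terms are not plain divided powers. -/
theorem sum_divPow_leibniz (T : Module.End ℂ M) (F : ℕ → ℕ → M)
    (h : ∀ i j, T (F i j) = ((i : ℂ) + 1) • F (i + 1) j + ((j : ℂ) + 1) • F i (j + 1)) (N : ℕ)
    (h1 : ∀ i j, N ≤ i → F i j = 0) (h2 : ∀ i j, N ≤ j → F i j = 0)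
    (hT : ∀ k u, N ≤ k → divPow T k u = 0) :
    ∑ n ∈ Finset.range N, divPow T n (F 0 0) =
      ∑ i ∈ Finset.range N, ∑ j ∈ Finset.range N, F i j := by
  -- Total degrees in the N × N square stay below 2N, so the vanishing tail is added before grouping
  -- by antidiagonals.
  have e1 : ∑ n ∈ Finset.range N, divPow T n (F 0 0) =
      ∑ n ∈ Finset.range (2 * N), divPow T n (F 0 0) := by
    refine Finset.sum_subset (Finset.range_mono (by omega)) fun n _ hn => hT _ _ ?_
    simpa using hn
  rw [e1, ← Finset.sum_product']
  rw [← Finset.sum_fiberwise_of_maps_to (s := Finset.range N ×ˢ Finset.range N)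
    (t := Finset.range (2 * N)) (g := fun p => p.1 + p.2)]
  · refine Finset.sum_congr rfl fun n _ => ?_
    rw [divPow_leibniz T F h]
    symm
    refine Finset.sum_subset ?_ ?_
    · intro p hp
      exact Finset.HasAntidiagonal.mem_antidiagonal.mpr (Finset.mem_filter.mp hp).2
    · intro p hp hn
      simp only [Finset.mem_filter, Finset.mem_product, Finset.mem_range, not_and] at hn
      by_cases ha : p.1 < N
      · by_cases hb : p.2 < N
        · exact absurd (Finset.HasAntidiagonal.mem_antidiagonal.mp hp) (hn ⟨ha, hb⟩)
        · exact h2 _ _ (not_lt.mp hb)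
      · exact h1 _ _ (not_lt.mp ha)
  · intro p hp
    simp only [Finset.mem_product, Finset.mem_range] at hp ⊢
    omega

end DividedPowers

/-! ### Gauge transformations -/

namespace ReductionData
variable {𝔤 : Type*} [LieRing 𝔤] [LieAlgebra ℂ 𝔤] (d : ReductionData 𝔤)
variable [FiniteDimensional ℂ 𝔤]

/-- The operator `-ad m` on loops. -/
def nad (m : Loop 𝔤) : Module.End ℂ (Loop 𝔤) := -LieAlgebra.ad ℂ (Loop 𝔤) m

theorem nad_apply (m v : Loop 𝔤) : nad m v = -⁅m, v⁆ := rfl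

theorem nad_lie (m u v : Loop 𝔤) : nad m ⁅u, v⁆ = ⁅nad m u, v⁆ + ⁅u, nad m v⁆ := by
  rw [nad_apply, nad_apply, nad_apply, leibniz_lie, neg_lie, lie_neg, neg_add]

theorem iterate_eq (m v : Loop 𝔤) (k : ℕ) : (fun v => -⁅m, v⁆)^[k] v = ((nad m) ^ k) v := by
  rw [Module.End.pow_apply]
  rfl

variable {m : Loop 𝔤}

theorem nad_pow_mem {i : ℤ} (hm : m ∈ loops (d.fil i)) {j : ℤ} {u : Loop 𝔤}
    (hu : u ∈ loops (d.fil j)) (k : ℕ) : ((nad m) ^ k) u ∈ loops (d.fil (k * i + j)) := by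
  induction k with
  | zero => simpa using hu
  | succ k ih =>
    rw [pow_succ', Module.End.mul_apply, nad_apply]
    have := d.lie_mem_loops_fil hm ih
    rw [show i + (k * i + j) = (k + 1 : ℕ) * i + j by push_cast; ring] at this
    exact neg_mem this

theorem divPow_nad_mem {i : ℤ} (hm : m ∈ loops (d.fil i)) {j : ℤ} {u : Loop 𝔤}
    (hu : u ∈ loops (d.fil j)) (k : ℕ) : divPow (nad m) k u ∈ loops (d.fil (k * i + j)) :=
  smul_mem_loops _ (d.nad_pow_mem hm hu k)

theorem nad_pow_eq_zero (hm : m ∈ loops (d.fil (-1))) {k : ℕ} (hk : 2 * d.bound + 1 ≤ k)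
    (u : Loop 𝔤) : ((nad m) ^ k) u = 0 :=
  d.eq_zero_of_mem_fil (by omega) (d.nad_pow_mem hm (d.mem_loops_top u le_rfl) k)

theorem divPow_nad_eq_zero (hm : m ∈ loops (d.fil (-1))) {k : ℕ} (hk : 2 * d.bound + 1 ≤ k)
    (u : Loop 𝔤) : divPow (nad m) k u = 0 := by
  rw [divPow_apply, d.nad_pow_eq_zero hm hk, smul_zero]

/-- The number of terms kept in exponential series. -/
def order : ℕ := 2 * d.bound + 2

/-- The automorphism `exp(-ad m)`. -/
def expNad (m : Loop 𝔤) : Module.End ℂ (Loop 𝔤) :=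
  ∑ k ∈ Finset.range d.order, divPow (nad m) k

theorem expNad_apply (m u : Loop 𝔤) :
    d.expNad m u = ∑ k ∈ Finset.range d.order, divPow (nad m) k u :=
  LinearMap.sum_apply _ _ _

theorem expNad_lie (hm : m ∈ loops (d.fil (-1))) (u v : Loop 𝔤) :
    d.expNad m ⁅u, v⁆ = ⁅d.expNad m u, d.expNad m v⁆ := by
  have h := sum_divPow_leibniz (nad m)
    (fun i j => ⁅divPow (nad m) i u, divPow (nad m) j v⁆) (fun i j => by
      rw [nad_lie, apply_divPow, apply_divPow, smul_lie, lie_smul]) d.order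
    (fun i j hi => by
      rw [d.divPow_nad_eq_zero hm (by rw [order] at hi; omega), zero_lie])
    (fun i j hj => by
      rw [d.divPow_nad_eq_zero hm (k := j) (by rw [order] at hj; omega), lie_zero])
    (fun k u hk => d.divPow_nad_eq_zero hm (by rw [order] at hk; omega) u)
  simp only [divPow_zero] at h
  rw [expNad_apply, h, expNad_apply, expNad_apply, sum_lie]
  simp only [lie_sum]

theorem nad_pow_smul (φ : CircleFun) (u : Loop 𝔤) (k : ℕ) :
    ((nad m) ^ k) (φ • u) = φ • ((nad m) ^ k) u := by
  induction k with
  | zero => rfl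
  | succ k ih =>
    rw [pow_succ', Module.End.mul_apply, Module.End.mul_apply, ih, nad_apply, nad_apply,
      lie_smul_loop, smul_neg]

theorem expNad_smul (φ : CircleFun) (u : Loop 𝔤) :
    d.expNad m (φ • u) = φ • d.expNad m u := by
  simp only [expNad_apply, divPow_apply, nad_pow_smul, Finset.smul_sum]
  refine Finset.sum_congr rfl fun k _ => smul_comm _ _ _

theorem expNad_sub_mem (hm : m ∈ loops (d.fil (-1))) {k : ℤ} {u : Loop 𝔤}
    (hu : u ∈ loops (d.fil k)) : d.expNad m u - u ∈ loops (d.fil (k - 1)) := by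
  rw [expNad_apply, order, Finset.sum_range_succ', divPow_zero, add_sub_cancel_right]
  refine sum_mem fun n _ => loops_mono (d.fil_mono ?_) (d.divPow_nad_mem hm hu (n + 1))
  omega

/-- The terms of `exp(-ad m)(ε ∂_x + z)`, apart from `ε ∂_x`. -/
def gaugeTerm (ε : ℂ) (m z : Loop 𝔤) : ℕ → Loop 𝔤
  | 0 => z
  | k + 1 => divPow (nad m) (k + 1) z +
      ((k + 1).factorial : ℂ)⁻¹ • ((nad m) ^ k) (ε • loopDeriv m)

/-- The derivative term carries one power of `nad m` fewer than its index; this is why `order` is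
one more than the nilpotency bound. -/
theorem gaugeTerm_eq_zero (hm : m ∈ loops (d.fil (-1))) (ε : ℂ) (z : Loop 𝔤) {k : ℕ}
    (hk : d.order ≤ k) : gaugeTerm ε m z k = 0 := by
  obtain ⟨k, rfl⟩ : ∃ j, k = j + 1 := ⟨k - 1, by rw [order] at hk; omega⟩
  rw [order] at hk
  rw [gaugeTerm, d.divPow_nad_eq_zero hm (by omega), d.nad_pow_eq_zero hm (by omega), smul_zero,
    add_zero]

theorem nad_gaugeTerm (ε : ℂ) (z : Loop 𝔤) (k : ℕ) :
    nad m (gaugeTerm ε m z (k + 1)) = ((k : ℂ) + 2) • gaugeTerm ε m z (k + 2) := by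
  rw [gaugeTerm, gaugeTerm, map_add, apply_divPow, smul_add, map_smul]
  congr 1
  · congr 1
    push_cast
    ring
  · have h : (k : ℂ) + 2 ≠ 0 := by exact_mod_cast (k + 1).succ_ne_zero
    rw [pow_succ', Module.End.mul_apply, Nat.factorial_succ (k + 1), smul_smul]
    congr 1
    push_cast
    rw [mul_inv, show (k : ℂ) + 1 + 1 = k + 2 by ring, mul_inv_cancel_left₀ h]

theorem gauge_eq (hm : m ∈ loops (d.fil (-1))) (ε : ℂ) (z : Loop 𝔤) :
    gauge ε m z = ∑ k ∈ Finset.range d.order, gaugeTerm ε m z k := by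
  rw [gauge, finsum_eq_sum_of_support_subset (s := Finset.range d.order),
    finsum_eq_sum_of_support_subset (s := Finset.range (2 * d.bound + 1))]
  · rw [order, Finset.sum_range_succ', Finset.sum_range_succ' (gaugeTerm ε m z)]
    simp only [gaugeTerm, Finset.sum_add_distrib, iterate_eq, divPow_apply, pow_zero,
      Module.End.one_apply, Nat.factorial_zero, Nat.cast_one, inv_one, one_smul]
    abel
  · intro k hk
    rw [Finset.coe_range, Set.mem_Iio]
    by_contra hn
    exact hk (by beta_reduce; rw [iterate_eq, d.nad_pow_eq_zero hm (by omega), smul_zero])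
  · intro k hk
    rw [Finset.coe_range, Set.mem_Iio]
    by_contra hn
    exact hk (by beta_reduce; rw [iterate_eq, d.nad_pow_eq_zero hm (by rw [order] at hn; omega), smul_zero])

theorem expNad_conn (hm : m ∈ loops (d.fil (-1))) (ε : ℂ) (z u : Loop 𝔤) :
    d.expNad m (conn ε z u) = conn ε (gauge ε m z) (d.expNad m u) := by
  -- The bare ε∂_x occurs only in row 0; its commutators with m are the derivative parts of
  -- `gaugeTerm`.
  let F : ℕ → ℕ → Loop 𝔤 := fun i j =>
    (if i = 0 then ε • loopDeriv (divPow (nad m) j u) else 0) +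
      ⁅gaugeTerm ε m z i, divPow (nad m) j u⁆
  have hD : ∀ v : Loop 𝔤, nad m (ε • loopDeriv v) = ⁅ε • loopDeriv m, v⁆ +
      ε • loopDeriv (nad m v) := by
    intro v
    rw [nad_apply, nad_apply, map_neg, loopDeriv_lie, lie_smul, smul_lie, smul_neg, smul_add]
    abel
  have h := sum_divPow_leibniz (nad m) F (fun i j => by
      simp only [F]
      rcases i with _ | i
      · simp only [if_true, zero_add, Nat.cast_zero, one_smul, one_ne_zero, if_false]
        rw [map_add, hD, nad_lie, apply_divPow, gaugeTerm, gaugeTerm, pow_zero,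
          Module.End.one_apply, map_smul, lie_smul, add_lie, smul_add, smul_comm ε]
        simp only [divPow_apply, zero_add, Nat.factorial_one, Nat.cast_one, inv_one, one_smul,
          pow_one]
        abel
      · simp only [Nat.add_eq_zero_iff, one_ne_zero, and_false, if_false, zero_add]
        rw [nad_lie, nad_gaugeTerm, apply_divPow, smul_lie, lie_smul]
        push_cast
        rw [add_assoc (i : ℂ), one_add_one_eq_two]) d.order
    (fun i j hi => by
      simp only [F]
      rw [if_neg (by rw [order] at hi; omega), d.gaugeTerm_eq_zero hm ε z hi, zero_lie, zero_add])
    (fun i j hj => by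
      simp only [F]
      rw [d.divPow_nad_eq_zero hm (by rw [order] at hj; omega), lie_zero, map_zero, smul_zero,
        ite_self, zero_add])
    (fun k u hk => d.divPow_nad_eq_zero hm (by rw [order] at hk; omega) u)
  have h0 : F 0 0 = conn ε z u := by
    simp only [F, if_true, divPow_zero, gaugeTerm]
    rfl
  rw [h0, ← expNad_apply] at h
  rw [h, conn_apply, d.gauge_eq hm, expNad_apply, sum_lie, map_sum, Finset.smul_sum]
  simp only [F, Finset.sum_add_distrib, lie_sum]
  congr 1
  rw [Finset.sum_eq_single_of_mem 0 (by simp [order])]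
  · simp
  · intro i _ hi
    simp [hi]

/-- Terms at least quadratic in m have degree ≤ 2 + 2k ≤ 1 + k, and those involving m_x have degree
≤ k. Thus -[m,z] is the leading effect of the gauge action. -/
theorem gauge_sub_mem (ε : ℂ) {k : ℤ} (hk : k ≤ -1) (hm : m ∈ loops (d.fil k)) {z : Loop 𝔤}
    (hz : z ∈ loops (d.fil 2)) :
    gauge ε m z - (z - ⁅m, z⁆) ∈ loops (d.fil (1 + k)) := by
  rw [d.gauge_eq (loops_mono (d.fil_mono hk) hm), order, Finset.sum_range_succ',
    Finset.sum_range_succ']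
  have e : gaugeTerm ε m z 1 = -⁅m, z⁆ + ε • loopDeriv m := by
    simp [gaugeTerm, divPow_apply, nad_apply]
  have hd : ε • loopDeriv m ∈ loops (d.fil k) := smul_mem_loops ε (loopDeriv_mem_loops hm)
  rw [zero_add, e, gaugeTerm]
  have e2 : ∀ S E z b : Loop 𝔤, S + (-b + E) + z - (z - b) = S + E := fun S E z b => by abel
  rw [e2]
  refine add_mem (sum_mem fun n _ => ?_) (loops_mono (d.fil_mono (by omega)) hd)
  rw [gaugeTerm]
  refine add_mem (loops_mono (d.fil_mono ?_) (d.divPow_nad_mem hm hz (n + 1 + 1)))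
    (smul_mem_loops _ (loops_mono (d.fil_mono ?_) (d.nad_pow_mem hm hd (n + 1))))
  · push_cast
    nlinarith
  · push_cast
    nlinarith

end ReductionData

/-! ### Uniqueness of the point of `Q` on a gauge orbit -/

namespace ReductionData
variable {𝔤 : Type*} [LieRing 𝔤] [LieAlgebra ℂ 𝔤] (d : ReductionData 𝔤)
variable [FiniteDimensional ℂ 𝔤]

/-- `A` is a unipotent automorphism of the loop algebra that intertwines the connections
`ε ∂_x + z` and `ε ∂_x + z'`. -/
structure IsGaugeMap (ε : ℂ) (A : Module.End ℂ (Loop 𝔤)) (z z' : Loop 𝔤) : Prop where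
  lie : ∀ u v, A ⁅u, v⁆ = ⁅A u, A v⁆
  smul : ∀ (φ : CircleFun) (u : Loop 𝔤), A (φ • u) = φ • A u
  lowers : ∀ (k : ℤ), ∀ u ∈ loops (d.fil k), A u - u ∈ loops (d.fil (k - 1))
  conn : ∀ u, A (conn ε z u) = WAlg.conn ε z' (A u)

theorem isGaugeMap_one (ε : ℂ) (z : Loop 𝔤) : d.IsGaugeMap ε 1 z z where
  lie _ _ := rfl
  smul _ _ := rfl
  lowers _ u _ := by rw [Module.End.one_apply, sub_self]; exact zero_mem _
  conn _ := rfl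

theorem isGaugeMap_expNad (ε : ℂ) {m : Loop 𝔤} (hm : m ∈ loops (d.fil (-1))) (z : Loop 𝔤) :
    d.IsGaugeMap ε (d.expNad m) z (gauge ε m z) where
  lie := d.expNad_lie hm
  smul := d.expNad_smul
  lowers _ _ := d.expNad_sub_mem hm
  conn := d.expNad_conn hm ε z

variable {d}

namespace IsGaugeMap
variable {ε : ℂ} {A B : Module.End ℂ (Loop 𝔤)} {z z' z'' : Loop 𝔤}

theorem apply_mem (h : d.IsGaugeMap ε A z z') {k : ℤ} {u : Loop 𝔤} (hu : u ∈ loops (d.fil k)) :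
    A u ∈ loops (d.fil k) := by
  have := add_mem (loops_mono (d.fil_mono (by omega)) (h.lowers k u hu)) hu
  rwa [sub_add_cancel] at this

/-- Successive gauge transformations are composed as intertwining automorphisms, so products of
exponentials need not be rewritten as one exponential. -/
theorem comp (h : d.IsGaugeMap ε A z z') (h' : d.IsGaugeMap ε B z' z'') :
    d.IsGaugeMap ε (B * A) z z'' where
  lie u v := by simp only [Module.End.mul_apply, h.lie, h'.lie]
  smul φ u := by simp only [Module.End.mul_apply, h.smul, h'.smul]
  lowers k u hu := by
    rw [Module.End.mul_apply, ← sub_add_sub_cancel (B (A u)) (A u) u]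
    exact add_mem (h'.lowers k _ (h.apply_mem hu)) (h.lowers k u hu)
  conn u := by simp only [Module.End.mul_apply, h.conn, h'.conn]

/-- Unipotence: solve up to an error one step lower, and continue down to the bottom of the
filtration. -/
theorem exists_apply_eq (h : d.IsGaugeMap ε A z z') {k : ℤ} {u : Loop 𝔤}
    (hu : u ∈ loops (d.fil k)) : ∃ w ∈ loops (d.fil k), A w = u := by
  have key : ∀ n : ℕ, ∀ k : ℤ, k + d.bound < n → ∀ u ∈ loops (d.fil k),
      ∃ w ∈ loops (d.fil k), A w = u := by
    intro n
    induction n with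
    | zero =>
      intro k hk u hu
      refine ⟨0, zero_mem _, ?_⟩
      rw [map_zero, d.eq_zero_of_mem_fil (by push_cast at hk; omega) hu]
    | succ n ih =>
      intro k hk u hu
      obtain ⟨w, hw, hA⟩ := ih (k - 1) (by push_cast at hk; omega) _ (h.lowers k u hu)
      refine ⟨u - w, sub_mem hu (loops_mono (d.fil_mono (by omega)) hw), ?_⟩
      rw [map_sub, hA, sub_sub_cancel]
  exact key (k + d.bound + 1).toNat k (by omega) u hu

end IsGaugeMap

variable (d)

/-- The leading part, of degree `-k`, of a linear map that lowers the filtration by `k`. -/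
def symbol (k : ℤ) (T : 𝔤 →ₗ[ℂ] 𝔤) : 𝔤 →ₗ[ℂ] 𝔤 :=
  ∑ i ∈ Finset.Icc (-(d.bound : ℤ)) d.bound, d.comp (i - k) ∘ₗ T ∘ₗ d.comp i

theorem symbol_apply (k : ℤ) (T : 𝔤 →ₗ[ℂ] 𝔤) {i : ℤ} {v : 𝔤} (hv : v ∈ d.gr i) :
    d.symbol k T v = d.comp (i - k) (T v) := by
  rw [symbol, LinearMap.sum_apply]
  simp only [LinearMap.comp_apply]
  by_cases hi : (d.bound : ℤ) < |i|
  · rw [d.gr_eq_bot hi, Submodule.mem_bot] at hv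
    simp [hv]
  · rw [Finset.sum_eq_single i, d.comp_of_mem hv]
    · intro j _ hj
      rw [d.comp_of_ne hj.symm hv, map_zero, map_zero]
    · intro h
      exact absurd (Finset.mem_Icc.mpr (abs_le.mp (not_lt.mp hi))) h

theorem comp_lie' {i : ℤ} {y : 𝔤} (hy : y ∈ d.gr i) (j : ℤ) (x : 𝔤) :
    d.comp (j + i) ⁅x, y⁆ = ⁅d.comp j x, y⁆ := by
  rw [← lie_skew, map_neg, add_comm, d.comp_lie hy, lie_skew]

theorem sub_comp_mem {i : ℤ} {x : 𝔤} (hx : x ∈ d.fil i) : x - d.comp i x ∈ d.fil (i - 1) := by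
  rw [mem_fil] at hx ⊢
  intro j hj
  rw [map_sub, d.comp_of_mem' j (d.comp_mem i x)]
  split_ifs with h
  · rw [h, sub_self]
  · rw [hx j (by omega), sub_zero]

theorem comp_lie_fil {i j : ℤ} {x y : 𝔤} (hx : x ∈ d.fil i) (hy : y ∈ d.fil j) :
    d.comp (i + j) ⁅x, y⁆ = ⁅d.comp i x, d.comp j y⁆ := by
  have h : ⁅x, y⁆ = ⁅x - d.comp i x, y⁆ + ⁅d.comp i x, y⁆ := by rw [sub_lie, sub_add_cancel]
  rw [h, map_add, d.comp_lie (d.comp_mem i x),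
    d.mem_fil.mp (d.lie_mem_fil (d.sub_comp_mem hx) hy) _ (by omega), zero_add]

theorem mem_fil_pred {i : ℤ} {x : 𝔤} (hx : x ∈ d.fil i) (h : d.comp i x = 0) :
    x ∈ d.fil (i - 1) := by
  have := d.sub_comp_mem hx
  rwa [h, sub_zero] at this

variable [LieAlgebra.IsKilling ℂ 𝔤]

theorem eq_zero_of_lie_gr {x : 𝔤} (h : ∀ i, ∀ v ∈ d.gr i, ⁅x, v⁆ = 0) : x = 0 := by
  have h1 : ∀ v : 𝔤, ⁅x, v⁆ = 0 := fun v => d.gr_induction (p := fun v => ⁅x, v⁆ = 0) h (lie_zero x)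
    (fun v w hv hw => by rw [lie_add, hv, hw, add_zero]) v
  refine eq_zero_of_killingForm fun y => ?_
  have h2 : LieAlgebra.ad ℂ 𝔤 x = 0 := LinearMap.ext h1
  rw [killingForm_apply_apply, h2, LinearMap.zero_comp, map_zero]

theorem mem_fil_of_lie {x : 𝔤} {s : ℤ} (h : ∀ i, ∀ v ∈ d.gr i, ⁅x, v⁆ ∈ d.fil (i + s)) :
    x ∈ d.fil s := d.mem_fil.mpr fun j hj => d.eq_zero_of_lie_gr fun i v hv => by
  rw [← d.comp_lie' hv]
  exact d.mem_fil.mp (h i v hv) _ (by omega)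

/-- Derivations of a Lie algebra with nondegenerate Killing form are inner; as the symbol has degree
-k, only that component of y acts. -/
theorem exists_gr_of_symbol {k : ℤ} {T : 𝔤 →ₗ[ℂ] 𝔤}
    (h : ∀ i j, ∀ v ∈ d.gr i, ∀ w ∈ d.gr j,
      d.symbol k T ⁅v, w⁆ = ⁅d.symbol k T v, w⁆ + ⁅v, d.symbol k T w⁆) :
    ∃ y ∈ d.gr (-k), ∀ i, ∀ v ∈ d.gr i, d.symbol k T v = ⁅y, v⁆ := by
  have h1 : ∀ v w, d.symbol k T ⁅v, w⁆ = ⁅d.symbol k T v, w⁆ + ⁅v, d.symbol k T w⁆ := by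
    intro v w
    refine d.gr_induction
      (p := fun v => d.symbol k T ⁅v, w⁆ = ⁅d.symbol k T v, w⁆ + ⁅v, d.symbol k T w⁆) ?_ (by simp)
      (fun v v' hv hv' => by
        simp only [add_lie, map_add, hv, hv']
        abel) v
    intro i v hv
    refine d.gr_induction
      (p := fun w => d.symbol k T ⁅v, w⁆ = ⁅d.symbol k T v, w⁆ + ⁅v, d.symbol k T w⁆)
      (fun j w hw => h i j v hv w hw) (by simp)
      (fun w w' hw hw' => by
        simp only [lie_add, map_add, hw, hw']
        abel) w
  obtain ⟨y, hy⟩ := LieDerivation.IsKilling.exists_eq_ad (R := ℂ) (L := 𝔤)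
    { d.symbol k T with
      leibniz' := fun v w => by
        change d.symbol k T ⁅v, w⁆ = ⁅v, d.symbol k T w⁆ - ⁅w, d.symbol k T v⁆
        rw [h1, ← lie_skew w, sub_neg_eq_add, add_comm] }
  have hy' : ∀ v, ⁅y, v⁆ = d.symbol k T v := fun v => by
    rw [← LieDerivation.ad_apply_apply ℂ 𝔤, hy]
    rfl
  refine ⟨d.comp (-k) y, d.comp_mem _ _, fun i v hv => ?_⟩
  rw [← d.comp_lie' hv, hy', d.symbol_apply k T hv, neg_add_eq_sub,
    d.comp_of_mem (d.comp_mem _ _)]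

section Unique
variable {d} {ε : ℂ} {A B : Module.End ℂ (Loop 𝔤)} {z q q' : Loop 𝔤}

/-- A map linear over functions acts pointwise, so its values on constant loops determine it. -/
theorem ev_const_of_smul {Δ : Module.End ℂ (Loop 𝔤)}
    (h : ∀ (φ : CircleFun) (u : Loop 𝔤), Δ (φ • u) = φ • Δ u) (t : ℝ) (u : Loop 𝔤) :
    ev t (Δ (const (ev t u))) = ev t (Δ u) := by
  induction u using TensorProduct.induction_on with
  | zero => simp [const]
  | add u v hu hv => rw [map_add, const_add, map_add, map_add, hu, hv, map_add, map_add]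
  | tmul φ y =>
    have e1 : φ ⊗ₜ[ℂ] y = φ • const y := by
      rw [const, TensorProduct.smul_tmul', smul_eq_mul, mul_one]
    rw [e1, h, ev_smul, ev_smul, ev_const, const, TensorProduct.tmul_smul, map_smul, map_smul]
    rfl

/-- The linear map `ev t ∘ Δ ∘ const` on `𝔤`. -/
def atPoint (Δ : Module.End ℂ (Loop 𝔤)) (t : ℝ) : 𝔤 →ₗ[ℂ] 𝔤 :=
  ev t ∘ₗ Δ ∘ₗ TensorProduct.mk ℂ CircleFun 𝔤 1

theorem atPoint_apply (Δ : Module.End ℂ (Loop 𝔤)) (t : ℝ) (v : 𝔤) :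
    atPoint Δ t v = ev t (Δ (const v)) := rfl

/-- If two unipotent automorphisms agree to order k, the leading part of their difference is ad y
with y of degree -k. Matching leading terms in the intertwining relation makes [y,e] the leading
part of q - q', which lies in 𝔤_f; hence y = 0. -/
theorem sub_mem_fil_pred (hA : d.IsGaugeMap ε A z q) (hB : d.IsGaugeMap ε B z q')
    (hz : z - const d.e ∈ loops (d.fil 1)) (hq : q - const d.e ∈ loops d.centralizer)
    (hq' : q' - const d.e ∈ loops d.centralizer) {k : ℤ} (hk : 1 ≤ k)
    (h : ∀ i, ∀ u ∈ loops (d.fil i), (A - B) u ∈ loops (d.fil (i - k))) (i : ℤ) :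
    ∀ u ∈ loops (d.fil i), (A - B) u ∈ loops (d.fil (i - (k + 1))) := by
  have he : const d.e ∈ loops (d.fil 2) := const_mem_loops (d.gr_le_fil le_rfl d.e_mem)
  have hz2 : z ∈ loops (d.fil 2) := by
    rw [← sub_add_cancel z (const d.e)]
    exact add_mem (loops_mono (d.fil_mono (by norm_num)) hz) he
  have hq0 := loops_mono d.centralizer_le_fil hq
  have hq2 : q ∈ loops (d.fil 2) := by
    rw [← sub_add_cancel q (const d.e)]
    exact add_mem (loops_mono (d.fil_mono (by norm_num)) hq0) he
  have hsm : ∀ (φ : CircleFun) (u : Loop 𝔤), (A - B) (φ • u) = φ • (A - B) u := fun φ u => by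
    rw [LinearMap.sub_apply, LinearMap.sub_apply, hA.smul, hB.smul, smul_sub]
  have hcon : ∀ u, (A - B) (conn ε z u) = conn ε q ((A - B) u) + ⁅q - q', B u⁆ := fun u => by
    rw [LinearMap.sub_apply, hA.conn, hB.conn, LinearMap.sub_apply, map_sub, sub_lie]
    simp only [conn_apply]
    abel
  have hcm : ∀ z ∈ loops (d.fil 2), ∀ i, ∀ u ∈ loops (d.fil i),
      conn ε z u ∈ loops (d.fil (i + 2)) := by
    intro z hz i u hu
    have := d.lie_mem_loops_fil hz hu
    rw [add_comm] at this
    exact add_mem (smul_mem_loops ε (loopDeriv_mem_loops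
      (loops_mono (d.fil_mono (by omega)) hu))) this
  have hqq : q - q' ∈ loops d.centralizer := by
    have := sub_mem hq hq'
    rwa [sub_sub_sub_cancel_right] at this
  -- By `hcon`, bracketing with q - q' is a combination of A - B, lowering by k, with connections,
  -- raising by at most 2. Surjectivity of B lets it be tested on every v.
  have hx : ∀ t, ev t (q - q') ∈ d.fil (2 - k) := by
    intro t
    refine d.mem_fil_of_lie fun i v hv => ?_
    obtain ⟨w, hw, hBw⟩ := hB.exists_apply_eq (const_mem_loops (d.gr_le_fil (le_refl i) hv))
    have h1 : ⁅q - q', B w⁆ ∈ loops (d.fil (i + (2 - k))) := by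
      rw [eq_sub_iff_add_eq'.mpr (hcon w).symm]
      refine sub_mem (loops_mono (d.fil_mono (by omega)) (h _ _ (hcm z hz2 i w hw)))
        (loops_mono (d.fil_mono (by omega)) (hcm q hq2 _ _ (h _ _ hw)))
    have h2 := mem_loops_iff.mp h1 t
    rwa [hBw, ev_lie, ev_const] at h2
  have key : ∀ t, ∀ i, ∀ v ∈ d.gr i, d.symbol k (atPoint (A - B) t) v = 0 := by
    intro t
    have hT : ∀ i, ∀ v ∈ d.fil i, atPoint (A - B) t v ∈ d.fil (i - k) := fun i v hv =>
      mem_loops_iff.mp (h i _ (const_mem_loops hv)) t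
    have hAt : ∀ C : Module.End ℂ (Loop 𝔤), (∀ (k : ℤ), ∀ u ∈ loops (d.fil k),
        C u - u ∈ loops (d.fil (k - 1))) → ∀ i, ∀ v ∈ d.gr i,
        ev t (C (const v)) ∈ d.fil i ∧ d.comp i (ev t (C (const v))) = v := by
      intro C hC i v hv
      have hv' := d.gr_le_fil (le_refl i) hv
      have h1 := mem_loops_iff.mp (hC i _ (const_mem_loops hv')) t
      rw [map_sub, ev_const] at h1
      refine ⟨?_, ?_⟩
      · have := add_mem (d.fil_mono (by omega) h1) hv'
        rwa [sub_add_cancel] at this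
      · have := d.mem_fil.mp h1 i (by omega)
        rwa [map_sub, d.comp_of_mem hv, sub_eq_zero] at this
    obtain ⟨y, hy, hs⟩ := d.exists_gr_of_symbol (k := k) (T := atPoint (A - B) t) (by
      intro i j v hv w hw
      have hvw : const ⁅v, w⁆ = ⁅const v, const w⁆ := by
        rw [const, const, const, LieAlgebra.ExtendScalars.bracket_tmul, mul_one]
      obtain ⟨a1, a2⟩ := hAt A hA.lowers j w hw
      obtain ⟨b1, b2⟩ := hAt B hB.lowers i v hv
      rw [d.symbol_apply k _ (d.lie_mem i j v hv w hw), d.symbol_apply k _ hv,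
        d.symbol_apply k _ hw]
      -- A twisted Leibniz rule; A and B become the identity on leading parts, so the symbol
      -- satisfies the untwisted one.
      have e1 : atPoint (A - B) t ⁅v, w⁆ = ⁅atPoint (A - B) t v, ev t (A (const w))⁆ +
          ⁅ev t (B (const v)), atPoint (A - B) t w⁆ := by
        simp only [atPoint_apply, LinearMap.sub_apply, hvw, hA.lie, hB.lie, map_sub, ev_lie,
          sub_lie, lie_sub]
        abel
      rw [e1, map_add, show i + j - k = (i - k) + j by ring,
        d.comp_lie_fil (hT i v (d.gr_le_fil le_rfl hv)) a1, a2,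
        show i - k + j = i + (j - k) by ring,
        d.comp_lie_fil b1 (hT j w (d.gr_le_fil le_rfl hw)), b2])
    -- Compare the components of degree i + 2 - k in `hcon`: of the connections only ad e survives,
    -- of B only the identity.
    have hye : ⁅y, d.e⁆ - d.comp (2 - k) (ev t (q - q')) = 0 := by
      refine d.eq_zero_of_lie_gr fun i v hv => ?_
      have hv' := d.gr_le_fil (le_refl i) hv
      have e0 := congrArg (fun u => d.comp (i + 2 - k) (ev t u)) (hcon (const v))
      have hΔ := h i _ (const_mem_loops hv')
      have hΔt : ev t ((A - B) (const v)) ∈ d.fil (i - k) := mem_loops_iff.mp hΔ t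
      have e1 : d.comp (i + 2 - k) (ev t ((A - B) (conn ε z (const v)))) = ⁅y, ⁅d.e, v⁆⁆ := by
        have e2 : conn ε z (const v) = ⁅z - const d.e, const v⁆ + ⁅const d.e, const v⁆ := by
          rw [conn_apply, loopDeriv_const, smul_zero, zero_add, sub_lie, sub_add_cancel]
        have e3 := h _ _ (d.lie_mem_loops_fil hz (const_mem_loops hv'))
        have hev : ⁅d.e, v⁆ ∈ d.gr (2 + i) := d.lie_mem 2 i _ d.e_mem _ hv
        rw [e2, map_add, map_add, map_add, d.mem_fil.mp (mem_loops_iff.mp e3 t) _ (by omega),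
          zero_add, ← hs _ _ hev, d.symbol_apply k _ hev, atPoint_apply,
          show const ⁅d.e, v⁆ = ⁅const d.e, const v⁆ by
            rw [const, const, const, LieAlgebra.ExtendScalars.bracket_tmul, mul_one],
          add_comm i]
      have e4 : d.comp (i + 2 - k) (ev t (conn ε q ((A - B) (const v)))) = ⁅d.e, ⁅y, v⁆⁆ := by
        have e5 : conn ε q ((A - B) (const v)) = ε • loopDeriv ((A - B) (const v)) +
            ⁅q - const d.e, (A - B) (const v)⁆ + ⁅const d.e, (A - B) (const v)⁆ := by
          rw [conn_apply, sub_lie]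
          abel
        have e6 := smul_mem_loops ε (loopDeriv_mem_loops hΔ)
        have e7 := d.lie_mem_loops_fil hq0 hΔ
        rw [e5, map_add, map_add, map_add, map_add,
          d.mem_fil.mp (mem_loops_iff.mp e6 t) _ (by omega),
          d.mem_fil.mp (mem_loops_iff.mp e7 t) _ (by omega), zero_add, zero_add, ev_lie,
          ev_const, show i + 2 - k = 2 + (i - k) by ring, d.comp_lie d.e_mem,
          ← atPoint_apply, ← d.symbol_apply k _ hv, hs i v hv]
      obtain ⟨b1, b2⟩ := hAt B hB.lowers i v hv
      have e8 : d.comp (i + 2 - k) (ev t ⁅q - q', B (const v)⁆) =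
          ⁅d.comp (2 - k) (ev t (q - q')), v⁆ := by
        rw [ev_lie, show i + 2 - k = (2 - k) + i by ring, d.comp_lie_fil (hx t) b1, b2]
      beta_reduce at e0
      rw [map_add, map_add, e1, e4, e8, leibniz_lie, add_comm, add_right_inj] at e0
      rw [sub_lie, e0, sub_self]
    have hy0 : y = 0 := by
      refine d.eq_zero_of_lie_e_mem (d.gr_le_fil (by omega) hy) ?_
      rw [← lie_skew, neg_mem_iff, sub_eq_zero.mp hye]
      exact d.comp_mem_centralizer _ (mem_loops_iff.mp hqq t)
    intro i v hv
    rw [hs i v hv, hy0, zero_lie]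
  intro u hu
  refine mem_loops_iff.mpr fun t => ?_
  rw [← ev_const_of_smul hsm, ← atPoint_apply]
  have hle : d.fil i ≤ (d.fil (i - (k + 1))).comap (atPoint (A - B) t) := by
    refine d.fil_le fun j hj v hv => ?_
    have h1 : atPoint (A - B) t v ∈ d.fil (j - k) :=
      mem_loops_iff.mp (h j _ (const_mem_loops (d.gr_le_fil le_rfl hv))) t
    have h2 := key t j v hv
    rw [d.symbol_apply k _ hv] at h2
    exact d.fil_mono (by omega) (d.mem_fil_pred h1 h2)
  exact hle (mem_loops_iff.mp hu t)

/-- Iterating the previous improvement exhausts the filtration and gives A = B. Then q - q' commutes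
with the image of B, which is everything, and 𝔤 has trivial centre. -/
theorem IsGaugeMap.unique (hA : d.IsGaugeMap ε A z q) (hB : d.IsGaugeMap ε B z q')
    (hz : z - const d.e ∈ loops (d.fil 1)) (hq : q - const d.e ∈ loops d.centralizer)
    (hq' : q' - const d.e ∈ loops d.centralizer) : q = q' := by
  have h : ∀ n : ℕ, ∀ i, ∀ u ∈ loops (d.fil i), (A - B) u ∈ loops (d.fil (i - (n + 1))) := by
    intro n
    induction n with
    | zero =>
      intro i u hu
      have := sub_mem (hA.lowers i u hu) (hB.lowers i u hu)
      rw [sub_sub_sub_cancel_right] at this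
      simpa using this
    | succ n ih =>
      intro i u hu
      have := sub_mem_fil_pred hA hB hz hq hq' (by omega) ih i u hu
      push_cast
      exact this
  have h0 : ∀ u, A u = B u := fun u => by
    rw [← sub_eq_zero]
    exact d.eq_zero_of_mem_fil (by push_cast; omega)
      (h (2 * d.bound + 1) d.bound u (d.mem_loops_top u le_rfl))
  rw [← sub_eq_zero]
  refine loop_ext fun t => ?_
  rw [map_zero]
  refine d.eq_zero_of_lie_gr fun i v hv => ?_
  obtain ⟨w, -, hw⟩ := hB.exists_apply_eq (const_mem_loops (d.gr_le_fil (le_refl i) hv))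
  have h1 := h0 (WAlg.conn ε z w)
  rw [hA.conn, hB.conn, h0, hw, conn_apply, conn_apply, add_right_inj, ← sub_eq_zero,
    ← sub_lie] at h1
  have h2 := congrArg (ev t) h1
  rwa [ev_lie, ev_const, map_zero] at h2

end Unique

end ReductionData

/-! ### The projection to `Q` along gauge orbits -/

namespace ReductionData
variable {𝔤 : Type*} [LieRing 𝔤] [LieAlgebra ℂ 𝔤] (d : ReductionData 𝔤)
variable [FiniteDimensional ℂ 𝔤] (ε : ℂ)

/-- One step of the gauge fixing procedure. -/
def gaugeStep (z : Loop 𝔤) : Loop 𝔤 :=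
  ∑ k ∈ Finset.range d.order, gaugeTerm ε (-d.thetaL (z - const d.e)) z k

/-- The point of `Q` on the gauge orbit of `z`. -/
def toSlice (z : Loop 𝔤) : Loop 𝔤 := (d.gaugeStep ε)^[d.bound + 1] z

variable {ε} {z : Loop 𝔤}

theorem neg_thetaL_mem (hz : z - const d.e ∈ loops (d.fil 1)) :
    -d.thetaL (z - const d.e) ∈ loops (d.fil (-1)) := by
  have := d.thetaL_fil hz
  rw [show (1 : ℤ) - 2 = -1 by norm_num] at this
  exact neg_mem this

theorem gaugeStep_eq (hz : z - const d.e ∈ loops (d.fil 1)) :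
    d.gaugeStep ε z = gauge ε (-d.thetaL (z - const d.e)) z :=
  (d.gauge_eq (d.neg_thetaL_mem hz) ε z).symm

theorem mem_loops_fil_two (hz : z - const d.e ∈ loops (d.fil 1)) : z ∈ loops (d.fil 2) := by
  rw [← sub_add_cancel z (const d.e)]
  exact add_mem (loops_mono (d.fil_mono (by norm_num)) hz)
    (const_mem_loops (d.gr_le_fil le_rfl d.e_mem))

theorem gauge_sub_e_mem {m : Loop 𝔤} (hm : m ∈ loops (d.fil (-1)))
    (hz : z - const d.e ∈ loops (d.fil 1)) : gauge ε m z - const d.e ∈ loops (d.fil 1) := by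
  have h1 := d.gauge_sub_mem ε le_rfl hm (d.mem_loops_fil_two hz)
  have h2 := d.lie_mem_loops_fil hm (d.mem_loops_fil_two hz)
  have h3 := sub_mem (add_mem (loops_mono (d.fil_mono (by norm_num)) h1) hz)
    (loops_mono (d.fil_mono (by norm_num)) h2)
  have e : gauge ε m z - (z - ⁅m, z⁆) + (z - const d.e) - ⁅m, z⁆ = gauge ε m z - const d.e := by
    abel
  rwa [e] at h3

theorem gaugeStep_sub_e_mem (hz : z - const d.e ∈ loops (d.fil 1)) :
    d.gaugeStep ε z - const d.e ∈ loops (d.fil 1) := by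
  rw [d.gaugeStep_eq hz]
  exact d.gauge_sub_e_mem (d.neg_thetaL_mem hz) hz

/-- With m = -θ(s), to first order s becomes s - [e,θ(s)] ∈ L(𝔤_f). The errors have degree ≤ k + 1,
and `theta` lowers them to k - 1: one degree is gained per step. -/
theorem thetaL_gaugeStep_mem (hz : z - const d.e ∈ loops (d.fil 1)) {k : ℤ} (hk : k ≤ -1)
    (hθ : d.thetaL (z - const d.e) ∈ loops (d.fil k)) :
    d.thetaL (d.gaugeStep ε z - const d.e) ∈ loops (d.fil (k - 1)) := by
  rw [d.gaugeStep_eq hz]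
  set s := z - const d.e with hs
  have h1 := d.gauge_sub_mem ε hk (neg_mem hθ) (d.mem_loops_fil_two hz)
  have h2 := d.lie_mem_loops_fil hθ hz
  have e : gauge ε (-d.thetaL s) z - const d.e =
      (s - ⁅const d.e, d.thetaL s⁆) + ((gauge ε (-d.thetaL s) z - (z - ⁅-d.thetaL s, z⁆)) +
        ⁅d.thetaL s, s⁆) := by
    have hz' : z = const d.e + s := by rw [hs, add_sub_cancel]
    have h3 : ⁅d.thetaL s, z⁆ = ⁅d.thetaL s, s⁆ - ⁅const d.e, d.thetaL s⁆ := by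
      rw [hz', lie_add, ← lie_skew (const d.e)]
      abel
    rw [neg_lie, h3]
    nth_rw 3 [hz']
    abel
  have h0 : s - ⁅const d.e, d.thetaL s⁆ ∈ loops d.centralizer := mem_loops_iff.mpr fun x => by
    rw [map_sub, ev_lie, ev_const, d.ev_thetaL]
    exact d.sub_lie_theta_mem _
  rw [e, map_add, d.thetaL_centralizer h0, zero_add]
  exact loops_mono (d.fil_mono (by omega)) (d.thetaL_fil
    (add_mem h1 (loops_mono (d.fil_mono (by omega)) h2)))

theorem iterate_gaugeStep (hz : z - const d.e ∈ loops (d.fil 1)) (n : ℕ) :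
    ((d.gaugeStep ε)^[n] z - const d.e ∈ loops (d.fil 1) ∧
      d.thetaL ((d.gaugeStep ε)^[n] z - const d.e) ∈ loops (d.fil (-n - 1))) ∧
      ∃ A, d.IsGaugeMap ε A z ((d.gaugeStep ε)^[n] z) := by
  induction n with
  | zero =>
    refine ⟨⟨hz, ?_⟩, 1, d.isGaugeMap_one ε z⟩
    have := d.thetaL_fil hz
    norm_num at this
    simpa using this
  | succ n ih =>
    obtain ⟨⟨h1, h2⟩, A, hA⟩ := ih
    rw [Function.iterate_succ_apply']
    refine ⟨⟨d.gaugeStep_sub_e_mem h1, ?_⟩, _,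
      hA.comp (d.gaugeStep_eq h1 ▸ d.isGaugeMap_expNad ε (d.neg_thetaL_mem h1) _)⟩
    have := d.thetaL_gaugeStep_mem (ε := ε) h1 (by omega) h2
    push_cast
    rwa [show -((n : ℤ) + 1) - 1 = -n - 1 - 1 by ring]

theorem toSlice_mem (hz : z - const d.e ∈ loops (d.fil 1)) :
    d.toSlice ε z - const d.e ∈ loops d.centralizer :=
  d.mem_loops_centralizer_of_thetaL
    (d.eq_zero_of_mem_fil (by push_cast; omega) (d.iterate_gaugeStep hz (d.bound + 1)).1.2)

theorem gaugeTerm_zero_left (z : Loop 𝔤) (k : ℕ) :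
    gaugeTerm ε 0 z (k + 1) = 0 := by
  have h : nad (0 : Loop 𝔤) = 0 := by rw [nad, map_zero, neg_zero]
  rw [gaugeTerm, divPow_apply, h, map_zero, smul_zero, map_zero, smul_zero,
    zero_pow (Nat.succ_ne_zero k), LinearMap.zero_apply, smul_zero, add_zero]

theorem toSlice_of_mem (hz : z - const d.e ∈ loops d.centralizer) : d.toSlice ε z = z := by
  have h : d.gaugeStep ε z = z := by
    rw [gaugeStep, d.thetaL_centralizer hz, neg_zero, order, Finset.sum_range_succ',
      Finset.sum_eq_zero fun k _ => gaugeTerm_zero_left z k, zero_add, gaugeTerm]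
  exact Function.iterate_fixed h _

/-- The point of `Q` is the same along gauge orbits. -/
theorem toSlice_gauge [LieAlgebra.IsKilling ℂ 𝔤] {m : Loop 𝔤} (hm : m ∈ loops (d.fil (-1)))
    (hz : z - const d.e ∈ loops (d.fil 1)) :
    d.toSlice ε (gauge ε m z) = d.toSlice ε z := by
  have hz' := d.gauge_sub_e_mem (ε := ε) hm hz
  obtain ⟨A, hA⟩ := (d.iterate_gaugeStep (ε := ε) hz (d.bound + 1)).2
  obtain ⟨B, hB⟩ := (d.iterate_gaugeStep (ε := ε) hz' (d.bound + 1)).2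
  exact ((d.isGaugeMap_expNad ε hm z).comp hB).unique hA hz (d.toSlice_mem hz')
    (d.toSlice_mem hz)

end ReductionData

/-! ### Loops that depend polynomially on the fields -/

section LoopDP
variable {𝔤 : Type*} [LieRing 𝔤] [LieAlgebra ℂ 𝔤] [FiniteDimensional ℂ 𝔤] {σ : Type*}

/-- The components of the loop-valued map are differential polynomials. -/
def IsLoopDP (Z : (σ → CircleFun) → Loop 𝔤) : Prop :=
  ∀ ℓ : Module.Dual ℂ 𝔤, IsDP fun u => app ℓ (Z u)

namespace IsLoopDP
variable {Z W : (σ → CircleFun) → Loop 𝔤}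

theorem const (w : 𝔤) : IsLoopDP fun _ : σ → CircleFun => const w := fun ℓ => by
  have h : app ℓ (WAlg.const w) = algebraMap ℂ CircleFun (ℓ w) := by
    rw [WAlg.const, app_tmul, Algebra.algebraMap_eq_smul_one]
  simpa only [h] using isDP_algebraMap _

theorem add (h : IsLoopDP Z) (k : IsLoopDP W) : IsLoopDP fun u => Z u + W u := fun ℓ => by
  simpa only [map_add] using (h ℓ).add (k ℓ)

theorem smul (c : ℂ) (h : IsLoopDP Z) : IsLoopDP fun u => c • Z u := fun ℓ => by
  simpa only [app_smul_complex] using (h ℓ).smul c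

theorem neg (h : IsLoopDP Z) : IsLoopDP fun u => -Z u := by
  simpa only [neg_one_smul] using h.smul (-1)

theorem sub (h : IsLoopDP Z) (k : IsLoopDP W) : IsLoopDP fun u => Z u - W u := by
  simpa only [sub_eq_add_neg] using h.add k.neg

theorem tmul {F : (σ → CircleFun) → CircleFun} (h : IsDP F) (w : 𝔤) :
    IsLoopDP fun u => F u ⊗ₜ[ℂ] w := fun ℓ => by
  simpa only [app_tmul] using h.smul (ℓ w)

theorem sum {τ : Type*} (s : Finset τ) {Z : τ → (σ → CircleFun) → Loop 𝔤}
    (h : ∀ t ∈ s, IsLoopDP (Z t)) : IsLoopDP fun u => ∑ t ∈ s, Z t u := fun ℓ => by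
  simpa only [map_sum] using isDP_sum s fun t ht => h t ht ℓ

theorem loopDeriv (h : IsLoopDP Z) : IsLoopDP fun u => loopDeriv (Z u) := fun ℓ => by
  simpa only [app_loopDeriv] using (h ℓ).dx

theorem baseChange (T : 𝔤 →ₗ[ℂ] 𝔤) (h : IsLoopDP Z) :
    IsLoopDP fun u => T.baseChange CircleFun (Z u) := fun ℓ => by
  simpa only [app_baseChange] using h (ℓ ∘ₗ T)

theorem lie (h : IsLoopDP Z) (k : IsLoopDP W) : IsLoopDP fun u => ⁅Z u, W u⁆ := by
  let B := Module.finBasis ℂ 𝔤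
  have := IsLoopDP.sum Finset.univ fun i _ => IsLoopDP.sum Finset.univ fun j _ =>
    IsLoopDP.tmul ((h (B.coord i)).mul (k (B.coord j))) ⁅B i, B j⁆
  simp only [← LoopCurve.lie_eq_sum] at this
  exact this

theorem nad_pow (h : IsLoopDP Z) (k : IsLoopDP W) (n : ℕ) :
    IsLoopDP fun u => (ReductionData.nad (Z u) ^ n) (W u) := by
  induction n with
  | zero => exact k
  | succ n ih =>
    simp only [pow_succ', Module.End.mul_apply, ReductionData.nad_apply]
    exact (h.lie ih).neg

theorem gaugeTerm (ε : ℂ) (h : IsLoopDP Z) (k : IsLoopDP W) (n : ℕ) :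
    IsLoopDP fun u => ReductionData.gaugeTerm ε (Z u) (W u) n := by
  cases n with
  | zero => exact k
  | succ n =>
    exact ((h.nad_pow k (n + 1)).smul _).add ((h.nad_pow (h.loopDeriv.smul ε) n).smul _)

/-- The numbers of iterations and of series terms are fixed in advance, so gauge fixing is a
composite of differential polynomial operations. -/
theorem toSlice (d : ReductionData 𝔤) (ε : ℂ) (h : IsLoopDP Z) :
    IsLoopDP fun u => d.toSlice ε (Z u) := by
  have h1 : ∀ W : (σ → CircleFun) → Loop 𝔤, IsLoopDP W →
      IsLoopDP fun u => d.gaugeStep ε (W u) := fun W hW =>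
    IsLoopDP.sum _ fun n _ =>
      IsLoopDP.gaugeTerm ε ((hW.sub (IsLoopDP.const d.e)).baseChange d.theta).neg hW n
  have h2 : ∀ n : ℕ, IsLoopDP fun u => (d.gaugeStep ε)^[n] (Z u) := by
    intro n
    induction n with
    | zero => exact h
    | succ n ih =>
      simp only [Function.iterate_succ_apply']
      exact h1 _ ih
  exact h2 _

end IsLoopDP

end LoopDP

/-! ### Derivative of gauge transformations -/

section GaugeCurve
variable {𝔤 : Type*} [LieRing 𝔤] [LieAlgebra ℂ 𝔤] [FiniteDimensional ℂ 𝔤]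
open ReductionData

theorem loopCurve_line (m : Loop 𝔤) : LoopCurve (fun θ : ℂ => θ • m) m := fun ℓ => by
  simpa only [zero_add, app_smul_complex] using PolyCurve.line 0 (app ℓ m)

/-- The n-th power carries θ^n, so at θ = 0 only n = 0 and n = 1 contribute to first order. -/
theorem loopCurve_nad_pow (m : Loop 𝔤) {u : ℂ → Loop 𝔤} {u' : Loop 𝔤} (h : LoopCurve u u')
    (n : ℕ) : LoopCurve (fun θ : ℂ => (nad (θ • m) ^ n) (u θ))
      (if n = 0 then u' else if n = 1 then nad m (u 0) else 0) := by
  induction n with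
  | zero => exact h
  | succ n ih =>
    have h1 := ((loopCurve_line m).lie ih).smul (-1)
    simp only [zero_smul, zero_lie, add_zero, neg_one_smul] at h1
    simp only [pow_succ', Module.End.mul_apply, nad_apply]
    convert h1 using 1
    rcases n with _ | n
    · simp
    · have : nad (0 : Loop 𝔤) = 0 := by rw [nad, map_zero, neg_zero]
      simp [this]

theorem loopCurve_gaugeTerm (ε : ℂ) (m z : Loop 𝔤) (n : ℕ) :
    LoopCurve (fun θ : ℂ => gaugeTerm ε (θ • m) z n)
      (if n = 1 then nad m z + ε • loopDeriv m else 0) := by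
  rcases n with _ | n
  · exact LoopCurve.const z
  · have h1 := (loopCurve_nad_pow m (LoopCurve.const z) (n + 1)).smul
      ((n + 1).factorial : ℂ)⁻¹
    have h2 := (loopCurve_nad_pow m ((loopCurve_line m).loopDeriv.smul ε) n).smul
      ((n + 1).factorial : ℂ)⁻¹
    have e : ((n + 1).factorial : ℂ)⁻¹ •
          (if n + 1 = 0 then (0 : Loop 𝔤) else if n + 1 = 1 then nad m z else 0) +
        ((n + 1).factorial : ℂ)⁻¹ • (if n = 0 then ε • loopDeriv m else
          if n = 1 then nad m (ε • loopDeriv ((0 : ℂ) • m)) else 0) =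
        if n + 1 = 1 then nad m z + ε • loopDeriv m else 0 := by
      rcases n with _ | _ | n <;> simp
    rw [← e]
    exact h1.add h2

end GaugeCurve

/-! ### Extensions of functionals and reduction of the pencil -/

section Reduction
variable {𝔤 : Type*} [LieRing 𝔤] [LieAlgebra ℂ 𝔤] [FiniteDimensional ℂ 𝔤]
  [LieAlgebra.IsSimple ℂ 𝔤]
variable {ι κ : Type*} [Fintype ι] [Fintype κ] [DecidableEq ι] [DecidableEq κ]
variable {d : ReductionData 𝔤} {ξ : Module.Basis (ι ⊕ κ) ℂ 𝔤}

/-! ### Gradients in coordinates -/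

theorem coords_eq (z : Loop 𝔤) : coords d ξ z = fun I => cf ξ I (z - const d.e) := by
  funext I
  rw [coords, pairing_comm, pairing_const_left, cf]

theorem loopForm_sum_dual (φ : ι ⊕ κ → CircleFun) (s : Loop 𝔤) :
    loopForm (∑ I, φ I ⊗ₜ[ℂ] dual ξ I) s = ∑ I, circleInt (φ I * cf ξ I s) := by
  rw [loopForm_eq, map_sum, LinearMap.sum_apply]
  exact Finset.sum_congr rfl fun I _ => loopForm_tmul_left _ _ _

theorem isGradient_loopFunctional (P : DiffPoly (ι ⊕ κ)) (z : Loop 𝔤) :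
    IsGradient (loopFunctional d ξ P) z
      (∑ I, euler P I (coords d ξ z) ⊗ₜ[ℂ] dual ξ I) := by
  intro s
  rw [loopForm_sum_dual]
  have h := isVarDeriv_euler P (coords d ξ z) fun I => cf ξ I s
  have e : ∀ θ : ℂ, coords d ξ (z + θ • s) = coords d ξ z + θ • fun I => cf ξ I s := by
    intro θ
    funext I
    rw [coords_eq, coords_eq, Pi.add_apply, Pi.smul_apply, add_sub_right_comm]
    beta_reduce
    rw [map_add]
    congr 1
    exact app_smul_complex _ _ _
  simp only [loopFunctional, e]
  exact h

theorem gradient_loopFunctional (P : DiffPoly (ι ⊕ κ)) (z : Loop 𝔤) :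
    gradient (loopFunctional d ξ P) z = ∑ I, euler P I (coords d ξ z) ⊗ₜ[ℂ] dual ξ I :=
  (isGradient_loopFunctional P z).gradient_eq

theorem hasDerivAt_loopFunctional (P : DiffPoly (ι ⊕ κ)) {z : Loop 𝔤} {γ : ℂ → Loop 𝔤}
    {γ' : Loop 𝔤} (h : LoopCurve γ γ') (h0 : γ 0 = z) :
    HasDerivAt (fun θ => loopFunctional d ξ P (γ θ))
      (loopForm (gradient (loopFunctional d ξ P) z) γ') 0 := by
  rw [gradient_loopFunctional, loopForm_sum_dual]
  have h1 : ∀ I, PolyCurve (fun θ => coords d ξ (γ θ) I) (cf ξ I γ') := by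
    intro I
    simp only [coords_eq, sub_eq_add_neg]
    have := (h.add (LoopCurve.const (-const d.e))) (killingForm ℂ 𝔤 (dual ξ I))
    rwa [add_zero] at this
  exact hasDerivAt_localFunctional P (coords d ξ z) h1 fun I => by rw [h0]

/-! ### Gauge invariant extensions -/

/-- A density which is constant along the gauge orbits of `L(⨁_{i < 0} 𝔤_i)` defines a functional
which is constant along the second Poisson tensor applied to `L(n)`. -/
theorem loopForm_gradient_eq_zero {ε : ℂ} (hε : ε ≠ 0) {P : DiffPoly (ι ⊕ κ)} {z : Loop 𝔤}
    (h : ∀ m ∈ loops (d.fil (-1)),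
      evalJet 1 P (coords d ξ (gauge ε m z)) = evalJet 1 P (coords d ξ z))
    {v : Loop 𝔤} (hv : v ∈ loops (d.fil (-1))) :
    loopForm (gradient (loopFunctional d ξ P) z) (P₂ ε z v) = 0 := by
  -- The infinitesimal gauge action -[m,z] + ε m_x equals P₂(z)(ε m), hence the factor ε⁻¹.
  set m := ε⁻¹ • v with hm
  have hmem : ∀ θ : ℂ, θ • m ∈ loops (d.fil (-1)) := fun θ =>
    smul_mem_loops θ (smul_mem_loops _ hv)
  have h1 : LoopCurve (fun θ : ℂ => gauge ε (θ • m) z) (P₂ ε z v) := by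
    simp only [d.gauge_eq (hmem _)]
    have := LoopCurve.sum (Finset.range d.order) fun n _ =>
      loopCurve_gaugeTerm ε m z n
    rw [Finset.sum_ite_eq' , if_pos (by simp [ReductionData.order])] at this
    have e : P₂ ε z v = ReductionData.nad m z + ε • loopDeriv m := by
      rw [P₂, ReductionData.nad_apply, hm, map_smul, smul_inv_smul₀ hε, smul_add,
        inv_smul_smul₀ hε, smul_lie, ← smul_neg, lie_skew, add_comm]
    rwa [e]
  have h0 : gauge ε ((0 : ℂ) • m) z = z := by
    rw [d.gauge_eq (hmem 0), ReductionData.order, Finset.sum_range_succ', zero_smul,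
      Finset.sum_eq_zero fun k _ => ReductionData.gaugeTerm_zero_left z k, zero_add,
      ReductionData.gaugeTerm]
  have h2 := hasDerivAt_loopFunctional (d := d) (ξ := ξ) P h1 h0
  have h3 : (fun θ : ℂ => loopFunctional d ξ P (gauge ε (θ • m) z)) =
      fun _ => loopFunctional d ξ P z := by
    funext θ
    rw [loopFunctional, localFunctional, h _ (hmem θ)]
    rfl
  rw [h3] at h2
  exact h2.unique (hasDerivAt_const 0 _)

variable (hξ : Submodule.span ℂ (Set.range fun i : ι => ξ (Sum.inl i)) = d.centralizer)

theorem exists_evalJet_toSlice (d : ReductionData 𝔤) (ξ : Module.Basis (ι ⊕ κ) ℂ 𝔤) (ε : ℂ)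
    (p : DiffPoly ι) : ∃ P : DiffPoly (ι ⊕ κ), ∀ z, evalJet 1 P (coords d ξ z) =
      evalJet 1 p fun i => coords d ξ (d.toSlice ε z) (Sum.inl i) := by
  have h1 : IsLoopDP fun u : ι ⊕ κ → CircleFun => const d.e + ∑ I, u I ⊗ₜ[ℂ] ξ I :=
    (IsLoopDP.const d.e).add (IsLoopDP.sum _ fun I _ => IsLoopDP.tmul (isDP_coord I) (ξ I))
  have h2 := IsDP.evalJet 1 p fun i : ι =>
    ((h1.toSlice d ε).sub (IsLoopDP.const d.e)) (killingForm ℂ 𝔤 (dual ξ (Sum.inl i)))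
  obtain ⟨P, hP⟩ := h2
  refine ⟨P, fun z => ?_⟩
  rw [← hP]
  beta_reduce
  have hz : const d.e + ∑ I, coords d ξ z I ⊗ₜ[ℂ] ξ I = z := by
    rw [coords_eq, ← eq_sum_cf, add_sub_cancel]
  rw [hz, coords_eq (d.toSlice ε z)]
  rfl

theorem coords_slice (q : ι → CircleFun) (i : ι) :
    coords d ξ (slice d ξ q) (Sum.inl i) = q i := by
  rw [coords_eq, slice]
  beta_reduce
  rw [add_sub_cancel_left, map_sum, Finset.sum_eq_single i]
  · rw [cf_tmul, if_pos rfl]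
  · intro j _ hj
    rw [cf_tmul, if_neg (by simpa using hj)]
  · simp

include hξ

theorem slice_sub_e_mem (q : ι → CircleFun) : slice d ξ q - const d.e ∈ loops d.centralizer := by
  rw [slice, add_sub_cancel_left]
  exact sum_mem_centralizer hξ q

/-- The pulled-back density is invariant under all loops of negative degree. This covers 𝔪, for
gauge invariance, and the possibly larger 𝔫, for constancy along D. -/
theorem exists_extension {ε : ℂ} (hε : ε ≠ 0) (p : DiffPoly ι) :
    ∃ P : DiffPoly (ι ⊕ κ), IsExtension d ξ ε P p ∧ IsGaugeInvariant d ξ ε P := by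
  obtain ⟨P, hP⟩ := exists_evalJet_toSlice d ξ ε p
  have hs : ∀ s ∈ loops d.b, const d.e + s - const d.e ∈ loops (d.fil 1) := fun s hs => by
    rw [add_sub_cancel_left]
    exact loops_mono d.b_le_fil hs
  have hinv : ∀ m ∈ loops (d.fil (-1)), ∀ s ∈ loops d.b,
      evalJet 1 P (coords d ξ (gauge ε m (const d.e + s))) =
        evalJet 1 P (coords d ξ (const d.e + s)) := by
    intro m hm s hs'
    rw [hP, hP, d.toSlice_gauge hm (hs s hs')]
  refine ⟨P, ⟨fun q => ?_, fun s hs' v hv => ?_⟩, fun m hm s hs' => ?_⟩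
  · rw [loopFunctional, localFunctional, localFunctional, hP,
      d.toSlice_of_mem (slice_sub_e_mem hξ q)]
    simp only [coords_slice]
  · exact loopForm_gradient_eq_zero hε (fun m hm => hinv m hm s hs')
      (loops_mono d.nil_le_fil hv)
  · exact hinv m (loops_mono (d.gaugeAlg_le_nil.trans d.nil_le_fil) hm) s hs'

/-! ### The reduction of the pencil -/

/-- Differentiating the restriction to Q only sees the gradient paired with 𝔤_f, that is, the
gradient modulo L([f,𝔤]). -/
theorem dcf_gradient {ε : ℂ} {P : DiffPoly (ι ⊕ κ)} {p : DiffPoly ι}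
    (h : IsExtension d ξ ε P p) (q : ι → CircleFun) (i : ι) :
    dcf ξ (Sum.inl i) (gradient (loopFunctional d ξ P) (slice d ξ q)) = euler p i q := by
  have h1 : IsVarDeriv (localFunctional p) q fun i =>
      dcf ξ (Sum.inl i) (gradient (loopFunctional d ξ P) (slice d ξ q)) := by
    intro s
    have h2 : LoopCurve (fun θ : ℂ => slice d ξ (q + θ • s))
        (∑ i, s i ⊗ₜ[ℂ] ξ (Sum.inl i)) := by
      have := loopCurve_shift (d := d) (ξ := ξ) 0 q s
      simpa only [← slice_add, zero_smul, add_zero] using this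
    have h3 := hasDerivAt_loopFunctional (d := d) (ξ := ξ) P h2 (z := slice d ξ q) (by simp)
    simp only [h.1] at h3
    convert h3 using 1
    rw [loopForm_eq, map_sum]
    refine Finset.sum_congr rfl fun i _ => ?_
    rw [← loopForm_eq, loopForm_comm, loopForm_tmul_left, mul_comm]
    rfl
  exact congrFun (h1.unique (isVarDeriv_euler p q)) i

/-- Skew-adjointness moves the connection from L(𝔫) to the gradient, and orthogonality to L(𝔫) means
values in 𝔟. -/
theorem conn_gradient_mem {ε : ℂ} (hε : ε ≠ 0) {P : DiffPoly (ι ⊕ κ)} {p : DiffPoly ι}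
    (h : IsExtension d ξ ε P p) (q : ι → CircleFun) :
    conn ε (slice d ξ q) (gradient (loopFunctional d ξ P) (slice d ξ q)) ∈ loops d.b := by
  have h1 : ∀ v ∈ loops d.nil, loopForm v
      (conn ε (slice d ξ q) (gradient (loopFunctional d ξ P) (slice d ξ q))) = 0 := by
    intro v hv
    have hs : ∑ i, q i ⊗ₜ[ℂ] ξ (Sum.inl i) ∈ loops d.b :=
      loops_mono (d.centralizer_le_fil.trans d.fil_le_b) (sum_mem_centralizer hξ q)
    have h2 : loopForm (gradient (loopFunctional d ξ P) (slice d ξ q))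
        (P₂ ε (slice d ξ q) v) = 0 := h.2 _ hs v hv
    rw [P₂, ← conn_apply, loopForm_eq, map_smul, smul_eq_zero,
      or_iff_right (inv_ne_zero hε), ← loopForm_eq, ← neg_eq_zero, ← loopForm_conn,
      loopForm_comm] at h2
    exact h2
  refine mem_loops_iff.mpr fun x y hy => ?_
  rw [killingForm_symm]
  exact killingForm_ev_eq_zero h1 x hy

/-- The pencil reduces to the bracket defined by `reducedOp`. -/
theorem tensorBracket_pencil (c : ℂ) {ε : ℂ} (hε : ε ≠ 0) {P R : DiffPoly (ι ⊕ κ)}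
    {p r : DiffPoly ι} (hP : IsExtension d ξ ε P p) (hR : IsExtension d ξ ε R r)
    (q : ι → CircleFun) :
    tensorBracket (pencil d.a c ε) (loopFunctional d ξ P) (loopFunctional d ξ R) (slice d ξ q) =
      opBracket ε (reducedOp d ξ c) (localFunctional p) (localFunctional r) q := by
  have hdiff : ∀ {P : DiffPoly (ι ⊕ κ)} {p : DiffPoly ι}, IsExtension d ξ ε P p →
      gradient (loopFunctional d ξ P) (slice d ξ q) -
        ∑ i, euler p i q ⊗ₜ[ℂ] dual ξ (Sum.inl i) ∈ loops d.imF := by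
    intro P p h
    refine mem_imF_of_dcf hξ fun i => ?_
    rw [map_sub, dcf_gradient hξ h, map_sum, Finset.sum_eq_single i, dcf_tmul, if_pos rfl,
      sub_self]
    · intro j _ hj
      rw [dcf_tmul, if_neg (by simpa using hj.symm)]
    · simp
  have hs : slice d ξ q = const d.e + shift d ξ 0 q := by
    rw [← slice_add, zero_smul, add_zero]
  have h1 := conn_gradient_mem hξ hε hP q
  have h2 := conn_gradient_mem hξ hε hR q
  have h3 := hdiff hP
  have h4 := hdiff hR
  have e : shift d ξ 0 q + c • const d.a = shift d ξ c q := by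
    rw [shift, shift, zero_smul, add_zero]
  rw [tensorBracket, pencil_eq, opBracket_eq_loopForm hξ, hamVec, hamVec,
    d.loopForm_lift ε (shift_mem hξ c q), loopForm_eq, map_smul, ← loopForm_eq, smul_eq_mul]
  rw [hs] at h1 h2 h3 h4 ⊢
  rw [d.loopForm_eq_lift ε (shift_mem hξ 0 q) c h1 h2 h3 h4, e]

end Reduction

/-! ### Dependence of the bracket on its operator -/

section Operators
variable {ι : Type*} [Fintype ι]

theorem opBracket_congr {ε : ℂ} {K K' : MatDiffOp ι ι ι}
    (h : ∀ q i j φ, (K i j).act ε q φ = (K' i j).act ε q φ) (f g : (ι → CircleFun) → ℂ) :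
    opBracket ε K f g = opBracket ε K' f g := by
  funext q
  simp only [opBracket, h]

theorem opBracket_sub (ε : ℂ) (K K' : MatDiffOp ι ι ι) (f g : (ι → CircleFun) → ℂ)
    (q : ι → CircleFun) :
    opBracket ε (K - K') f g q = opBracket ε K f g q - opBracket ε K' f g q := by
  have e : ∀ i j φ, ((K - K') i j).act ε q φ = (K i j).act ε q φ - (K' i j).act ε q φ := by
    intro i j φ
    have : (K - K') i j = K i j + (-1 : ℂ) • K' i j := by
      rw [neg_one_smul, ← sub_eq_add_neg]
      rfl
    rw [this, DiffOp.add_act, DiffOp.smul_act, neg_one_smul, ← sub_eq_add_neg]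
  simp only [opBracket, e, mul_sub, circleInt_eq, map_sub, Finset.sum_sub_distrib]

theorem IsLocalPoisson.congr {ε : ℂ} {K K' : MatDiffOp ι ι ι} (h : IsLocalPoisson ε K)
    (e : ∀ q i j φ, (K' i j).act ε q φ = (K i j).act ε q φ) : IsLocalPoisson ε K' where
  closed p q := by rw [opBracket_congr e]; exact h.closed p q
  skew p q := by simp only [opBracket_congr e]; exact h.skew p q
  jacobi p q r := by simp only [opBracket_congr e]; exact h.jacobi p q r

end Operators

end WAlg
end

theorem proposition3p9 {𝔤 : Type*} [LieRing 𝔤] [LieAlgebra ℂ 𝔤] [FiniteDimensional ℂ 𝔤]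
    [LieAlgebra.IsSimple ℂ 𝔤]
    {ι κ : Type*} [Fintype ι] [Fintype κ] [DecidableEq ι] [DecidableEq κ]
    (d : WAlg.ReductionData 𝔤) (ξ : Module.Basis (ι ⊕ κ) ℂ 𝔤)
    (hξ : Submodule.span ℂ (Set.range fun i : ι => ξ (Sum.inl i)) = d.centralizer) :
    ∃ K₁ K₂ : WAlg.MatDiffOp ι ι ι,
      (∀ ε : ℂ, ε ≠ 0 →
        WAlg.IsReducedOperator d ξ ε (WAlg.P₁ d.a ε) K₁ ∧
        WAlg.IsReducedOperator d ξ ε (WAlg.P₂ ε) K₂) ∧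
      ∀ c : ℂ, ∃ S : WAlg.MatDiffOp ι κ κ, ∀ ε : ℂ, ε ≠ 0 →
        WAlg.IsMinorInverse d ξ c ε S ∧
        (∀ (q : ι → WAlg.CircleFun) (i j : ι) (φ : WAlg.CircleFun),
          WAlg.diracOp d ξ c ε S q i j φ = (K₂ i j + c • K₁ i j).act ε q φ) ∧
        WAlg.IsLocalPoisson ε (K₂ + c • K₁) ∧
        WAlg.IsReducedOperator d ξ ε (WAlg.pencil d.a c ε) (K₂ + c • K₁) := by
  have htb : ∀ (c ε : ℂ) (F G : WAlg.Loop 𝔤 → ℂ) (z : WAlg.Loop 𝔤),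
      WAlg.tensorBracket (WAlg.pencil d.a c ε) F G z = WAlg.tensorBracket (WAlg.P₂ ε) F G z +
        c * WAlg.tensorBracket (WAlg.P₁ d.a ε) F G z := fun c ε F G z => by
    simp only [WAlg.tensorBracket, WAlg.pencil, WAlg.loopForm_eq]
    rw [map_add, map_smul, smul_eq_mul]
  -- P₁ is the difference of the pencil at parameters 1 and 0, which dictates the witness for its
  -- reduction; P₂ is the pencil at 0.
  refine ⟨WAlg.reducedOp d ξ 1 - WAlg.reducedOp d ξ 0, WAlg.reducedOp d ξ 0,
    fun ε hε => ⟨⟨WAlg.exists_extension hξ hε, fun p r P R hP hR q => ?_⟩,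
      ⟨WAlg.exists_extension hξ hε, fun p r P R hP hR q => ?_⟩⟩,
    fun c => ⟨WAlg.minorInverse d ξ c, fun ε hε => ?_⟩⟩
  · rw [WAlg.opBracket_sub, ← WAlg.tensorBracket_pencil hξ 1 hε hP hR,
      ← WAlg.tensorBracket_pencil hξ 0 hε hP hR, htb, htb]
    ring
  · rw [← WAlg.tensorBracket_pencil hξ 0 hε hP hR, htb, zero_mul, add_zero]
  · have e := WAlg.reducedOp_affine hξ c ε
    refine ⟨WAlg.isMinorInverse_minorInverse hξ c hε, fun q i j φ => ?_,
      (WAlg.isLocalPoisson_reducedOp hξ c hε).congr e,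
      WAlg.exists_extension hξ hε, fun p r P R hP hR q => ?_⟩
    · rw [WAlg.diracOp_minorInverse hξ c hε]
      exact (e q i j φ).symm
    · rw [WAlg.tensorBracket_pencil hξ c hε hP hR, WAlg.opBracket_congr e]
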